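/- Let $N\ge 2$ be an integer, $M\in\frac12\mathbb N_0$, and $a,b,\omega\in\mathbb R$; all indices in $\{1,\dots,N\}$ are cyclic ($N+1\equiv1$, $0\equiv N$). Let $\Sigma$ be the complex spin space with basis $|s_1,\dots,s_N\rangle$, $s_i\in\{-M,-M+1,\dots,M\}$, let $S_{ij}$ be the operator on $\Sigma$ exchanging $s_i$ and $s_j$, let $K_{ij}$ be the operator on functions exchanging the $i$-th and the $j$-th coordinate, and let $\Lambda$ be the projection onto the states that are symmetric under simultaneous permutations of coordinates and spins. Write $\Lambda(z_1z_2|s\rangle)=\sum_{i<j}z_iz_j|s_{ij}\rangle$ with $|s_{ij}\rangle=|s_{ji}\rangle\in\Sigma$, and let $\Sigma'\subset\Sigma$ be the space of those $|s\rangle$ for which $\sum_i|s_{i,i+1}\rangle$ is invariant under all permutations of the spins. Put $\sigma_k=\sum_iz_i^k$ and $\tau_k=\sum_{i_1<\dots<i_k}z_{i_1}\cdots z_{i_k}$. For $\epsilon=0,1,2$ let $$T_\epsilon=\sum_iz_i^\epsilon\partial_{z_i}^2+2a\sum_i\frac{z_i^\epsilon\partial_{z_i}-z_{i+1}^\epsilon\partial_{z_{i+1}}}{z_i-z_{i+1}}-2a\sum_i\frac{\vartheta_\epsilon(z_i,z_{i+1})}{(z_i-z_{i+1})^2}(1-K_{i,i+1}),$$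 with $\vartheta_0=1$, $\vartheta_1(x,y)=\frac12(x+y)$, $\vartheta_2(x,y)=xy$, and let $\overline H_\epsilon=cT_\epsilon+c_-\sum_i\partial_{z_i}+c_0\sum_iz_i\partial_{z_i}+E_0$ with $(c,c_-,c_0,E_0)$ equal to $(-1,\,0,\,2\omega,\,N\omega(2a+1))$ for $\epsilon=0$, to $(-4,\,-2(2b+1),\,4\omega,\,N\omega(4a+2b+1))$ for $\epsilon=1$, and to $(4,\,0,\,4(1-2a),\,2Na^2)$ for $\epsilon=2$. The operator $\overline H_\epsilon$ acts on $\mathbb C[z_1,\dots,z_N]\otimes\Sigma$ through the first factor (a priori with values in rational functions). For $n\ge0$ define linear spaces $\overline{\mathcal H}{}^n_\epsilon\subset\mathbb C[z_1,\dots,z_N]\otimes\Sigma$ as follows. Here $f,g,h,\tilde h,q$ are polynomials in the indicated arguments, regarded as independent variables, subscripts denote partial derivatives with respect to $\sigma_k$ ($k=1,2,3$) or $\tau_k$ ($k=N-1,N$), $|s\rangle\in\Sigma$ and $|s'\rangle\in\Sigma'$ are arbitrary, $\deg$ is the total degree in $z$, and $\deg f\le n$, $\deg g\le n-1$, $\deg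 h\le n-2$, $\deg\tilde h\le n-2$, $\deg q\le n-N+1$: - $\overline{\mathcal H}{}^n_0$ is spanned by the states $f(\sigma_1,\sigma_2,\sigma_3)\Lambda|s\rangle$, $g(\sigma_1,\sigma_2,\sigma_3)\Lambda(z_1|s\rangle)$, $h(\sigma_1,\sigma_2)\Lambda(z_1^2|s\rangle)$, $\tilde h(\sigma_1,\sigma_2)\Lambda(z_1z_2|s'\rangle)$ with $f_{33}=g_{33}=0$; - $\overline{\mathcal H}{}^n_1$ is spanned by the states $f(\sigma_1,\sigma_2,\tau_N)\Lambda|s\rangle$, $g(\sigma_1,\tau_N)\Lambda(z_1|s\rangle)$ with $f_{22}=0$ and $f_N=g_N=0$; - $\overline{\mathcal H}{}^n_2$ is spanned by the states $f(\sigma_1,\tau_{N-1},\tau_N)\Lambda|s\rangle$, $g(\tau_{N-1},\tau_N)\Lambda(z_1|s\rangle)$, $\tau_Nq(\sigma_1,\tau_N)\Lambda(z_1^{-1}|s\rangle)$ with $f_{11}=f_{N-1,N-1}=g_{N-1,N-1}=q_{11}=0$. Then for every $\epsilon\in\{0,1,2\}$ and every $n\ge 0$: 1. $\overline H_\epsilon$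 maps $\overline{\mathcal H}{}^n_\epsilon$ into itself. 2. Let $H_\epsilon=-\sum_i\partial_{x_i}^2+V_\epsilon$, where, with $r^2=\sum_ix_i^2$, $$V_0=\omega^2r^2+\sum_i\frac{2a^2}{(x_i-x_{i-1})(x_i-x_{i+1})}+\sum_i\frac{2a}{(x_i-x_{i+1})^2}(a-S_{i,i+1}),$$ $$V_1=\omega^2r^2+\sum_i\frac{b(b-1)}{x_i^2}+\sum_i\frac{8a^2x_i^2}{(x_i^2-x_{i-1}^2)(x_i^2-x_{i+1}^2)}+4a\sum_i\frac{x_i^2+x_{i+1}^2}{(x_i^2-x_{i+1}^2)^2}(a-S_{i,i+1}),$$ $$V_2=2a^2\sum_i\cot(x_i-x_{i-1})\cot(x_i-x_{i+1})+2a\sum_i\csc^2(x_i-x_{i+1})(a-S_{i,i+1}),$$ on the set $C_\epsilon$ of all real $x_1<\dots<x_N$, with in addition $x_1>0$ for $\epsilon=1$ and $\sin|x_i-x_{i+1}|>0$ for all $i$ for $\epsilon=2$. Let $\mu$ be $e^{-\omega r^2/2}\prod_i|x_i-x_{i+1}|^a$, $e^{-\omega r^2/2}\prod_i|x_i^2-x_{i+1}^2|^ax_i^b$,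 $\prod_i\sin^a|x_i-x_{i+1}|$, and let $\zeta(x)$ be $x$, $x^2$, $e^{\pm2\mathrm ix}$ (either sign), for $\epsilon=0,1,2$ respectively. Then for all $\Phi\in\overline{\mathcal H}{}^n_\epsilon$, $$H_\epsilon\big(\mu\,\Phi|_{z_i=\zeta(x_i)}\big)=\mu\,(\overline H_\epsilon\Phi)|_{z_i=\zeta(x_i)}\quad\text{on }C_\epsilon .$$ 3. Consequently, if $0\ne\Phi\in\overline{\mathcal H}{}^n_\epsilon$ and $\overline H_\epsilon\Phi=E\Phi$ with $E\in\mathbb C$, then $\Psi=\mu\,\Phi|_{z_i=\zeta(x_i)}$ is smooth and not identically zero on $C_\epsilon$ and satisfies $H_\epsilon\Psi=E\Psi$ there. -/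

import Mathlib

open scoped BigOperators

namespace QES

noncomputable section

/-! ### Spin space, spin-valued polynomials, symmetrizer -/

/-- Labels `(s_1, …, s_N)` of the basis vectors `|s_1, …, s_N⟩` for `N` particles of spin `M`, where
`k = 2M`; the `k + 1 = 2M + 1` values `-M, -M+1, …, M` are numbered `0, …, k`. -/
abbrev Config (N k : ℕ) : Type := Fin N → Fin (k + 1)

/-- The spin space `Σ`, in coordinates with respect to the basis `|s_1, …, s_N⟩`. -/
abbrev Spin (N k : ℕ) : Type := Config N k → ℂ

/-- The action of permutations on the spin space: `|s⟩ ↦ |s ∘ π⁻¹⟩` (the spin of particle `i` is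
moved to particle `π i`). -/
def spinPerm {N k : ℕ} (π : Equiv.Perm (Fin N)) (v : Spin N k) : Spin N k :=
  fun s => v (fun i => s (π i))

/-- The spin exchange operator `S_{ij}`. -/
def spinExchange {N k : ℕ} (i j : Fin N) (v : Spin N k) : Spin N k :=
  spinPerm (Equiv.swap i j) v

/-- Complex polynomials in `z_1, …, z_N`. -/
abbrev Poly (N : ℕ) : Type := MvPolynomial (Fin N) ℂ

/-- Rational functions in `z_1, …, z_N`. -/
abbrev RatFun (N : ℕ) : Type := FractionRing (Poly N)

/-- `ℂ[z_1, …, z_N] ⊗ Σ`: polynomial spin states, in coordinates. -/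
abbrev State (N k : ℕ) : Type := Config N k → Poly N

/-- The decomposable state `p(z) |v⟩`. -/
def prodState {N k : ℕ} (p : Poly N) (v : Spin N k) : State N k :=
  fun s => v s • p

/-- The simultaneous permutation of the coordinates (`z_i ↦ z_{π i}`) and of the spins. -/
def totalPerm {N k : ℕ} (π : Equiv.Perm (Fin N)) (Φ : State N k) : State N k :=
  fun s => MvPolynomial.rename π (Φ (fun i => s (π i)))

/-- The projection `Λ` on the totally symmetric states. -/
def symmetrize {N k : ℕ} (Φ : State N k) : State N k :=
  ((N.factorial : ℂ)⁻¹) • ∑ π : Equiv.Perm (Fin N), totalPerm π Φ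

/-- For `i ≠ j`, the spin vector `|s_{ij}⟩`, that is, the coefficient of `z_i z_j` in
`Λ(z_1 z_2 |s⟩)`. -/
def pairSpin {N k : ℕ} [NeZero N] (v : Spin N k) (i j : Fin N) : Spin N k :=
  fun s => MvPolynomial.coeff (Finsupp.single i 1 + Finsupp.single j 1)
    (symmetrize (prodState (MvPolynomial.X 0 * MvPolynomial.X 1) v) s)

/-- Membership in `Σ'`: the spin vector `∑_i |s_{i,i+1}⟩` (cyclic sum) is symmetric. -/
def IsSpecialSpin {N k : ℕ} [NeZero N] (v : Spin N k) : Prop :=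
  ∀ π : Equiv.Perm (Fin N),
    spinPerm π (∑ i : Fin N, pairSpin v i (i + 1)) = ∑ i : Fin N, pairSpin v i (i + 1)

/-! ### The gauge Hamiltonians -/

/-- The inclusion of polynomials in rational functions. -/
def toRat {N : ℕ} (p : Poly N) : RatFun N := algebraMap (Poly N) (RatFun N) p

/-- The functions `ϑ_0(x,y) = 1`, `ϑ_1(x,y) = (x + y)/2`, `ϑ_2(x,y) = x y`. -/
def theta {N : ℕ} (ε : Fin 3) (x y : RatFun N) : RatFun N :=
  match ε with
  | 0 => 1
  | 1 => (x + y) / 2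
  | 2 => x * y

open MvPolynomial in
/-- The differential-difference operator `T_ε` (indices are cyclic: `z_{N+1} = z_1`). -/
def opT {N : ℕ} [NeZero N] (ε : Fin 3) (a : ℝ) (f : Poly N) : RatFun N :=
  toRat (∑ i, X i ^ (ε : ℕ) * pderiv i (pderiv i f))
  + toRat (C (2 * a : ℂ)) *
      ∑ i : Fin N, toRat (X i ^ (ε : ℕ) * pderiv i f - X (i + 1) ^ (ε : ℕ) * pderiv (i + 1) f)
        / (toRat (X i) - toRat (X (i + 1)))
  - toRat (C (2 * a : ℂ)) *
      ∑ i : Fin N, theta ε (toRat (X i)) (toRat (X (i + 1)))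
        / (toRat (X i) - toRat (X (i + 1))) ^ 2
        * toRat (f - rename (Equiv.swap i (i + 1)) f)

/-- `J^- = ∑_i ∂_i`. -/
def opJminus {N : ℕ} (f : Poly N) : Poly N := ∑ i, MvPolynomial.pderiv i f

/-- `J^0 = ∑_i z_i ∂_i`. -/
def opJzero {N : ℕ} (f : Poly N) : Poly N :=
  ∑ i, MvPolynomial.X i * MvPolynomial.pderiv i f

/-- The constant `c`. -/
def constC (ε : Fin 3) : ℝ :=
  match ε with
  | 0 => -1
  | 1 => -4
  | 2 => 4

/-- The constant `c_-`. -/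
def constMinus (ε : Fin 3) (b : ℝ) : ℝ :=
  match ε with
  | 0 => 0
  | 1 => -2 * (2 * b + 1)
  | 2 => 0

/-- The constant `c_0`. -/
def constZero (ε : Fin 3) (a ω : ℝ) : ℝ :=
  match ε with
  | 0 => 2 * ω
  | 1 => 4 * ω
  | 2 => 4 * (1 - 2 * a)

/-- The constant `E_0`. -/
def constE (ε : Fin 3) (N : ℕ) (a b ω : ℝ) : ℝ :=
  match ε with
  | 0 => N * ω * (2 * a + 1)
  | 1 => N * ω * (4 * a + 2 * b + 1)
  | 2 => 2 * N * a ^ 2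

open MvPolynomial in
/-- The gauge Hamiltonian `c T_ε + c_- J^- + c_0 J^0 + E_0` on polynomials. -/
def gaugeHam {N : ℕ} [NeZero N] (ε : Fin 3) (a b ω : ℝ) (f : Poly N) : RatFun N :=
  toRat (C (constC ε : ℂ)) * opT ε a f
  + toRat (C (constMinus ε b : ℂ) * opJminus f)
  + toRat (C (constZero ε a ω : ℂ) * opJzero f)
  + toRat (C (constE ε N a b ω : ℂ) * f)

/-- `GaugeMaps ε a b ω Φ Ψ`: the gauge Hamiltonian maps the state `Φ` to the state `Ψ`
(it acts trivially on spin, i.e. componentwise). -/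
def GaugeMaps {N k : ℕ} [NeZero N] (ε : Fin 3) (a b ω : ℝ) (Φ Ψ : State N k) : Prop :=
  ∀ s, gaugeHam ε a b ω (Φ s) = toRat (Ψ s)

/-! ### The invariant spaces -/

/-- `σ_j = ∑_i z_i ^ j`. -/
def sigma (N j : ℕ) : Poly N := MvPolynomial.psum (Fin N) ℂ j

/-- `τ_j`, the `j`-th elementary symmetric polynomial. -/
def tau (N j : ℕ) : Poly N := MvPolynomial.esymm (Fin N) ℂ j

/-- The polynomial `τ_N / z_1`. -/
def tauOverFirst (N : ℕ) [NeZero N] : Poly N :=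
  ∏ i ∈ Finset.univ.erase (0 : Fin N), MvPolynomial.X i

/-- Substitution `f(p_0, p_1, …)` of polynomials in `z` into a formal polynomial `f`. -/
def substPoly {N m : ℕ} (p : Fin m → Poly N) (f : MvPolynomial (Fin m) ℂ) : Poly N :=
  MvPolynomial.aeval p f

open MvPolynomial in
/-- The space for `ε = 0`. The variables of `f`, `g` are `σ_1, σ_2, σ_3`, those of `h` are
`σ_1, σ_2`. -/
def space0 (N k n : ℕ) [NeZero N] : Submodule ℂ (State N k) :=
  Submodule.span ℂ (
    {Φ | ∃ (f : MvPolynomial (Fin 3) ℂ) (v : Spin N k),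
      pderiv 2 (pderiv 2 f) = 0 ∧
      (substPoly ![sigma N 1, sigma N 2, sigma N 3] f).totalDegree ≤ n ∧
      Φ = fun s => substPoly ![sigma N 1, sigma N 2, sigma N 3] f * symmetrize (prodState 1 v) s} ∪
    {Φ | ∃ (g : MvPolynomial (Fin 3) ℂ) (v : Spin N k),
      pderiv 2 (pderiv 2 g) = 0 ∧
      (substPoly ![sigma N 1, sigma N 2, sigma N 3] g).totalDegree + 1 ≤ n ∧
      Φ = fun s => substPoly ![sigma N 1, sigma N 2, sigma N 3] g * symmetrize (prodState (X 0) v) s} ∪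
    {Φ | ∃ (h : MvPolynomial (Fin 2) ℂ) (v : Spin N k),
      (substPoly ![sigma N 1, sigma N 2] h).totalDegree + 2 ≤ n ∧
      Φ = fun s => substPoly ![sigma N 1, sigma N 2] h * symmetrize (prodState (X 0 ^ 2) v) s} ∪
    {Φ | ∃ (h : MvPolynomial (Fin 2) ℂ) (v : Spin N k),
      IsSpecialSpin v ∧
      (substPoly ![sigma N 1, sigma N 2] h).totalDegree + 2 ≤ n ∧
      Φ = fun s => substPoly ![sigma N 1, sigma N 2] h * symmetrize (prodState (X 0 * X 1) v) s})

open MvPolynomial in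
/-- The space for `ε = 1`. The variables of `f` are `σ_1, σ_2, τ_N`, those of `g` are
`σ_1, τ_N`; `f` and `g` are restricted by `∂f/∂τ_N = ∂g/∂τ_N = 0`, which makes the conditions
`∂²f/∂τ_N² = ∂²g/∂τ_N² = 0` automatic. -/
def space1 (N k n : ℕ) [NeZero N] : Submodule ℂ (State N k) :=
  Submodule.span ℂ (
    {Φ | ∃ (f : MvPolynomial (Fin 3) ℂ) (v : Spin N k),
      pderiv 1 (pderiv 1 f) = 0 ∧ pderiv 2 f = 0 ∧
      (substPoly ![sigma N 1, sigma N 2, tau N N] f).totalDegree ≤ n ∧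
      Φ = fun s => substPoly ![sigma N 1, sigma N 2, tau N N] f * symmetrize (prodState 1 v) s} ∪
    {Φ | ∃ (g : MvPolynomial (Fin 2) ℂ) (v : Spin N k),
      pderiv 1 g = 0 ∧
      (substPoly ![sigma N 1, tau N N] g).totalDegree + 1 ≤ n ∧
      Φ = fun s => substPoly ![sigma N 1, tau N N] g * symmetrize (prodState (X 0) v) s})

open MvPolynomial in
/-- The space for `ε = 2`. The variables of `f` are `σ_1, τ_{N-1}, τ_N`, those of `g` are
`τ_{N-1}, τ_N`, those of `q` are `σ_1, τ_N`. The last family is `τ_N q Λ(z_1⁻¹ |s⟩)`, where the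
symmetric factor `τ_N` has been moved inside `Λ`. -/
def space2 (N k n : ℕ) [NeZero N] : Submodule ℂ (State N k) :=
  Submodule.span ℂ (
    {Φ | ∃ (f : MvPolynomial (Fin 3) ℂ) (v : Spin N k),
      pderiv 0 (pderiv 0 f) = 0 ∧ pderiv 1 (pderiv 1 f) = 0 ∧
      (substPoly ![sigma N 1, tau N (N - 1), tau N N] f).totalDegree ≤ n ∧
      Φ = fun s => substPoly ![sigma N 1, tau N (N - 1), tau N N] f * symmetrize (prodState 1 v) s} ∪
    {Φ | ∃ (g : MvPolynomial (Fin 2) ℂ) (v : Spin N k),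
      pderiv 0 (pderiv 0 g) = 0 ∧
      (substPoly ![tau N (N - 1), tau N N] g).totalDegree + 1 ≤ n ∧
      Φ = fun s => substPoly ![tau N (N - 1), tau N N] g * symmetrize (prodState (X 0) v) s} ∪
    {Φ | ∃ (q : MvPolynomial (Fin 2) ℂ) (v : Spin N k),
      pderiv 0 (pderiv 0 q) = 0 ∧
      (substPoly ![sigma N 1, tau N N] q).totalDegree + N ≤ n + 1 ∧
      Φ = fun s => substPoly ![sigma N 1, tau N N] q * symmetrize (prodState (tauOverFirst N) v) s})

/-- The space `H̄_ε^n`. -/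
def invSpace (N k n : ℕ) [NeZero N] (ε : Fin 3) : Submodule ℂ (State N k) :=
  match ε with
  | 0 => space0 N k n
  | 1 => space1 N k n
  | 2 => space2 N k n

/-! ### The physical Hamiltonians -/

/-- The configuration spaces. For `ε = 2` the poles of the potential, i.e. the points at which
some `sin (x_i - x_{i+1})` vanishes, are excluded, as well as the points at which some
`sin |x_i - x_{i+1}|` is negative, where the gauge factor would not be defined. -/
def configSpace (N : ℕ) [NeZero N] (ε : Fin 3) : Set (Fin N → ℝ) :=
  match ε with
  | 0 => {x | StrictMono x}
  | 1 => {x | StrictMono x ∧ 0 < x 0}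
  | 2 => {x | StrictMono x ∧ ∀ i, 0 < Real.sin |x i - x (i + 1)|}

/-- The potential `V_ε(x)`, an operator on the spin space (indices are cyclic). -/
def potential {N k : ℕ} [NeZero N] (ε : Fin 3) (a b ω : ℝ) (x : Fin N → ℝ) (v : Spin N k) :
    Spin N k :=
  match ε with
  | 0 => ((ω ^ 2 * ∑ i, x i ^ 2
        + ∑ i, 2 * a ^ 2 / ((x i - x (i - 1)) * (x i - x (i + 1))) : ℝ) : ℂ) • v
      + ∑ i, ((2 * a / (x i - x (i + 1)) ^ 2 : ℝ) : ℂ)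
          • ((a : ℂ) • v - spinExchange i (i + 1) v)
  | 1 => ((ω ^ 2 * ∑ i, x i ^ 2 + ∑ i, b * (b - 1) / x i ^ 2
        + ∑ i, 8 * a ^ 2 * x i ^ 2
            / ((x i ^ 2 - x (i - 1) ^ 2) * (x i ^ 2 - x (i + 1) ^ 2)) : ℝ) : ℂ) • v
      + ∑ i, ((4 * a * ((x i ^ 2 + x (i + 1) ^ 2) / (x i ^ 2 - x (i + 1) ^ 2) ^ 2) : ℝ) : ℂ)
          • ((a : ℂ) • v - spinExchange i (i + 1) v)
  | 2 => ((2 * a ^ 2 * ∑ i, Real.cot (x i - x (i - 1)) * Real.cot (x i - x (i + 1)) : ℝ) : ℂ) • v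
      + ∑ i, ((2 * a / Real.sin (x i - x (i + 1)) ^ 2 : ℝ) : ℂ)
          • ((a : ℂ) • v - spinExchange i (i + 1) v)

/-- The second partial derivative `∂²Ψ/∂x_i²` of a spin-valued function. -/
def secondPartial {N k : ℕ} (i : Fin N) (Ψ : (Fin N → ℝ) → Spin N k) (x : Fin N → ℝ) :
    Spin N k :=
  fun s => iteratedDeriv 2 (fun t : ℝ => Ψ (Function.update x i t) s) (x i)

/-- The Hamiltonian `H_ε = -∑_i ∂²/∂x_i² + V_ε`. -/
def ham {N k : ℕ} [NeZero N] (ε : Fin 3) (a b ω : ℝ) (Ψ : (Fin N → ℝ) → Spin N k)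
    (x : Fin N → ℝ) : Spin N k :=
  -(∑ i, secondPartial i Ψ x) + potential ε a b ω x (Ψ x)

/-- The gauge factor `μ`. -/
def gaugeFactor {N : ℕ} [NeZero N] (ε : Fin 3) (a b ω : ℝ) (x : Fin N → ℝ) : ℝ :=
  match ε with
  | 0 => Real.exp (-(ω / 2) * ∑ i, x i ^ 2) * ∏ i, |x i - x (i + 1)| ^ a
  | 1 => Real.exp (-(ω / 2) * ∑ i, x i ^ 2) * ∏ i, (|x i ^ 2 - x (i + 1) ^ 2| ^ a * x i ^ b)
  | 2 => ∏ i, Real.sin |x i - x (i + 1)| ^ a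

/-- The change of variable `ζ`: `x`, `x²`, `exp(± 2 i x)`; the sign `η` is used for `ε = 2`
only. -/
def changeVar (ε : Fin 3) (η : ℤˣ) (x : ℝ) : ℂ :=
  match ε with
  | 0 => (x : ℂ)
  | 1 => (x : ℂ) ^ 2
  | 2 => Complex.exp (((η : ℤ) : ℂ) * 2 * Complex.I * (x : ℂ))

/-- The spin function `μ(x) Φ(ζ(x_1), …, ζ(x_N))` obtained from a polynomial state `Φ`. -/
def physical {N k : ℕ} [NeZero N] (ε : Fin 3) (η : ℤˣ) (a b ω : ℝ) (Φ : State N k)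
    (x : Fin N → ℝ) : Spin N k :=
  fun s => (gaugeFactor ε a b ω x : ℂ) * MvPolynomial.eval (fun i => changeVar ε η (x i)) (Φ s)

/-- `Ψ` is a smooth, not identically zero solution of `H_ε Ψ = E Ψ` on the configuration space. -/
def IsEigenfunction {N k : ℕ} [NeZero N] (ε : Fin 3) (a b ω : ℝ) (E : ℂ)
    (Ψ : (Fin N → ℝ) → Spin N k) : Prop :=
  ContDiffOn ℝ ((⊤ : ℕ∞) : WithTop ℕ∞) Ψ (configSpace N ε) ∧
  (∃ x ∈ configSpace N ε, Ψ x ≠ 0) ∧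
  ∀ x ∈ configSpace N ε, ham ε a b ω Ψ x = E • Ψ x

end

end QES

/-!
Conjugating `H_ε` by `μ` and changing variables to `z = ζ(x)` produces first-order terms from the
logarithmic derivatives of `μ`; the one- and two-particle identities these satisfy turn them into
the drift of `H̄_ε`, up to the potential. Since `Φ` is symmetric under simultaneous permutations of
coordinates and spins, the exchange `K_{i,i+1}` of coordinates acts on it as the exchange
`S_{i,i+1}` of spins in the potential.

On `f Λ(φ |s⟩)` with `f` symmetric, `H̄_ε` acts by the product rule. The derivatives of `f` produce
Dunkl quotients of generators `σ_k`, `τ_k`, which are again polynomials in the generators as long as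
`f` has low degree in the top generator, and no term raises the degree in `z`. The remaining terms
act on `φ |s⟩` and stay in the span of the `Λ(φ |s⟩)`; the sum `∑ |s_{i,i+1}⟩` occurs with a
symmetric factor, which is why it has to be permutation invariant.

A nonzero polynomial cannot vanish on a product of infinite sets, so `Ψ ≠ 0`.
-/

namespace QES

open MvPolynomial
open scoped Topology

noncomputable section

/-! ### Polynomials and their derivatives -/

section Polynomials

variable {R σ τ : Type*} [CommSemiring R]

theorem pderiv_mem_restrictSupport {s t : Set (σ →₀ ℕ)} {f : MvPolynomial σ R}
    (hf : f ∈ restrictSupport R s) {i : σ} (h : ∀ d, d + Finsupp.single i 1 ∈ s → d ∈ t) :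
    pderiv i f ∈ restrictSupport R t := by
  rw [mem_restrictSupport_iff] at hf ⊢
  intro d hd
  rw [Finset.mem_coe, mem_support_iff, coeff_pderiv] at hd
  exact h d (hf (mem_support_iff.2 (left_ne_zero_of_mul hd)))

theorem X_mul_mem_restrictSupport {s t : Set (σ →₀ ℕ)} {f : MvPolynomial σ R}
    (hf : f ∈ restrictSupport R s) {i : σ} (h : ∀ d ∈ s, d + Finsupp.single i 1 ∈ t) :
    X i * f ∈ restrictSupport R t := by
  have hX : X i ∈ restrictSupport R {Finsupp.single i 1} :=
    (monomial_mem_restrictSupport R).2 (Or.inl rfl)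
  have hXf := Submodule.mul_mem_mul hX hf
  rw [← restrictSupport_add] at hXf
  refine restrictSupport_mono R ?_ hXf
  rintro _ ⟨_, rfl, d, hd, rfl⟩
  simpa only [add_comm] using h d hd

theorem pderiv_pderiv_comm (i j : σ) (f : MvPolynomial σ R) :
    pderiv i (pderiv j f) = pderiv j (pderiv i f) := by
  classical
  rcases eq_or_ne i j with rfl | hij
  · rfl
  · ext d
    simp only [coeff_pderiv, Finsupp.add_apply, Finsupp.single_eq_of_ne hij,
      Finsupp.single_eq_of_ne hij.symm, add_zero, add_right_comm d, mul_right_comm]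

theorem pderiv_eq_zero_iff_mem_restrictSupport [NoZeroDivisors R] [CharZero R]
    {f : MvPolynomial σ R} {i : σ} :
    pderiv i f = 0 ↔ f ∈ restrictSupport R {d | d i = 0} := by
  constructor
  · intro h d hd
    by_contra hi
    have hle : Finsupp.single i 1 ≤ d := by
      simpa [Finsupp.single_le_iff, Nat.one_le_iff_ne_zero] using hi
    have hc := coeff_pderiv (i := i) f (d - Finsupp.single i 1)
    rw [h, coeff_zero, tsub_add_cancel_of_le hle] at hc
    exact mul_ne_zero (mem_support_iff.1 hd) (Nat.cast_add_one_ne_zero _) hc.symm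
  · intro h
    have : pderiv i f ∈ restrictSupport R (∅ : Set (σ →₀ ℕ)) :=
      pderiv_mem_restrictSupport h fun d hd => by simp at hd
    simpa [mem_restrictSupport_iff, Set.subset_empty_iff] using this

theorem pderiv_pderiv_eq_zero_iff_mem_restrictSupport [NoZeroDivisors R] [CharZero R]
    {f : MvPolynomial σ R} {i : σ} :
    pderiv i (pderiv i f) = 0 ↔ f ∈ restrictSupport R {d | d i ≤ 1} := by
  rw [pderiv_eq_zero_iff_mem_restrictSupport]
  constructor
  · intro h d hd
    by_contra hi
    have hle : Finsupp.single i 1 ≤ d := by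
      simp only [Finsupp.single_le_iff]
      rw [Set.mem_ofPred_eq] at hi
      omega
    have hmem : d - Finsupp.single i 1 ∈ (pderiv i f).support := by
      rw [mem_support_iff, coeff_pderiv, tsub_add_cancel_of_le hle]
      exact mul_ne_zero (mem_support_iff.1 hd) (Nat.cast_add_one_ne_zero _)
    have := h hmem
    simp only [Set.mem_ofPred_eq, Finsupp.coe_tsub, Pi.sub_apply, Finsupp.single_eq_same] at this hi
    omega
  · exact fun h => pderiv_mem_restrictSupport h fun d hd => by simpa using hd

theorem derivation_aeval {A M : Type*} [CommSemiring A] [Algebra R A] [AddCommMonoid M]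
    [Module R M] [Module A M] [Fintype σ] (D : Derivation R A M) (p : σ → A)
    (f : MvPolynomial σ R) :
    D (aeval p f) = ∑ i, aeval p (pderiv i f) • D (p i) := by
  classical
  induction f using MvPolynomial.induction_on with
  | C c => simp
  | add f g hf hg => simp only [map_add, hf, hg, add_smul, Finset.sum_add_distrib]
  | mul_X f j hf =>
    simp [Derivation.leibniz, pderiv_X, add_smul, Finset.sum_add_distrib, hf, mul_smul,
      Pi.single_apply, apply_ite, Finset.smul_sum]

section WeightedDegree

variable {p : σ → MvPolynomial τ R} {w : σ → ℕ}

theorem isHomogeneous_aeval_monomial (hp : ∀ i, (p i).IsHomogeneous (w i)) (d : σ →₀ ℕ) (c : R) :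
    (aeval p (monomial d c)).IsHomogeneous (Finsupp.weight w d) := by
  rw [aeval_monomial, MvPolynomial.algebraMap_eq, Finsupp.weight_apply]
  exact (IsHomogeneous.prod _ _ _ fun i _ => by
    simpa [mul_comm] using (hp i).pow (d i)).C_mul c

theorem totalDegree_aeval_le (hp : ∀ i, (p i).IsHomogeneous (w i)) {m : ℕ} {f : MvPolynomial σ R}
    (hf : f ∈ restrictSupport R {d | Finsupp.weight w d ≤ m}) : (aeval p f).totalDegree ≤ m := by
  rw [f.as_sum, map_sum]
  exact totalDegree_finsetSum_le fun d hd =>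
    (isHomogeneous_aeval_monomial hp d _).totalDegree_le.trans (hf hd)

theorem homogeneousComponent_aeval (hp : ∀ i, (p i).IsHomogeneous (w i)) (f : MvPolynomial σ R)
    (j : ℕ) :
    homogeneousComponent j (aeval p f) = aeval p (weightedHomogeneousComponent w j f) := by
  classical
  induction f using MvPolynomial.induction_on' with
  | monomial d c =>
    rw [homogeneousComponent_of_mem (isHomogeneous_aeval_monomial hp d c),
      weightedHomogeneousComponent_of_mem (isWeightedHomogeneous_monomial w d c rfl)]
    split_ifs <;> simp
  | add f g hf hg => simp only [map_add, hf, hg]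

theorem exists_aeval_eq_of_totalDegree_le (hp : ∀ i, (p i).IsHomogeneous (w i)) {m : ℕ}
    {s : Set (σ →₀ ℕ)} {f : MvPolynomial σ R} (hf : f ∈ restrictSupport R s)
    (hm : (aeval p f).totalDegree ≤ m) :
    ∃ g ∈ restrictSupport R {d ∈ s | Finsupp.weight w d ≤ m}, aeval p g = aeval p f := by
  classical
  refine ⟨∑ j ∈ Finset.range (m + 1), weightedHomogeneousComponent w j f,
    Submodule.sum_mem _ fun j hj => (mem_restrictSupport_iff R).2 fun d hd => ?_, ?_⟩
  · rw [Finset.mem_coe, mem_support_iff, coeff_weightedHomogeneousComponent] at hd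
    split_ifs at hd with hdj
    · exact ⟨hf (mem_support_iff.2 hd), by rw [hdj]; simpa [Nat.lt_succ_iff] using hj⟩
    · exact absurd rfl hd
  · simp only [map_sum, ← homogeneousComponent_aeval hp]
    conv_rhs => rw [← sum_homogeneousComponent (aeval p f)]
    refine (Finset.sum_subset (Finset.range_mono (by omega)) fun j _ hj => ?_).symm
    exact homogeneousComponent_eq_zero _ _ (by simpa using hj)

end WeightedDegree

end Polynomials

/-! ### The gauge Hamiltonian on polynomials -/

section GaugeHamiltonian

variable {N : ℕ}

/-- The polynomial part `∑_i z_i^ε ∂_i²` of `T_ε`. -/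
def laplacian (ε : Fin 3) (f : Poly N) : Poly N := ∑ i, X i ^ (ε : ℕ) * pderiv i (pderiv i f)

theorem derivation_sum_apply {R A M ι : Type*} [CommSemiring R] [CommSemiring A]
    [AddCommMonoid M] [Algebra R A] [Module A M] [Module R M] (s : Finset ι)
    (D : ι → Derivation R A M) (x : A) : (∑ i ∈ s, D i) x = ∑ i ∈ s, D i x := by
  simpa only [Finset.sum_apply, Derivation.coeFnAddMonoidHom_apply]
    using congrFun (map_sum Derivation.coeFnAddMonoidHom D s) x

/-- The bilinear form `g ↦ ∑_i z_i^ε (∂_i f) (∂_i g)` of `laplacian`, as a derivation in `g`. -/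
def carreDuChamp (ε : Fin 3) (f : Poly N) : Derivation ℂ (Poly N) (Poly N) :=
  ∑ i, (X i ^ (ε : ℕ) * pderiv i f) • pderiv i

theorem carreDuChamp_apply (ε : Fin 3) (f g : Poly N) :
    carreDuChamp ε f g = ∑ i, X i ^ (ε : ℕ) * (pderiv i f * pderiv i g) := by
  simp [carreDuChamp, derivation_sum_apply, mul_assoc]

theorem carreDuChamp_comm (ε : Fin 3) (f g : Poly N) :
    carreDuChamp ε f g = carreDuChamp ε g f := by
  simp only [carreDuChamp_apply, mul_comm (pderiv _ f)]

theorem laplacian_mul (ε : Fin 3) (f g : Poly N) :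
    laplacian ε (f * g) = f * laplacian ε g + g * laplacian ε f + 2 * carreDuChamp ε f g := by
  simp only [laplacian, carreDuChamp_apply, Finset.mul_sum, ← Finset.sum_add_distrib,
    Derivation.leibniz, map_add, smul_eq_mul]
  exact Finset.sum_congr rfl fun i _ => by ring

theorem laplacian_aeval {κ : Type*} [Fintype κ] (ε : Fin 3) (p : κ → Poly N)
    (f : MvPolynomial κ ℂ) :
    laplacian ε (aeval p f) = ∑ k, aeval p (pderiv k f) * laplacian ε (p k)
      + ∑ k, ∑ l, aeval p (pderiv l (pderiv k f)) * carreDuChamp ε (p k) (p l) := by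
  have h : ∀ i, X i ^ (ε : ℕ) * pderiv i (pderiv i (aeval p f)) =
      ∑ k, aeval p (pderiv k f) * (X i ^ (ε : ℕ) * pderiv i (pderiv i (p k)))
      + ∑ k, ∑ l, aeval p (pderiv l (pderiv k f))
          * (X i ^ (ε : ℕ) * (pderiv i (p k) * pderiv i (p l))) := fun i => by
    simp only [derivation_aeval, map_sum, smul_eq_mul, Derivation.leibniz, Finset.mul_sum,
      ← Finset.sum_add_distrib, mul_add]
    refine Finset.sum_congr rfl fun k _ => congrArg₂ _ (by ring) ?_
    exact Finset.sum_congr rfl fun l _ => by ring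
  simp only [laplacian, carreDuChamp_apply, h, Finset.sum_add_distrib, Finset.mul_sum]
  rw [Finset.sum_comm]
  refine congrArg₂ _ rfl ?_
  rw [Finset.sum_comm]
  exact Finset.sum_congr rfl fun k _ => Finset.sum_comm

variable [NeZero N]

/-- The derivation `f ↦ z_i^ε ∂_i f - z_{i+1}^ε ∂_{i+1} f`. -/
def pairDeriv (ε : Fin 3) (i : Fin N) : Derivation ℂ (Poly N) (Poly N) :=
  (X i ^ (ε : ℕ) : Poly N) • pderiv i - (X (i + 1) ^ (ε : ℕ) : Poly N) • pderiv (i + 1)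

theorem pairDeriv_apply (ε : Fin 3) (i : Fin N) (f : Poly N) :
    pairDeriv ε i f = X i ^ (ε : ℕ) * pderiv i f - X (i + 1) ^ (ε : ℕ) * pderiv (i + 1) f := rfl

/-- The first-order part of the gauge Hamiltonian, with values in rational functions. -/
def gaugeDrift (ε : Fin 3) (a b ω : ℝ) : Derivation ℂ (Poly N) (RatFun N) :=
  ∑ i, (toRat (C (constC ε * (2 * a) : ℂ)) / (toRat (X i) - toRat (X (i + 1)))) •
      (Algebra.linearMap (Poly N) (RatFun N)).compDer (pairDeriv ε i)
    + (Algebra.linearMap (Poly N) (RatFun N)).compDer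
        (∑ i, (C (constMinus ε b : ℂ) + C (constZero ε a ω : ℂ) * X i : Poly N) • pderiv i)

/-- The exchange part of the gauge Hamiltonian; it vanishes on symmetric polynomials. -/
def gaugeExchange (ε : Fin 3) (a : ℝ) (f : Poly N) : RatFun N :=
  toRat (C (constC ε * (2 * a) : ℂ)) * ∑ i : Fin N, theta ε (toRat (X i)) (toRat (X (i + 1)))
    / (toRat (X i) - toRat (X (i + 1))) ^ 2 * toRat (f - rename (Equiv.swap i (i + 1)) f)

theorem gaugeHam_eq_add (ε : Fin 3) (a b ω : ℝ) (f : Poly N) :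
    gaugeHam ε a b ω f = toRat (C (constC ε : ℂ) * laplacian ε f) + gaugeDrift ε a b ω f
      - gaugeExchange ε a f + toRat (C (constE ε N a b ω : ℂ) * f) := by
  have hT : ∑ i : Fin N, (toRat (C (constC ε * (2 * a) : ℂ)) / (toRat (X i) - toRat (X (i + 1)))) *
      toRat (pairDeriv ε i f) = toRat (C (constC ε : ℂ)) * (toRat (C (2 * a : ℂ)) *
        ∑ i : Fin N, toRat (pairDeriv ε i f) / (toRat (X i) - toRat (X (i + 1)))) := by
    simp only [Finset.mul_sum, toRat, map_mul]
    exact Finset.sum_congr rfl fun i _ => by ring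
  have hJ : ∑ i : Fin N, (C (constMinus ε b : ℂ) + C (constZero ε a ω : ℂ) * X i) * pderiv i f
      = C (constMinus ε b : ℂ) * opJminus f + C (constZero ε a ω : ℂ) * opJzero f := by
    simp only [opJminus, opJzero, Finset.mul_sum, ← Finset.sum_add_distrib, add_mul, mul_assoc]
  have hD : gaugeDrift ε a b ω f = ∑ i : Fin N, (toRat (C (constC ε * (2 * a) : ℂ)) /
      (toRat (X i) - toRat (X (i + 1)))) * toRat (pairDeriv ε i f)
      + toRat (∑ i : Fin N,
        (C (constMinus ε b : ℂ) + C (constZero ε a ω : ℂ) * X i) * pderiv i f) := by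
    simp [gaugeDrift, derivation_sum_apply, toRat, Algebra.smul_def]
  rw [hD, hT, hJ]
  simp only [gaugeHam, opT, gaugeExchange, laplacian, ← pairDeriv_apply]
  simp only [toRat, map_add, map_mul]
  ring

theorem gaugeHam_add (ε : Fin 3) (a b ω : ℝ) (f g : Poly N) :
    gaugeHam ε a b ω (f + g) = gaugeHam ε a b ω f + gaugeHam ε a b ω g := by
  have hE : gaugeExchange ε a (f + g) = gaugeExchange ε a f + gaugeExchange ε a g := by
    simp only [gaugeExchange, ← mul_add, ← Finset.sum_add_distrib, toRat, ← map_add]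
    simp only [map_add, add_sub_add_comm]
  have hL : laplacian ε (f + g) = laplacian ε f + laplacian ε g := by
    simp only [laplacian, map_add, mul_add, Finset.sum_add_distrib]
  simp only [gaugeHam_eq_add, hE, hL, mul_add, toRat, map_add]
  ring

theorem gaugeExchange_mul (ε : Fin 3) (a : ℝ) {F : Poly N} (hF : F.IsSymmetric) (f : Poly N) :
    gaugeExchange ε a (F * f) = toRat F * gaugeExchange ε a f := by
  have h : ∀ i, F * f - rename (Equiv.swap i (i + 1)) (F * f)
      = F * (f - rename (Equiv.swap i (i + 1)) f) := fun i => by rw [map_mul, hF, mul_sub]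
  have hmul : ∀ g : Poly N, toRat (F * g) = toRat F * toRat g := map_mul _ _
  simp only [gaugeExchange, h, hmul, Finset.mul_sum]
  exact Finset.sum_congr rfl fun i _ => by ring

theorem gaugeExchange_eq_zero (ε : Fin 3) (a : ℝ) {F : Poly N} (hF : F.IsSymmetric) :
    gaugeExchange ε a F = 0 := by
  simp [gaugeExchange, toRat, hF _]

theorem gaugeHam_mul (ε : Fin 3) (a b ω : ℝ) {F : Poly N} (hF : F.IsSymmetric) (φ : Poly N) :
    gaugeHam ε a b ω (F * φ) = toRat F * gaugeHam ε a b ω φ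
      + toRat φ * (gaugeHam ε a b ω F - toRat (C (constE ε N a b ω : ℂ) * F))
      + toRat (C (2 * constC ε : ℂ) * carreDuChamp ε F φ) := by
  simp only [gaugeHam_eq_add, gaugeExchange_mul ε a hF, gaugeExchange_eq_zero ε a hF,
    laplacian_mul, Derivation.leibniz, Algebra.smul_def, toRat, map_add, map_mul, map_ofNat]
  ring

theorem gaugeHam_C_mul (ε : Fin 3) (a b ω : ℝ) (c : ℂ) (f : Poly N) :
    gaugeHam ε a b ω (C c * f) = toRat (C c) * gaugeHam ε a b ω f := by
  have hC : gaugeHam ε a b ω (C c : Poly N) = toRat (C (constE ε N a b ω : ℂ) * C c) := by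
    have hD : gaugeDrift ε a b ω (C c : Poly N) = 0 := (gaugeDrift ε a b ω).map_algebraMap c
    rw [gaugeHam_eq_add, gaugeExchange_eq_zero ε a (IsSymmetric.C c), hD]
    simp [laplacian, toRat]
  rw [gaugeHam_mul ε a b ω (IsSymmetric.C c), hC]
  simp [carreDuChamp_apply, toRat]

omit [NeZero N] in
theorem isSymmetric_aeval {κ : Type*} {p : κ → Poly N} (hp : ∀ k, (p k).IsSymmetric)
    (f : MvPolynomial κ ℂ) : (aeval p f).IsSymmetric := fun e => by
  have h : (rename e : Poly N →ₐ[ℂ] Poly N).comp (aeval p) = aeval p := by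
    ext k
    simp [hp k e]
  exact DFunLike.congr_fun h f

theorem gaugeHam_aeval_mul {κ : Type*} [Fintype κ] {ε : Fin 3} {a b ω : ℝ} {p G : κ → Poly N}
    {φ g : Poly N} {f L : MvPolynomial κ ℂ} (hp : ∀ k, (p k).IsSymmetric)
    (hG : ∀ k, gaugeHam ε a b ω (p k) = toRat (G k + C (constE ε N a b ω : ℂ) * p k))
    (hL : ∑ k, aeval p (pderiv k f) * G k + C (constC ε : ℂ) *
      ∑ k, ∑ l, aeval p (pderiv l (pderiv k f)) * carreDuChamp ε (p k) (p l) = aeval p L)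
    (hg : gaugeHam ε a b ω φ = toRat g) :
    gaugeHam ε a b ω (aeval p f * φ) = toRat (aeval p L * φ + aeval p f * g
      + C (2 * constC ε : ℂ) * ∑ k, aeval p (pderiv k f) * carreDuChamp ε (p k) φ) := by
  have hF := isSymmetric_aeval hp f
  have hk : ∀ k, gaugeDrift ε a b ω (p k) = toRat (G k - C (constC ε : ℂ) * laplacian ε (p k)) :=
    fun k => by
      have h := hG k
      rw [gaugeHam_eq_add, gaugeExchange_eq_zero ε a (hp k)] at h
      simp only [toRat, map_add, map_sub] at h ⊢
      linear_combination h
  have hΓ : carreDuChamp ε (aeval p f) φ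
      = ∑ k, aeval p (pderiv k f) * carreDuChamp ε (p k) φ := by
    simp only [carreDuChamp_comm _ _ φ, derivation_aeval, smul_eq_mul]
  have hsum : toRat (C (constC ε : ℂ) * laplacian ε (aeval p f)) + gaugeDrift ε a b ω (aeval p f)
      = toRat (aeval p L) := by
    rw [← hL]
    simp only [derivation_aeval, laplacian_aeval, hk, Algebra.smul_def]
    simp only [toRat, ← map_mul, ← map_sum, ← map_add, mul_sub, Finset.sum_sub_distrib,
      mul_add, Finset.mul_sum, mul_left_comm (aeval p _) (C _)]
    congr 1
    ring
  rw [gaugeHam_mul ε a b ω hF, hg, gaugeHam_eq_add ε a b ω (aeval p f),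
    gaugeExchange_eq_zero ε a hF, sub_zero, hsum, hΓ]
  simp only [toRat, map_add, map_mul]
  ring

/-- `ϑ_ε` on polynomials. -/
def thetaPoly (ε : Fin 3) (x y : Poly N) : Poly N :=
  match ε with
  | 0 => 1
  | 1 => C (1 / 2) * (x + y)
  | 2 => x * y

omit [NeZero N] in
theorem toRat_thetaPoly (ε : Fin 3) (x y : Poly N) :
    toRat (thetaPoly ε x y) = theta ε (toRat x) (toRat y) := by
  have h2 : algebraMap (Poly N) (RatFun N) (C (1 / 2)) = 1 / 2 := by
    rw [← MvPolynomial.algebraMap_eq, ← IsScalarTower.algebraMap_apply, map_div₀, map_one,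
      map_ofNat]
  fin_cases ε
  · exact map_one _
  · simp only [thetaPoly, theta, toRat, map_mul, map_add, h2]
    ring
  · exact map_mul _ x y

omit [NeZero N] in
theorem toRat_injective : Function.Injective (toRat (N := N)) :=
  IsFractionRing.injective (Poly N) (RatFun N)

theorem fin_ne_add_one (hN : 2 ≤ N) (i : Fin N) : i ≠ i + 1 := by
  simpa using (show N ≠ 1 by omega)

/-- `R i` is the value at `f` of the `i`-th Dunkl-type term of `T_ε`; multiplying by the square of
`z_i - z_{i+1}` keeps the relation inside polynomials. -/
def IsDunklQuotient (ε : Fin 3) (f : Poly N) (R : Fin N → Poly N) : Prop :=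
  ∀ i, pairDeriv ε i f * (X i - X (i + 1))
    - thetaPoly ε (X i) (X (i + 1)) * (f - rename (Equiv.swap i (i + 1)) f)
    = (X i - X (i + 1)) ^ 2 * R i

theorem gaugeHam_eq_of_isDunklQuotient (hN : 2 ≤ N) {ε : Fin 3} {f : Poly N} {R : Fin N → Poly N}
    (h : IsDunklQuotient ε f R) (a b ω : ℝ) :
    gaugeHam ε a b ω f = toRat (C (constC ε : ℂ) * (laplacian ε f + C (2 * a : ℂ) * ∑ i, R i)
      + C (constMinus ε b : ℂ) * opJminus f + C (constZero ε a ω : ℂ) * opJzero f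
      + C (constE ε N a b ω : ℂ) * f) := by
  have hi : ∀ i : Fin N, toRat (R i) =
      toRat (pairDeriv ε i f) / (toRat (X i) - toRat (X (i + 1)))
      - theta ε (toRat (X i)) (toRat (X (i + 1))) / (toRat (X i) - toRat (X (i + 1))) ^ 2
        * toRat (f - rename (Equiv.swap i (i + 1)) f) := fun i => by
    have hd : toRat (X i) - toRat (X (i + 1) : Poly N) ≠ 0 :=
      sub_ne_zero.2 fun h => fin_ne_add_one hN i (X_injective (toRat_injective h))
    have hR := congrArg toRat (h i)
    rw [← toRat_thetaPoly]
    simp only [toRat, map_mul, map_pow, map_sub _ (_ * _), map_sub _ (X i)] at hR hd ⊢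
    field_simp
    linear_combination -hR
  simp only [gaugeHam, opT, laplacian, ← pairDeriv_apply]
  rw [add_sub_assoc, ← mul_sub, ← Finset.sum_sub_distrib, ← Finset.sum_congr rfl fun i _ => hi i]
  simp only [toRat, map_add, map_mul, map_sum]

end GaugeHamiltonian

/-! ### Dunkl quotients -/

section DunklQuotients

variable {N : ℕ}

theorem pderiv_sigma (i : Fin N) (k : ℕ) :
    pderiv i (sigma N k) = C (k : ℂ) * X i ^ (k - 1) := by
  simp [sigma, psum, pderiv_X, Pi.single_apply]

theorem isSymmetric_sigma (k : ℕ) : (sigma N k).IsSymmetric := psum_isSymmetric _ _ _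

theorem isSymmetric_tau (k : ℕ) : (tau N k).IsSymmetric := esymm_isSymmetric _ _ _

theorem isHomogeneous_sigma (k : ℕ) : (sigma N k).IsHomogeneous k :=
  IsHomogeneous.sum _ _ _ fun i _ => isHomogeneous_X_pow i k

theorem isHomogeneous_tau (k : ℕ) : (tau N k).IsHomogeneous k := by
  refine IsHomogeneous.sum _ _ _ fun s hs => ?_
  simpa [(Finset.mem_powersetCard.1 hs).2] using
    IsHomogeneous.prod s (fun i => (X i : Poly N)) (fun _ => 1) fun i _ => isHomogeneous_X ℂ i

theorem sigma_zero : sigma N 0 = C (N : ℂ) := by simp [sigma]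

theorem sigma_one : sigma N 1 = ∑ i, X i := psum_one _ _

theorem tau_self : tau N N = ∏ i, X i := by
  have h : Finset.powersetCard N (Finset.univ : Finset (Fin N)) = {Finset.univ} := by
    simpa using Finset.powersetCard_self (Finset.univ : Finset (Fin N))
  simp [tau, esymm, h]

/-- The product of all variables but `z_j`; it stands for `τ_N / z_j`. -/
def cofactor (j : Fin N) : Poly N := ∏ i ∈ Finset.univ.erase j, X i

theorem X_mul_cofactor (j : Fin N) : X j * cofactor j = tau N N := by
  rw [tau_self, cofactor, Finset.mul_prod_erase _ _ (Finset.mem_univ j)]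

theorem rename_cofactor (e : Equiv.Perm (Fin N)) (j : Fin N) :
    rename e (cofactor j) = cofactor (e j) := by
  refine mul_left_cancel₀ (X_ne_zero (R := ℂ) (e j)) ?_
  rw [X_mul_cofactor, ← isSymmetric_tau N e, ← X_mul_cofactor j, map_mul, rename_X]

theorem isHomogeneous_cofactor (j : Fin N) : (cofactor j).IsHomogeneous (N - 1) := by
  simpa [cofactor] using IsHomogeneous.prod (Finset.univ.erase j) (fun i => (X i : Poly N))
    (fun _ => 1) fun i _ => isHomogeneous_X ℂ i

theorem tau_pred [NeZero N] : tau N (N - 1) = ∑ j, cofactor j := by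
  have hN := NeZero.pos N
  rw [tau, esymm]
  symm
  refine Finset.sum_bij (fun (j : Fin N) _ => Finset.univ.erase j) (fun j _ => ?_)
    (fun i _ j _ h => ?_) (fun s hs => ?_) fun j _ => rfl
  · simp [Finset.mem_powersetCard]
  · by_contra hne
    simpa [hne] using Finset.ext_iff.1 h i
  · have hs : sᶜ.card = 1 := by
      rw [Finset.card_compl, (Finset.mem_powersetCard.1 hs).2, Fintype.card_fin]
      omega
    obtain ⟨j, hj⟩ := Finset.card_eq_one.1 hs
    exact ⟨j, Finset.mem_univ j, by rw [← compl_compl s, hj]; ext; simp⟩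

theorem X_mul_pderiv_prod (s : Finset (Fin N)) (i : Fin N) :
    X i * pderiv i (∏ m ∈ s, X m : Poly N) = if i ∈ s then ∏ m ∈ s, X m else 0 := by
  induction s using Finset.induction_on with
  | empty => simp
  | insert m s hm ih =>
    rw [Finset.prod_insert hm, Derivation.leibniz, pderiv_X]
    simp only [smul_eq_mul, mul_add]
    rw [mul_left_comm, ih]
    by_cases h : m = i
    · subst h
      simp [hm, mul_comm]
    · simp [h, Ne.symm h]

theorem X_sq_mul_pderiv_pderiv_prod (s : Finset (Fin N)) (i : Fin N) :
    X i ^ 2 * pderiv i (pderiv i (∏ m ∈ s, X m : Poly N)) = 0 := by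
  have h₁ := X_mul_pderiv_prod s i
  have h₂ := congrArg (fun p => X i * pderiv i p) h₁
  simp only [Derivation.leibniz, smul_eq_mul, pderiv_X_self] at h₂
  split_ifs at h₁ h₂
  · linear_combination h₂
  · simp only [map_zero] at h₂
    linear_combination h₂ - h₁

theorem X_mul_pderiv_cofactor (i j : Fin N) :
    X i * pderiv i (cofactor j) = if i = j then 0 else cofactor j := by
  rw [cofactor, X_mul_pderiv_prod]
  by_cases h : i = j <;> simp [h]

theorem X_mul_pderiv_tau_self (i : Fin N) : X i * pderiv i (tau N N) = tau N N := by
  simp [tau_self, X_mul_pderiv_prod]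

theorem X_mul_pderiv_tau_pred [NeZero N] (i : Fin N) :
    X i * pderiv i (tau N (N - 1)) = tau N (N - 1) - cofactor i := by
  simp only [tau_pred, map_sum, Finset.mul_sum, X_mul_pderiv_cofactor]
  rw [eq_sub_iff_add_eq, ← Fintype.sum_ite_eq i (cofactor (N := N)), ← Finset.sum_add_distrib]
  exact Finset.sum_congr rfl fun j _ => by split_ifs <;> simp

theorem opJzero_of_isHomogeneous {f : Poly N} {d : ℕ} (hf : f.IsHomogeneous d) :
    opJzero f = C (d : ℂ) * f := by
  rw [opJzero, hf.sum_X_mul_pderiv, nsmul_eq_mul, map_natCast]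

theorem opJminus_sigma (k : ℕ) : opJminus (sigma N k) = C (k : ℂ) * sigma N (k - 1) := by
  simp only [opJminus, pderiv_sigma, ← Finset.mul_sum]
  rfl

theorem opJminus_X (j : Fin N) : opJminus (X j : Poly N) = 1 := by
  simp [opJminus, pderiv_X, Pi.single_apply]

theorem laplacian_sigma (ε : Fin 3) (k : ℕ) :
    laplacian ε (sigma N k) = C ((k : ℂ) * (k - 1 : ℕ)) * sigma N ((ε : ℕ) + (k - 1 - 1)) := by
  simp only [laplacian, pderiv_sigma, pderiv_C_mul, pderiv_pow, pderiv_X_self]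
  simp only [sigma, psum, Finset.mul_sum, C_mul, map_natCast]
  exact Finset.sum_congr rfl fun i _ => by ring

theorem laplacian_X (ε : Fin 3) (j : Fin N) : laplacian ε (X j : Poly N) = 0 := by
  refine Finset.sum_eq_zero fun i _ => ?_
  rw [pderiv_X, Pi.single_apply]
  split_ifs <;> simp

theorem laplacian_two_cofactor (j : Fin N) : laplacian 2 (cofactor j) = 0 :=
  Finset.sum_eq_zero fun i _ => X_sq_mul_pderiv_pderiv_prod _ i

theorem laplacian_two_tau_self : laplacian 2 (tau N N) = 0 := by
  rw [tau_self]
  exact Finset.sum_eq_zero fun i _ => X_sq_mul_pderiv_pderiv_prod _ i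

theorem laplacian_two_tau_pred [NeZero N] : laplacian 2 (tau N (N - 1)) = 0 := by
  simp only [tau_pred, laplacian, map_sum, Finset.mul_sum]
  exact Finset.sum_eq_zero fun i _ => Finset.sum_eq_zero fun j _ =>
    X_sq_mul_pderiv_pderiv_prod _ i

theorem carreDuChamp_X (ε : Fin 3) (f : Poly N) (j : Fin N) :
    carreDuChamp ε f (X j) = X j ^ (ε : ℕ) * pderiv j f := by
  simp [carreDuChamp_apply, pderiv_X, Pi.single_apply]

theorem carreDuChamp_sigma_sigma (ε : Fin 3) (k l : ℕ) :
    carreDuChamp ε (sigma N k) (sigma N l) =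
      C ((k : ℂ) * l) * sigma N ((ε : ℕ) + (k - 1) + (l - 1)) := by
  simp only [carreDuChamp_apply, pderiv_sigma]
  simp only [sigma, psum, Finset.mul_sum, C_mul]
  exact Finset.sum_congr rfl fun i _ => by ring

theorem carreDuChamp_two_tau_self (f : Poly N) :
    carreDuChamp 2 (tau N N) f = tau N N * opJzero f := by
  simp only [carreDuChamp_apply, opJzero, Finset.mul_sum, Fin.val_two]
  exact Finset.sum_congr rfl fun i _ => by
    linear_combination (X i * pderiv i f) * X_mul_pderiv_tau_self i

theorem carreDuChamp_two_tau_pred [NeZero N] (f : Poly N) :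
    carreDuChamp 2 (tau N (N - 1)) f = tau N (N - 1) * opJzero f - tau N N * opJminus f := by
  simp only [carreDuChamp_apply, opJzero, opJminus, Finset.mul_sum, ← Finset.sum_sub_distrib,
    Fin.val_two]
  exact Finset.sum_congr rfl fun i _ => by
    linear_combination (X i * pderiv i f) * X_mul_pderiv_tau_pred i - pderiv i f * X_mul_cofactor i

variable [NeZero N]

theorem sum_add_one {M : Type*} [AddCommMonoid M] (g : Fin N → M) : ∑ i, g (i + 1) = ∑ i, g i :=
  Equiv.sum_comp (Equiv.addRight (1 : Fin N)) g

theorem sum_X_add_X : ∑ i : Fin N, (X i + X (i + 1) : Poly N) = 2 * sigma N 1 := by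
  rw [Finset.sum_add_distrib, sum_add_one (fun i => (X i : Poly N)), ← sigma_one, two_mul]

/-- The number of times `j` occurs among `i`, `i + 1`, as a polynomial. -/
def incidence (i j : Fin N) : Poly N := (if j = i then 1 else 0) + (if j = i + 1 then 1 else 0)

theorem sum_incidence (j : Fin N) : ∑ i : Fin N, incidence i j = 2 := by
  have h := sum_add_one (fun i : Fin N => if j = i then (1 : Poly N) else 0)
  simp only [incidence, Finset.sum_add_distrib, h, Finset.sum_ite_eq, Finset.mem_univ, if_true]
  exact one_add_one_eq_two

theorem isDunklQuotient_one (ε : Fin 3) : IsDunklQuotient ε (1 : Poly N) fun _ => 0 := fun i => by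
  simp

theorem isDunklQuotient_sigma {ε : Fin 3} {k : ℕ} {R : Fin N → Poly N}
    (h : ∀ i, C (k : ℂ) * (X i ^ ((ε : ℕ) + (k - 1)) - X (i + 1) ^ ((ε : ℕ) + (k - 1)))
      = (X i - X (i + 1)) * R i) : IsDunklQuotient ε (sigma N k) R := fun i => by
  rw [isSymmetric_sigma, pairDeriv_apply, pderiv_sigma, pderiv_sigma]
  linear_combination (X i - X (i + 1)) * h i

theorem isDunklQuotient_two_tau_self : IsDunklQuotient 2 (tau N N) fun _ => tau N N := fun i => by
  rw [isSymmetric_tau, pairDeriv_apply, Fin.val_two]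
  linear_combination (X i - X (i + 1)) *
    (X i * X_mul_pderiv_tau_self i - X (i + 1) * X_mul_pderiv_tau_self (i + 1))

theorem isDunklQuotient_two_tau_pred :
    IsDunklQuotient 2 (tau N (N - 1)) fun _ => tau N (N - 1) := fun i => by
  rw [isSymmetric_tau, pairDeriv_apply, Fin.val_two]
  linear_combination (X i - X (i + 1)) *
    (X i * X_mul_pderiv_tau_pred i - X (i + 1) * X_mul_pderiv_tau_pred (i + 1)
      - X_mul_cofactor i + X_mul_cofactor (i + 1))

theorem isDunklQuotient_X (hN : 2 ≤ N) {ε : Fin 3} {r : Poly N → Poly N}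
    (h : ∀ x y, x ^ (ε : ℕ) - thetaPoly ε x y = (x - y) * r x)
    (hθ : ∀ x y : Poly N, thetaPoly ε x y = thetaPoly ε y x) (j : Fin N) :
    IsDunklQuotient ε (X j) fun i => r (X j) * incidence i j := fun i => by
  have hi := fin_ne_add_one hN i
  simp only [pairDeriv_apply, rename_X, incidence]
  rcases eq_or_ne j i with rfl | hji
  · simp only [pderiv_X_self, pderiv_X_of_ne hi, Equiv.swap_apply_left, if_true, if_neg hi]
    linear_combination (X j - X (j + 1)) * h (X j) (X (j + 1))
  rcases eq_or_ne j (i + 1) with rfl | hji'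
  · simp only [pderiv_X_self, pderiv_X_of_ne hi.symm, Equiv.swap_apply_right, if_true,
      if_neg hi.symm]
    linear_combination (X (i + 1) - X i) * (h (X (i + 1)) (X i) + hθ (X (i + 1)) (X i))
  · simp [pderiv_X_of_ne hji, pderiv_X_of_ne hji', Equiv.swap_apply_of_ne_of_ne hji hji', hji, hji']

theorem isDunklQuotient_zero_X_sq (hN : 2 ≤ N) (j : Fin N) :
    IsDunklQuotient 0 (X j ^ 2 : Poly N) fun i => incidence i j := fun i => by
  have hi := fin_ne_add_one hN i
  simp only [pairDeriv_apply, Derivation.leibniz_pow, map_pow, rename_X, thetaPoly, incidence]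
  rcases eq_or_ne j i with rfl | hji
  · simp only [Fin.coe_ofNat_eq_mod, pderiv_X, Pi.single_eq_same, Equiv.swap_apply_left,
      ↓reduceIte, pderiv_X_of_ne hi, hi]
    ring
  rcases eq_or_ne j (i + 1) with rfl | hji'
  · simp only [Fin.coe_ofNat_eq_mod, pderiv_X, Pi.single_eq_same, Equiv.swap_apply_right,
      ↓reduceIte, pderiv_X_of_ne hi.symm, hi.symm]
    ring
  · simp [pderiv_X_of_ne hji, pderiv_X_of_ne hji', Equiv.swap_apply_of_ne_of_ne hji hji', hji, hji']

omit [NeZero N] in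
theorem coeff_X_mul_X {i j k l : Fin N} (hkl : k ≠ l) :
    coeff (Finsupp.single i 1 + Finsupp.single j 1) (X k * X l : Poly N) =
      if (i = k ∧ j = l) ∨ (i = l ∧ j = k) then 1 else 0 := by
  rw [X, X, monomial_mul, coeff_monomial, mul_one]
  refine if_congr ⟨fun h => ?_, ?_⟩ rfl rfl
  · have hk := DFunLike.congr_fun h k
    have hl := DFunLike.congr_fun h l
    simp only [Finsupp.add_apply, Finsupp.single_apply, if_true, if_neg hkl, if_neg hkl.symm]
      at hk hl
    grind
  · rintro (⟨rfl, rfl⟩ | ⟨rfl, rfl⟩)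
    exacts [rfl, add_comm _ _]

theorem isDunklQuotient_zero_X_mul_X (hN : 2 ≤ N) {j l : Fin N} (hjl : j ≠ l) :
    IsDunklQuotient 0 (X j * X l : Poly N) fun i =>
      -C (coeff (Finsupp.single i 1 + Finsupp.single (i + 1) 1) (X j * X l : Poly N)) := fun i => by
  have hi := fin_ne_add_one hN i
  simp only [coeff_X_mul_X hjl, pairDeriv_apply, map_mul, rename_X, thetaPoly, Derivation.leibniz,
    smul_eq_mul, Fin.val_zero, pow_zero, one_mul, pderiv_X, Pi.single_apply, Equiv.swap_apply_def]
  split_ifs <;> grind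

theorem isDunklQuotient_two_cofactor (hN : 2 ≤ N) (j : Fin N) :
    IsDunklQuotient 2 (cofactor j) fun _ => cofactor j := fun i => by
  have hi := fin_ne_add_one hN i
  have h₁ := X_mul_pderiv_cofactor i j
  have h₂ := X_mul_pderiv_cofactor (i + 1) j
  have h₃ : X i * cofactor i = X (i + 1) * cofactor (i + 1) := by simp only [X_mul_cofactor]
  simp only [pairDeriv_apply, rename_cofactor, thetaPoly, Fin.val_two]
  rcases eq_or_ne j i with rfl | hji
  · rw [if_pos rfl] at h₁
    rw [if_neg hi.symm] at h₂
    rw [Equiv.swap_apply_left]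
    linear_combination (X j - X (j + 1)) * (X j * h₁ - X (j + 1) * h₂) - X j * h₃
  rcases eq_or_ne j (i + 1) with rfl | hji'
  · rw [if_neg hi] at h₁
    rw [if_pos rfl] at h₂
    rw [Equiv.swap_apply_right]
    linear_combination (X i - X (i + 1)) * (X i * h₁ - X (i + 1) * h₂) + X (i + 1) * h₃
  · rw [if_neg hji.symm] at h₁
    rw [if_neg hji'.symm] at h₂
    rw [Equiv.swap_apply_of_ne_of_ne hji hji']
    linear_combination (X i - X (i + 1)) * (X i * h₁ - X (i + 1) * h₂)

end DunklQuotients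

section ReducedStates

variable {N : ℕ} [NeZero N]

theorem gaugeHam_one (hN : 2 ≤ N) (ε : Fin 3) (a b ω : ℝ) :
    gaugeHam ε a b ω (1 : Poly N) = toRat (C (constE ε N a b ω : ℂ)) := by
  rw [gaugeHam_eq_of_isDunklQuotient hN (isDunklQuotient_one ε)]
  simp [laplacian, opJminus, opJzero]

theorem gaugeHam_zero_sigma_one (hN : 2 ≤ N) (a b ω : ℝ) :
    gaugeHam 0 a b ω (sigma N 1) =
      toRat (C (2 * ω : ℂ) * sigma N 1 + C (constE 0 N a b ω : ℂ) * sigma N 1) := by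
  have h : IsDunklQuotient 0 (sigma N 1) fun _ => 0 := isDunklQuotient_sigma fun i => by simp
  rw [gaugeHam_eq_of_isDunklQuotient hN h, laplacian_sigma,
    opJzero_of_isHomogeneous (isHomogeneous_sigma 1)]
  simp [constMinus, constZero]

theorem gaugeHam_zero_sigma_two (hN : 2 ≤ N) (a b ω : ℝ) :
    gaugeHam 0 a b ω (sigma N 2) =
      toRat (C (-(2 * N * (1 + 2 * a)) : ℂ) + C (4 * ω : ℂ) * sigma N 2
        + C (constE 0 N a b ω : ℂ) * sigma N 2) := by
  have h : IsDunklQuotient 0 (sigma N 2) fun _ => 2 := isDunklQuotient_sigma fun i => by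
    simp only [Fin.val_zero, Nat.cast_ofNat, map_ofNat]
    ring
  rw [gaugeHam_eq_of_isDunklQuotient hN h, laplacian_sigma,
    opJzero_of_isHomogeneous (isHomogeneous_sigma 2)]
  refine congrArg toRat ?_
  simp only [Complex.ofReal_neg, Complex.ofReal_one, C_neg, C_1, Fin.coe_ofNat_eq_mod,
    Nat.zero_mod, tsub_self, add_zero, map_natCast, C_mul, Finset.sum_const, Finset.card_univ,
    Fintype.card_fin, Complex.ofReal_zero, C_0, Complex.ofReal_mul, Complex.ofReal_ofNat, C_add,
    constC, map_ofNat C, sigma_zero, constMinus, constZero]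
  ring

theorem gaugeHam_zero_sigma_three (hN : 2 ≤ N) (a b ω : ℝ) :
    gaugeHam 0 a b ω (sigma N 3) =
      toRat (C (-(6 * (1 + 2 * a)) : ℂ) * sigma N 1 + C (6 * ω : ℂ) * sigma N 3
        + C (constE 0 N a b ω : ℂ) * sigma N 3) := by
  have h : IsDunklQuotient 0 (sigma N 3) fun i => 3 * (X i + X (i + 1)) :=
    isDunklQuotient_sigma fun i => by
      simp only [Fin.val_zero, Nat.cast_ofNat, map_ofNat]
      ring
  rw [gaugeHam_eq_of_isDunklQuotient hN h, laplacian_sigma,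
    opJzero_of_isHomogeneous (isHomogeneous_sigma 3), ← Finset.mul_sum, sum_X_add_X]
  refine congrArg toRat ?_
  simp only [Complex.ofReal_neg, Complex.ofReal_one, C_neg, C_1, Nat.cast_ofNat,
    Nat.add_one_sub_one, C_mul, Fin.coe_ofNat_eq_mod, Complex.ofReal_zero, C_0, Complex.ofReal_mul,
    Complex.ofReal_ofNat, C_add, constC, map_ofNat C, constMinus, constZero]
  ring

theorem gaugeHam_zero_X (hN : 2 ≤ N) (a b ω : ℝ) (j : Fin N) :
    gaugeHam 0 a b ω (X j) = toRat (C (2 * ω + constE 0 N a b ω : ℂ) * X j) := by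
  have h := isDunklQuotient_X hN (ε := 0) (r := fun _ => 0) (by simp [thetaPoly])
    (by simp [thetaPoly]) j
  rw [gaugeHam_eq_of_isDunklQuotient hN h, laplacian_X,
    opJzero_of_isHomogeneous (isHomogeneous_X ℂ j)]
  refine congrArg toRat ?_
  simp only [zero_mul, Finset.sum_const_zero, Complex.ofReal_zero, C_0, Complex.ofReal_mul,
    Complex.ofReal_ofNat, Nat.cast_one, C_1, C_add, constMinus, constZero]
  ring

theorem gaugeHam_zero_X_sq (hN : 2 ≤ N) (a b ω : ℝ) (j : Fin N) :
    gaugeHam 0 a b ω (X j ^ 2) =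
      toRat (C (-(2 * (1 + 2 * a)) : ℂ) + C (4 * ω + constE 0 N a b ω : ℂ) * X j ^ 2) := by
  have hL : laplacian 0 (X j ^ 2 : Poly N) = 2 := by
    rw [sq, laplacian_mul, laplacian_X, carreDuChamp_X]
    simp
  rw [gaugeHam_eq_of_isDunklQuotient hN (isDunklQuotient_zero_X_sq hN j), hL, sum_incidence,
    opJzero_of_isHomogeneous (isHomogeneous_X_pow j 2)]
  refine congrArg toRat ?_
  simp only [Complex.ofReal_neg, Complex.ofReal_one, C_neg, C_1, C_mul, Complex.ofReal_zero, C_0,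
    Complex.ofReal_mul, Complex.ofReal_ofNat, Nat.cast_ofNat, C_add, constC, map_ofNat C,
    constMinus, constZero]
  ring

theorem gaugeHam_zero_X_mul_X (hN : 2 ≤ N) (a b ω : ℝ) {j l : Fin N} (hjl : j ≠ l) :
    gaugeHam 0 a b ω (X j * X l) =
      toRat (C (2 * a : ℂ) * ∑ i : Fin N,
          C (coeff (Finsupp.single i 1 + Finsupp.single (i + 1) 1) (X j * X l : Poly N))
        + C (4 * ω + constE 0 N a b ω : ℂ) * (X j * X l)) := by
  have hL : laplacian 0 (X j * X l : Poly N) = 0 := by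
    rw [laplacian_mul, laplacian_X, laplacian_X, carreDuChamp_X, pderiv_X_of_ne hjl]
    simp
  rw [gaugeHam_eq_of_isDunklQuotient hN (isDunklQuotient_zero_X_mul_X hN hjl), hL,
    opJzero_of_isHomogeneous ((isHomogeneous_X ℂ j).mul (isHomogeneous_X ℂ l)),
    Finset.sum_neg_distrib]
  refine congrArg toRat ?_
  simp only [Complex.ofReal_neg, Complex.ofReal_one, C_neg, C_1, C_mul, Complex.ofReal_zero, C_0,
    Complex.ofReal_mul, Complex.ofReal_ofNat, Nat.reduceAdd, Nat.cast_ofNat, C_add, constC,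
    map_ofNat C, constMinus, constZero]
  ring

theorem gaugeHam_one_sigma_one (hN : 2 ≤ N) (a b ω : ℝ) :
    gaugeHam 1 a b ω (sigma N 1) =
      toRat (C (-(N * (8 * a + 2 * (2 * b + 1))) : ℂ) + C (4 * ω : ℂ) * sigma N 1
        + C (constE 1 N a b ω : ℂ) * sigma N 1) := by
  have h : IsDunklQuotient 1 (sigma N 1) fun _ => 1 := isDunklQuotient_sigma fun i => by simp
  rw [gaugeHam_eq_of_isDunklQuotient hN h, laplacian_sigma, opJminus_sigma,
    opJzero_of_isHomogeneous (isHomogeneous_sigma 1)]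
  refine congrArg toRat ?_
  simp only [Complex.ofReal_neg, Complex.ofReal_ofNat, C_neg, tsub_self, C_mul, Finset.sum_const,
    Finset.card_univ, Fintype.card_fin, Complex.ofReal_mul, Complex.ofReal_add, Complex.ofReal_one,
    C_add, map_natCast, constC, map_ofNat C, constMinus, sigma_zero, constZero]
  ring

theorem gaugeHam_one_sigma_two (hN : 2 ≤ N) (a b ω : ℝ) :
    gaugeHam 1 a b ω (sigma N 2) =
      toRat (C (-(4 * (2 + 8 * a + (2 * b + 1))) : ℂ) * sigma N 1 + C (8 * ω : ℂ) * sigma N 2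
        + C (constE 1 N a b ω : ℂ) * sigma N 2) := by
  have h : IsDunklQuotient 1 (sigma N 2) fun i => 2 * (X i + X (i + 1)) :=
    isDunklQuotient_sigma fun i => by
      simp only [Fin.val_one, Nat.cast_ofNat, map_ofNat]
      ring
  rw [gaugeHam_eq_of_isDunklQuotient hN h, laplacian_sigma, opJminus_sigma,
    opJzero_of_isHomogeneous (isHomogeneous_sigma 2), ← Finset.mul_sum, sum_X_add_X]
  refine congrArg toRat ?_
  simp only [Complex.ofReal_neg, Complex.ofReal_ofNat, C_neg, Nat.cast_ofNat, Nat.add_one_sub_one,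
    Nat.cast_one, Fin.coe_ofNat_eq_mod, C_mul, Complex.ofReal_mul, Complex.ofReal_add,
    Complex.ofReal_one, C_add, C_1, constC, map_ofNat C, constMinus, constZero]
  ring

theorem gaugeHam_one_X (hN : 2 ≤ N) (a b ω : ℝ) (j : Fin N) :
    gaugeHam 1 a b ω (X j) =
      toRat (C (-(8 * a + 2 * (2 * b + 1)) : ℂ) + C (4 * ω + constE 1 N a b ω : ℂ) * X j) := by
  have h2 : (2 : Poly N) * C (1 / 2 : ℂ) = 1 := by
    rw [← map_ofNat C, ← C_mul]
    norm_num
  have h := isDunklQuotient_X (N := N) hN (ε := 1) (r := fun _ => C (1 / 2 : ℂ))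
    (fun x y => by simp only [thetaPoly, Fin.val_one]; linear_combination (-x) * h2)
    (fun x y => by simp only [thetaPoly]; ring) j
  rw [gaugeHam_eq_of_isDunklQuotient hN h, laplacian_X, opJminus_X, ← Finset.mul_sum,
    sum_incidence, mul_comm (C (1 / 2)), h2, opJzero_of_isHomogeneous (isHomogeneous_X ℂ j)]
  refine congrArg toRat ?_
  simp only [Complex.ofReal_neg, Complex.ofReal_ofNat, C_neg, C_mul, Complex.ofReal_mul,
    Complex.ofReal_add, Complex.ofReal_one, C_add, C_1, Nat.cast_one, constC, map_ofNat C,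
    constMinus, constZero]
  ring

theorem gaugeHam_two_sigma_one (hN : 2 ≤ N) (a b ω : ℝ) :
    gaugeHam 2 a b ω (sigma N 1) =
      toRat (C (4 * (1 + 2 * a) : ℂ) * sigma N 1 + C (constE 2 N a b ω : ℂ) * sigma N 1) := by
  have h : IsDunklQuotient 2 (sigma N 1) fun i => X i + X (i + 1) :=
    isDunklQuotient_sigma fun i => by
      simp only [Fin.val_two, Nat.cast_one, map_one]
      ring
  rw [gaugeHam_eq_of_isDunklQuotient hN h, laplacian_sigma, sum_X_add_X,
    opJzero_of_isHomogeneous (isHomogeneous_sigma 1)]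
  refine congrArg toRat ?_
  simp only [Complex.ofReal_ofNat, Nat.cast_one, CharP.cast_eq_zero, C_0, C_mul,
    Complex.ofReal_zero, Complex.ofReal_mul, Complex.ofReal_sub, Complex.ofReal_one, C_sub, C_1,
    C_add, constC, constMinus, constZero]
  ring

theorem gaugeHam_two_tau_pred (hN : 2 ≤ N) (a b ω : ℝ) :
    gaugeHam 2 a b ω (tau N (N - 1)) =
      toRat (C (8 * a * N + 4 * (1 - 2 * a) * (N - 1 : ℕ) : ℂ) * tau N (N - 1)
        + C (constE 2 N a b ω : ℂ) * tau N (N - 1)) := by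
  rw [gaugeHam_eq_of_isDunklQuotient hN isDunklQuotient_two_tau_pred, laplacian_two_tau_pred,
    opJzero_of_isHomogeneous (isHomogeneous_tau _)]
  refine congrArg toRat ?_
  simp only [Complex.ofReal_ofNat, C_mul, Finset.sum_const, Finset.card_univ, Fintype.card_fin,
    Complex.ofReal_zero, C_0, Complex.ofReal_mul, Complex.ofReal_sub, Complex.ofReal_one,
    map_natCast, C_add, constC, map_ofNat C, constMinus, constZero]
  ring

theorem gaugeHam_two_tau_self (hN : 2 ≤ N) (a b ω : ℝ) :
    gaugeHam 2 a b ω (tau N N) =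
      toRat (C (4 * N : ℂ) * tau N N + C (constE 2 N a b ω : ℂ) * tau N N) := by
  rw [gaugeHam_eq_of_isDunklQuotient hN isDunklQuotient_two_tau_self, laplacian_two_tau_self,
    opJzero_of_isHomogeneous (isHomogeneous_tau _)]
  refine congrArg toRat ?_
  simp only [Complex.ofReal_ofNat, C_mul, Finset.sum_const, Finset.card_univ, Fintype.card_fin,
    Complex.ofReal_zero, C_0, Complex.ofReal_mul, Complex.ofReal_sub, Complex.ofReal_one, C_sub,
    C_1, map_natCast, constC, constMinus, constZero]
  ring

theorem gaugeHam_two_X (hN : 2 ≤ N) (a b ω : ℝ) (j : Fin N) :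
    gaugeHam 2 a b ω (X j) = toRat (C (4 * (1 + 2 * a) + constE 2 N a b ω : ℂ) * X j) := by
  have h := isDunklQuotient_X (N := N) hN (ε := 2) (r := fun x => x)
    (fun x y => by simp only [thetaPoly, Fin.val_two]; ring)
    (fun x y => by simp only [thetaPoly]; ring) j
  rw [gaugeHam_eq_of_isDunklQuotient hN h, laplacian_X, ← Finset.mul_sum, sum_incidence,
    opJzero_of_isHomogeneous (isHomogeneous_X ℂ j)]
  refine congrArg toRat ?_
  simp only [Complex.ofReal_ofNat, C_mul, Complex.ofReal_zero, C_0, Complex.ofReal_mul,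
    Complex.ofReal_sub, Complex.ofReal_one, C_sub, C_1, Nat.cast_one, C_add, constC, constMinus,
    constZero]
  ring

theorem gaugeHam_two_cofactor (hN : 2 ≤ N) (a b ω : ℝ) (j : Fin N) :
    gaugeHam 2 a b ω (cofactor j) =
      toRat (C (8 * a * N + 4 * (1 - 2 * a) * (N - 1 : ℕ) + constE 2 N a b ω : ℂ)
        * cofactor j) := by
  rw [gaugeHam_eq_of_isDunklQuotient hN (isDunklQuotient_two_cofactor hN j),
    laplacian_two_cofactor, opJzero_of_isHomogeneous (isHomogeneous_cofactor j)]
  refine congrArg toRat ?_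
  simp only [Complex.ofReal_ofNat, C_mul, Finset.sum_const, Finset.card_univ, Fintype.card_fin,
    Complex.ofReal_zero, C_0, Complex.ofReal_mul, Complex.ofReal_sub, Complex.ofReal_one,
    map_natCast, C_add, constC, map_ofNat C, constMinus, constZero]
  ring

end ReducedStates

/-! ### Symmetrized states -/

section SymmetrizedStates

variable {N k : ℕ}

/-- The state `(N!)⁻¹ ∑_π Q_π |v ∘ π⟩`; for `Q_π = p ∘ π` it is `Λ(p |v⟩)`, and operators on the
first factor act on the `Q_π` one at a time. -/
def symState (v : Spin N k) : (Equiv.Perm (Fin N) → Poly N) →ₗ[ℂ] State N k where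
  toFun Q := fun s => ((N.factorial : ℂ)⁻¹) • ∑ π, v (fun i => s (π i)) • Q π
  map_add' P Q := by
    funext s
    simp only [Pi.add_apply, smul_add, Finset.sum_add_distrib]
  map_smul' c Q := by
    funext s
    simp only [Pi.smul_apply, RingHom.id_apply, Finset.smul_sum]
    refine Finset.sum_congr rfl fun π _ => ?_
    rw [smul_comm _ c (Q π), smul_comm _ c]

theorem symState_apply (v : Spin N k) (Q : Equiv.Perm (Fin N) → Poly N) (s : Config N k) :
    symState v Q s = ((N.factorial : ℂ)⁻¹) • ∑ π, v (fun i => s (π i)) • Q π := rfl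

theorem symmetrize_prodState (p : Poly N) (v : Spin N k) :
    symmetrize (prodState p v) = symState v fun π => rename π p := by
  funext s
  simp [symmetrize, symState_apply, totalPerm, prodState, Finset.sum_apply]

theorem symState_mul (v : Spin N k) (F : Poly N) (Q : Equiv.Perm (Fin N) → Poly N) :
    symState v (fun π => F * Q π) = fun s => F * symState v Q s := by
  funext s
  simp only [symState_apply, mul_smul_comm, Finset.mul_sum]

theorem mul_symmetrize_prodState (F p : Poly N) (v : Spin N k) :
    (fun s => F * symmetrize (prodState p v) s) = symState v fun π => F * rename π p := by
  rw [symState_mul, symmetrize_prodState]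

theorem symState_map (v : Spin N k) (T : Poly N →ₗ[ℂ] Poly N) (Q : Equiv.Perm (Fin N) → Poly N)
    (s : Config N k) : symState v (fun π => T (Q π)) s = T (symState v Q s) := by
  simp only [symState_apply, map_smul, map_sum]

theorem symState_spinPerm (σ : Equiv.Perm (Fin N)) (v : Spin N k)
    (Q : Equiv.Perm (Fin N) → Poly N) :
    symState (spinPerm σ v) (fun π => Q (π * σ)) = symState v Q := by
  funext s
  simp only [symState_apply]
  exact congrArg _ (Equiv.sum_comp (Equiv.mulRight σ) fun π => v (fun i => s (π i)) • Q π)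

theorem totalPerm_symmetrize (e : Equiv.Perm (Fin N)) (Φ : State N k) :
    totalPerm e (symmetrize Φ) = symmetrize Φ := by
  funext s
  simp only [totalPerm, symmetrize, Pi.smul_apply, Finset.sum_apply, map_smul, map_sum,
    rename_rename]
  exact congrArg _ (Fintype.sum_equiv (Equiv.mulLeft e) _ _ fun π => rfl)

theorem symState_one_of_invariant {w : Spin N k} (hw : ∀ π, spinPerm π w = w) (s : Config N k) :
    symState w (fun _ => 1) s = C (w s) := by
  have h : ∀ π : Equiv.Perm (Fin N), w (fun i => s (π i)) = w s := fun π => congrFun (hw π) s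
  have hN : (N.factorial : ℂ) ≠ 0 := Nat.cast_ne_zero.2 N.factorial_ne_zero
  simp only [symState_apply, h, Finset.sum_const, Finset.card_univ, Fintype.card_perm,
    Fintype.card_fin, ← Nat.cast_smul_eq_nsmul ℂ]
  rw [inv_smul_smul₀ hN, smul_eq_C_mul, mul_one]

variable [NeZero N]

theorem symState_sum_coeff {v : Spin N k} (hv : IsSpecialSpin v) :
    symState v (fun π => ∑ i : Fin N,
        C (coeff (Finsupp.single i 1 + Finsupp.single (i + 1) 1) (X (π 0) * X (π 1) : Poly N)))
      = symState (∑ i : Fin N, pairSpin v i (i + 1)) fun _ => 1 := by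
  funext s
  have h := symState_map v (∑ i : Fin N, (Algebra.linearMap ℂ (Poly N)).comp
    (lcoeff ℂ (Finsupp.single i 1 + Finsupp.single (i + 1) 1)))
    (fun π => (X (π 0) * X (π 1) : Poly N)) s
  simp only [LinearMap.sum_apply, LinearMap.comp_apply, Algebra.linearMap_apply,
    MvPolynomial.algebraMap_eq, lcoeff_apply] at h
  rw [symState_one_of_invariant hv, h, Finset.sum_apply, map_sum]
  refine Finset.sum_congr rfl fun i _ => ?_
  simp [pairSpin, symmetrize_prodState]

theorem gaugeHam_smul (ε : Fin 3) (a b ω : ℝ) (c : ℂ) (f : Poly N) :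
    gaugeHam ε a b ω (c • f) = toRat (C c) * gaugeHam ε a b ω f := by
  rw [smul_eq_C_mul, gaugeHam_C_mul]

theorem gaugeHam_sum {ι : Type*} (ε : Fin 3) (a b ω : ℝ) (s : Finset ι) (f : ι → Poly N) :
    gaugeHam ε a b ω (∑ i ∈ s, f i) = ∑ i ∈ s, gaugeHam ε a b ω (f i) :=
  map_sum (AddMonoidHom.mk' (gaugeHam ε a b ω) (gaugeHam_add ε a b ω)) f s

theorem gaugeMaps_symState {ε : Fin 3} {a b ω : ℝ} (v : Spin N k)
    {P Q : Equiv.Perm (Fin N) → Poly N} (h : ∀ π, gaugeHam ε a b ω (P π) = toRat (Q π)) :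
    GaugeMaps ε a b ω (symState v P) (symState v Q) := fun s => by
  simp only [symState_apply, gaugeHam_smul, gaugeHam_sum, h]
  simp only [smul_eq_C_mul, toRat, map_mul, map_sum]

/-- The states that the gauge Hamiltonian maps into a given space. -/
def preimage (ε : Fin 3) (a b ω : ℝ) (S : Submodule ℂ (State N k)) : Submodule ℂ (State N k) where
  carrier := {Φ | ∃ Ψ ∈ S, GaugeMaps ε a b ω Φ Ψ}
  zero_mem' := ⟨0, S.zero_mem, fun s => by
    simpa [toRat] using gaugeHam_C_mul (N := N) ε a b ω 0 0⟩
  add_mem' := by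
    rintro Φ Φ' ⟨Ψ, h, hm⟩ ⟨Ψ', h', hm'⟩
    refine ⟨Ψ + Ψ', S.add_mem h h', fun s => ?_⟩
    rw [Pi.add_apply, gaugeHam_add, hm s, hm' s, Pi.add_apply, toRat, toRat, toRat, map_add]
  smul_mem' := by
    rintro c Φ ⟨Ψ, h, hm⟩
    refine ⟨c • Ψ, S.smul_mem c h, fun s => ?_⟩
    rw [Pi.smul_apply, gaugeHam_smul, hm s, Pi.smul_apply, smul_eq_C_mul, toRat, toRat, toRat,
      map_mul]

end SymmetrizedStates

/-! ### Spaces filtered by degree -/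

section Coefficients

variable {R σ τ υ : Type*} [CommSemiring R]

theorem map_rename_restrictSupport {e : σ → τ} (he : Function.Injective e) (s : Set (σ →₀ ℕ)) :
    (restrictSupport R s).map (rename e : MvPolynomial σ R →ₐ[R] MvPolynomial τ R).toLinearMap =
      restrictSupport R {d | (∀ i ∉ Set.range e, d i = 0) ∧ d.comapDomain e he.injOn ∈ s} := by
  rw [restrictSupport_eq_span, restrictSupport_eq_span, Submodule.map_span, Set.image_image]
  congr 1
  ext f
  constructor
  · rintro ⟨d, hd, rfl⟩
    refine ⟨d.mapDomain e, ⟨fun i hi => Finsupp.mapDomain_of_notMem_range _ _ hi, ?_⟩, ?_⟩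
    · rwa [Finsupp.comapDomain_mapDomain e he]
    · exact (rename_monomial e d 1).symm
  · rintro ⟨d, ⟨hd, hs⟩, rfl⟩
    refine ⟨_, hs, ?_⟩
    have : (d.comapDomain e he.injOn).mapDomain e = d :=
      Finsupp.mapDomain_comapDomain e he d fun i hi => by
        by_contra h
        exact Finsupp.mem_support_iff.1 hi (hd i h)
    exact (rename_monomial e _ 1).trans (congrArg (monomial · 1) this)

/-- The exponents in `s` of weight at most `n - c`. -/
def admissible (w : σ → ℕ) (s : Set (σ →₀ ℕ)) (c n : ℕ) : Set (σ →₀ ℕ) :=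
  {d ∈ s | Finsupp.weight w d + c ≤ n}

/-- The polynomials `f(p_1, …, p_m)` in which the exponents of the monomials of `f` lie in `s` and
the degree, counted with weight `w i` for `p_i`, is at most `n - c`. -/
def coeffSpace (p : σ → MvPolynomial τ R) (w : σ → ℕ) (s : Set (σ →₀ ℕ)) (c n : ℕ) :
    Submodule R (MvPolynomial τ R) :=
  (restrictSupport R (admissible w s c n)).map (aeval p).toLinearMap

variable {p : σ → MvPolynomial τ R} {w : σ → ℕ} {s : Set (σ →₀ ℕ)} {c n : ℕ}

theorem mem_coeffSpace_iff_of_ne_zero (hp : ∀ i, (p i).IsHomogeneous (w i))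
    {F : MvPolynomial τ R} (hF : F ≠ 0) :
    F ∈ coeffSpace p w s c n ↔ (∃ f ∈ restrictSupport R s, aeval p f = F) ∧
      F.totalDegree + c ≤ n := by
  constructor
  · rintro ⟨f, hf, rfl⟩
    have hf0 : f ≠ 0 := by
      rintro rfl
      exact hF (map_zero _)
    obtain ⟨d, hd⟩ := support_nonempty.2 hf0
    have hc : c ≤ n := (Nat.le_add_left _ _).trans (hf hd).2
    refine ⟨⟨f, restrictSupport_mono R (fun d hd => hd.1) hf, rfl⟩, ?_⟩
    have := totalDegree_aeval_le hp (m := n - c)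
      (restrictSupport_mono R (fun d hd => Nat.le_sub_of_add_le hd.2) hf)
    exact Nat.add_le_of_le_sub hc this
  · rintro ⟨⟨f, hf, rfl⟩, hn⟩
    obtain ⟨g, hg, hgf⟩ := exists_aeval_eq_of_totalDegree_le hp hf (Nat.le_sub_of_add_le hn)
    have hsub : {d ∈ s | Finsupp.weight w d ≤ n - c} ⊆ admissible w s c n :=
      fun d hd => ⟨hd.1, Nat.add_le_of_le_sub ((Nat.le_add_left _ _).trans hn) hd.2⟩
    exact ⟨g, restrictSupport_mono R hsub hg, hgf⟩

theorem exists_aeval_eq_iff_of_injective {q : υ → MvPolynomial τ R} {e : υ → σ}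
    (he : Function.Injective e) (hq : ∀ i, q i = p (e i)) {t : Set (υ →₀ ℕ)}
    (hs : s = {d | (∀ i ∉ Set.range e, d i = 0) ∧ d.comapDomain e he.injOn ∈ t})
    (F : MvPolynomial τ R) :
    (∃ f ∈ restrictSupport R s, aeval p f = F) ↔ ∃ f ∈ restrictSupport R t, aeval q f = F := by
  obtain rfl : q = p ∘ e := funext hq
  rw [hs, ← map_rename_restrictSupport he]
  simp only [Submodule.mem_map, AlgHom.toLinearMap_apply, exists_exists_and_eq_and, aeval_rename]

theorem aeval_mem_coeffSpace {f : MvPolynomial σ R}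
    (hf : f ∈ restrictSupport R (admissible w s c n)) :
    aeval p f ∈ coeffSpace p w s c n :=
  ⟨f, hf, rfl⟩

end Coefficients

variable {N k : ℕ}

/-- The span of the states `F Λ(φ |v⟩)` with `F ∈ B` and `v ∈ V`. -/
def stateSpace (B : Submodule ℂ (Poly N)) (φ : Poly N) (V : Set (Spin N k)) :
    Submodule ℂ (State N k) :=
  Submodule.span ℂ {Φ | ∃ F ∈ B, ∃ v ∈ V, Φ = fun s => F * symmetrize (prodState φ v) s}

theorem symState_mem_stateSpace {B : Submodule ℂ (Poly N)} {V : Set (Spin N k)} {F : Poly N}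
    {v : Spin N k} (hF : F ∈ B) (hv : v ∈ V) (φ : Poly N) :
    symState v (fun π => F * rename π φ) ∈ stateSpace B φ V :=
  Submodule.subset_span ⟨F, hF, v, hv, (mul_symmetrize_prodState F φ v).symm⟩

theorem span_setOf_eq_stateSpace {κ : ℕ} {q : Fin κ → Poly N} {φ : Poly N}
    {A : Submodule ℂ (MvPolynomial (Fin κ) ℂ)} {B : Submodule ℂ (Poly N)} {V : Set (Spin N k)}
    {c n : ℕ} (hB : ∀ F ≠ 0, F ∈ B ↔ (∃ f ∈ A, aeval q f = F) ∧ F.totalDegree + c ≤ n) :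
    Submodule.span ℂ {Φ | ∃ f v, f ∈ A ∧ v ∈ V ∧ (substPoly q f).totalDegree + c ≤ n ∧
      Φ = fun s => substPoly q f * symmetrize (prodState φ v) s} = stateSpace B φ V := by
  apply le_antisymm <;> refine Submodule.span_le.2 ?_
  · rintro _ ⟨f, v, hf, hv, hn, rfl⟩
    by_cases hF : substPoly q f = 0
    · simp only [hF, zero_mul]
      exact zero_mem _
    · exact Submodule.subset_span ⟨_, (hB _ hF).2 ⟨⟨f, hf, rfl⟩, hn⟩, v, hv, rfl⟩
  · rintro _ ⟨F, hFB, v, hv, rfl⟩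
    by_cases hF : F = 0
    · simp only [hF, zero_mul]
      exact zero_mem _
    · obtain ⟨⟨f, hf, rfl⟩, hn⟩ := (hB F hF).1 hFB
      exact Submodule.subset_span ⟨f, v, hf, hv, hn, rfl⟩

theorem stateSpace_le_preimage [NeZero N] {ε : Fin 3} {a b ω : ℝ} {S : Submodule ℂ (State N k)}
    {B : Submodule ℂ (Poly N)} {φ : Poly N} {V : Set (Spin N k)}
    (h : ∀ F ∈ B, ∀ v ∈ V, ∃ Q : Equiv.Perm (Fin N) → Poly N, symState v Q ∈ S ∧
      ∀ π : Equiv.Perm (Fin N), gaugeHam ε a b ω (F * rename π φ) = toRat (Q π)) :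
    stateSpace B φ V ≤ preimage ε a b ω S := by
  refine Submodule.span_le.2 ?_
  rintro _ ⟨F, hF, v, hv, rfl⟩
  obtain ⟨Q, hQ, hm⟩ := h F hF v hv
  rw [mul_symmetrize_prodState]
  exact ⟨_, hQ, gaugeMaps_symState v hm⟩

/-! ### Invariance for `ε = 0` -/

section RationalSpaces

section Derivatives

variable {R σ : Type*} [CommSemiring R]

theorem X_mul_pderiv_mem_restrictSupport {s t : Set (σ →₀ ℕ)} {f : MvPolynomial σ R}
    (hf : f ∈ restrictSupport R s) {i j : σ}
    (h : ∀ d, d + Finsupp.single j 1 ∈ s → d + Finsupp.single i 1 ∈ t) :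
    X i * pderiv j f ∈ restrictSupport R t :=
  X_mul_mem_restrictSupport
    (pderiv_mem_restrictSupport (t := {d | d + Finsupp.single j 1 ∈ s}) hf fun _ hd => hd) h

theorem X_mul_pderiv_pderiv_mem_restrictSupport {s t : Set (σ →₀ ℕ)} {f : MvPolynomial σ R}
    (hf : f ∈ restrictSupport R s) {i j l : σ}
    (h : ∀ d, d + Finsupp.single j 1 + Finsupp.single l 1 ∈ s → d + Finsupp.single i 1 ∈ t) :
    X i * pderiv j (pderiv l f) ∈ restrictSupport R t :=
  X_mul_pderiv_mem_restrictSupport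
    (pderiv_mem_restrictSupport (t := {d | d + Finsupp.single l 1 ∈ s}) hf fun _ hd => hd) h

theorem X_mul_X_mul_pderiv_pderiv_mem_restrictSupport {s t : Set (σ →₀ ℕ)}
    {f : MvPolynomial σ R} (hf : f ∈ restrictSupport R s) {i j l m : σ}
    (h : ∀ d, d + Finsupp.single l 1 + Finsupp.single m 1 ∈ s →
      d + Finsupp.single j 1 + Finsupp.single i 1 ∈ t) :
    X i * (X j * pderiv l (pderiv m f)) ∈ restrictSupport R t :=
  X_mul_mem_restrictSupport (X_mul_pderiv_pderiv_mem_restrictSupport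
    (t := {d | d + Finsupp.single i 1 ∈ t}) hf h) fun _ hd => hd

theorem pderiv_mem_restrictSupport_admissible {w : σ → ℕ} {s t : Set (σ →₀ ℕ)} {c c' n : ℕ}
    {f : MvPolynomial σ R} (hf : f ∈ restrictSupport R (admissible w s c n)) {i : σ}
    (hs : ∀ d, d + Finsupp.single i 1 ∈ s → d ∈ t) (hc : c' ≤ w i + c) :
    pderiv i f ∈ restrictSupport R (admissible w t c' n) := by
  refine pderiv_mem_restrictSupport hf fun d ⟨hd, hw⟩ => ⟨hs d hd, ?_⟩
  rw [map_add, Finsupp.weight_single, one_smul] at hw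
  omega

theorem X_mul_pderiv_mem_restrictSupport_admissible {w : σ → ℕ} {s t : Set (σ →₀ ℕ)}
    {c c' n n' : ℕ} {f : MvPolynomial σ R} (hf : f ∈ restrictSupport R (admissible w s c n))
    {i j : σ}
    (hs : ∀ d, d + Finsupp.single j 1 ∈ s → d + Finsupp.single i 1 ∈ t)
    (hc : w i + c' + n ≤ w j + c + n') :
    X i * pderiv j f ∈ restrictSupport R (admissible w t c' n') := by
  refine X_mul_pderiv_mem_restrictSupport hf fun d ⟨hd, hw⟩ => ⟨hs d hd, ?_⟩
  rw [map_add, Finsupp.weight_single, one_smul] at hw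
  rw [map_add, Finsupp.weight_single, one_smul]
  omega

theorem weight_fin_three (w : Fin 3 → ℕ) (d : Fin 3 →₀ ℕ) :
    Finsupp.weight w d = d 0 * w 0 + d 1 * w 1 + d 2 * w 2 := by
  simp [Finsupp.weight_apply, Finsupp.sum_fintype, Fin.sum_univ_three]

end Derivatives

variable {N k n : ℕ}

/-- The symmetric functions `σ_1, σ_2, σ_3` generating the coefficients for `ε = 0`. -/
def genZero (N : ℕ) : Fin 3 → Poly N := ![sigma N 1, sigma N 2, sigma N 3]

theorem isHomogeneous_genZero (i : Fin 3) :
    (genZero N i).IsHomogeneous ((![1, 2, 3] : Fin 3 → ℕ) i) := by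
  fin_cases i
  exacts [isHomogeneous_sigma 1, isHomogeneous_sigma 2, isHomogeneous_sigma 3]

theorem isSymmetric_genZero (i : Fin 3) : (genZero N i).IsSymmetric := by
  fin_cases i
  exacts [isSymmetric_sigma 1, isSymmetric_sigma 2, isSymmetric_sigma 3]

/-- The operator on functions of `σ_1, σ_2, σ_3`, of degree at most one in `σ_3`, induced by the
gauge Hamiltonian for `ε = 0` without its constant term. -/
def formalHamZero (N : ℕ) (a ω : ℝ) (f : MvPolynomial (Fin 3) ℂ) : MvPolynomial (Fin 3) ℂ :=
  (2 * ω : ℂ) • (X 0 * pderiv 0 f) + (4 * ω : ℂ) • (X 1 * pderiv 1 f)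
    + (6 * ω : ℂ) • (X 2 * pderiv 2 f)
    - (2 * N * (1 + 2 * a) : ℂ) • pderiv 1 f - (6 * (1 + 2 * a) : ℂ) • (X 0 * pderiv 2 f)
    - (N : ℂ) • pderiv 0 (pderiv 0 f) - (4 : ℂ) • (X 0 * pderiv 0 (pderiv 1 f))
    - (4 : ℂ) • (X 1 * pderiv 1 (pderiv 1 f)) - (6 : ℂ) • (X 1 * pderiv 0 (pderiv 2 f))
    - (12 : ℂ) • (X 2 * pderiv 1 (pderiv 2 f))

theorem formalHamZero_mem_restrictSupport {m c : ℕ} {f : MvPolynomial (Fin 3) ℂ}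
    (hf : f ∈ restrictSupport ℂ (admissible ![1, 2, 3] {d | d 2 ≤ m} c n)) (a ω : ℝ) :
    formalHamZero N a ω f ∈ restrictSupport ℂ (admissible ![1, 2, 3] {d | d 2 ≤ m} c n) := by
  have h0 : pderiv 0 f ∈ restrictSupport ℂ
      {d | d + Finsupp.single 0 1 ∈ admissible ![1, 2, 3] {d | d 2 ≤ m} c n} :=
    pderiv_mem_restrictSupport hf fun _ hd => hd
  refine sub_mem (sub_mem (sub_mem (sub_mem (sub_mem (sub_mem (sub_mem (add_mem (add_mem
    (Submodule.smul_mem _ _ (X_mul_pderiv_mem_restrictSupport hf ?_))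
    (Submodule.smul_mem _ _ (X_mul_pderiv_mem_restrictSupport hf ?_)))
    (Submodule.smul_mem _ _ (X_mul_pderiv_mem_restrictSupport hf ?_)))
    (Submodule.smul_mem _ _ (pderiv_mem_restrictSupport hf ?_)))
    (Submodule.smul_mem _ _ (X_mul_pderiv_mem_restrictSupport hf ?_)))
    (Submodule.smul_mem _ _ (pderiv_mem_restrictSupport h0 ?_)))
    (Submodule.smul_mem _ _ (X_mul_pderiv_pderiv_mem_restrictSupport hf ?_)))
    (Submodule.smul_mem _ _ (X_mul_pderiv_pderiv_mem_restrictSupport hf ?_)))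
    (Submodule.smul_mem _ _ (X_mul_pderiv_pderiv_mem_restrictSupport hf ?_)))
    (Submodule.smul_mem _ _ (X_mul_pderiv_pderiv_mem_restrictSupport hf ?_))
  all_goals
    rintro d ⟨hd, hw⟩
    simp only [Set.mem_ofPred_eq, Finsupp.coe_add, Pi.add_apply, ne_eq, Fin.reduceEq,
      not_false_eq_true, Finsupp.single_eq_of_ne, Finsupp.single_eq_same, Matrix.cons_val,
      weight_fin_three, admissible] at hd hw ⊢
    omega

theorem gaugeHam_zero_aeval_mul [NeZero N] (hN : 2 ≤ N) {a b ω : ℝ} {φ g : Poly N}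
    {f : MvPolynomial (Fin 3) ℂ} (hf : pderiv 2 (pderiv 2 f) = 0)
    (hg : gaugeHam 0 a b ω φ = toRat g) :
    gaugeHam 0 a b ω (aeval (genZero N) f * φ) = toRat (
      aeval (genZero N) (formalHamZero N a ω f) * φ + aeval (genZero N) f * g
      - 2 * (aeval (genZero N) (pderiv 0 f) * carreDuChamp 0 (sigma N 1) φ
        + aeval (genZero N) (pderiv 1 f) * carreDuChamp 0 (sigma N 2) φ
        + aeval (genZero N) (pderiv 2 f) * carreDuChamp 0 (sigma N 3) φ)) := by
  rw [gaugeHam_aeval_mul isSymmetric_genZero (L := formalHamZero N a ω f)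
    (G := ![C (2 * ω : ℂ) * sigma N 1,
      C (-(2 * N * (1 + 2 * a)) : ℂ) + C (4 * ω : ℂ) * sigma N 2,
      C (-(6 * (1 + 2 * a)) : ℂ) * sigma N 1 + C (6 * ω : ℂ) * sigma N 3]) ?_ ?_ hg]
  · refine congrArg toRat ?_
    simp only [Complex.ofReal_neg, Complex.ofReal_one, mul_neg, mul_one, C_neg, Matrix.cons_val,
      genZero, constC, map_ofNat C, Fin.sum_univ_three]
    ring
  · intro i
    fin_cases i
    exacts [gaugeHam_zero_sigma_one hN a b ω, gaugeHam_zero_sigma_two hN a b ω,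
      gaugeHam_zero_sigma_three hN a b ω]
  · have h10 := pderiv_pderiv_comm 1 0 f
    have h20 := pderiv_pderiv_comm 2 0 f
    have h21 := pderiv_pderiv_comm 2 1 f
    simp only [Fin.sum_univ_three, h10, h20, h21, hf, genZero, Matrix.cons_val,
      carreDuChamp_sigma_sigma, formalHamZero, map_sub, map_add, map_smul, map_mul, aeval_X]
    simp only [C_neg, C_mul, C_1, Complex.ofReal_neg, Complex.ofReal_one, Nat.cast_one,
      Fin.coe_ofNat_eq_mod, Nat.zero_mod, Nat.cast_ofNat, Nat.add_one_sub_one, zero_add, map_zero,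
      map_ofNat C, constC, sigma_zero, smul_eq_C_mul]
    ring

theorem pderiv_pderiv_eq_zero_of_mem_zero {m c : ℕ} (hm : m ≤ 1) {f : MvPolynomial (Fin 3) ℂ}
    (hf : f ∈ restrictSupport ℂ (admissible ![1, 2, 3] {d | d 2 ≤ m} c n)) :
    pderiv 2 (pderiv 2 f) = 0 :=
  pderiv_pderiv_eq_zero_iff_mem_restrictSupport.2
    (restrictSupport_mono ℂ (fun _ hd => le_trans hd.1 hm) hf)

theorem admissible_zero_subset {c : ℕ} :
    admissible ![1, 2, 3] {d : Fin 3 →₀ ℕ | d 2 ≤ 0} c n ⊆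
      admissible ![1, 2, 3] {d | d 2 ≤ 1} 0 n :=
  fun _ hd => ⟨le_trans (b := 0) hd.1 zero_le_one, le_of_add_le_left hd.2⟩

/-- The family of states `F Λ(φ |v⟩)`, `v ∈ V`, for `ε = 0`, where `F` has degree at most `m` in
`σ_3` and degree at most `n - c` in `z`. -/
def familyZero (m c n : ℕ) (φ : Poly N) (V : Set (Spin N k)) : Submodule ℂ (State N k) :=
  stateSpace (coeffSpace (genZero N) ![1, 2, 3] {d | d 2 ≤ m} c n) φ V

theorem span_eq_familyZero_one {c : ℕ} (φ : Poly N) :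
    Submodule.span ℂ {Φ : State N k | ∃ f v, pderiv 2 (pderiv 2 f) = 0 ∧
      (substPoly ![sigma N 1, sigma N 2, sigma N 3] f).totalDegree + c ≤ n ∧
      Φ = fun s => substPoly ![sigma N 1, sigma N 2, sigma N 3] f * symmetrize (prodState φ v) s} =
    familyZero 1 c n φ Set.univ := by
  rw [familyZero, ← span_setOf_eq_stateSpace fun F hF =>
    mem_coeffSpace_iff_of_ne_zero isHomogeneous_genZero hF]
  simp only [← pderiv_pderiv_eq_zero_iff_mem_restrictSupport, Set.mem_univ, true_and, genZero]

theorem span_eq_familyZero_zero {c : ℕ} (φ : Poly N) (V : Set (Spin N k)) :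
    Submodule.span ℂ {Φ | ∃ (f : MvPolynomial (Fin 2) ℂ) (v : Spin N k), v ∈ V ∧
      (substPoly ![sigma N 1, sigma N 2] f).totalDegree + c ≤ n ∧
      Φ = fun s => substPoly ![sigma N 1, sigma N 2] f * symmetrize (prodState φ v) s} =
    familyZero 0 c n φ V := by
  have he : Function.Injective (![0, 1] : Fin 2 → Fin 3) := by decide
  have hs : {d : Fin 3 →₀ ℕ | d 2 ≤ 0} = {d | (∀ i ∉ Set.range (![0, 1] : Fin 2 → Fin 3), d i = 0)
      ∧ d.comapDomain _ he.injOn ∈ Set.univ} := by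
    ext d
    simp [Fin.forall_fin_succ]
  have hq : ∀ i, ![sigma N 1, sigma N 2] i = genZero N (![0, 1] i) :=
    Fin.forall_fin_two.2 ⟨rfl, rfl⟩
  rw [familyZero, ← span_setOf_eq_stateSpace fun F hF =>
    (mem_coeffSpace_iff_of_ne_zero isHomogeneous_genZero hF).trans
      (and_congr_left' (exists_aeval_eq_iff_of_injective he hq hs F))]
  simp only [restrictSupport_univ, Submodule.mem_top, true_and]

theorem symState_mem_familyZero {m c : ℕ} {f : MvPolynomial (Fin 3) ℂ} {v : Spin N k}
    {V : Set (Spin N k)} (hf : f ∈ restrictSupport ℂ (admissible ![1, 2, 3] {d | d 2 ≤ m} c n))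
    (hv : v ∈ V) (φ : Poly N) :
    symState v (fun π => aeval (genZero N) f * rename π φ) ∈ familyZero m c n φ V :=
  symState_mem_stateSpace (aeval_mem_coeffSpace hf) hv φ

variable [NeZero N]

theorem symState_X_one_mem_familyZero {m c : ℕ} {f : MvPolynomial (Fin 3) ℂ}
    (hf : f ∈ restrictSupport ℂ (admissible ![1, 2, 3] {d | d 2 ≤ m} c n)) (v : Spin N k) :
    symState v (fun π => aeval (genZero N) f * X (π 1)) ∈ familyZero m c n (X 0) Set.univ := by
  have := symState_mem_familyZero hf (Set.mem_univ (spinPerm (Equiv.swap 0 1) v)) (X 0)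
  rw [← symState_spinPerm (Equiv.swap 0 1)]
  simpa using this

theorem symState_sum_coeff_mem_familyZero {m c : ℕ} {f : MvPolynomial (Fin 3) ℂ}
    (hf : f ∈ restrictSupport ℂ (admissible ![1, 2, 3] {d | d 2 ≤ m} c n)) {v : Spin N k}
    (hv : IsSpecialSpin v) :
    symState v (fun π => aeval (genZero N) f *
      ∑ i, C (coeff (Finsupp.single i 1 + Finsupp.single (i + 1) 1) (X (π 0) * X (π 1) : Poly N))) ∈
      familyZero m c n 1 Set.univ := by
  have := symState_mem_familyZero hf (Set.mem_univ (∑ i, pairSpin v i (i + 1))) 1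
  rw [symState_mul, symState_sum_coeff hv, ← symState_mul]
  simpa using this

theorem space0_eq : space0 N k n = familyZero 1 0 n 1 Set.univ ⊔ familyZero 1 1 n (X 0) Set.univ ⊔
    familyZero 0 2 n (X 0 ^ 2) Set.univ ⊔ familyZero 0 2 n (X 0 * X 1) {v | IsSpecialSpin v} := by
  simp only [← span_eq_familyZero_one, ← span_eq_familyZero_zero, ← Submodule.span_union, space0,
    Set.mem_univ, true_and, Set.mem_ofPred_eq, add_zero]

theorem familyZero_one_le_space0 : familyZero 1 0 n 1 Set.univ ≤ space0 N k n :=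
  space0_eq.ge.trans' (le_sup_left.trans (le_sup_left.trans le_sup_left))

theorem familyZero_X_le_space0 : familyZero 1 1 n (X 0) Set.univ ≤ space0 N k n :=
  space0_eq.ge.trans' (le_sup_right.trans (le_sup_left.trans le_sup_left))

theorem familyZero_X_sq_le_space0 : familyZero 0 2 n (X 0 ^ 2) Set.univ ≤ space0 N k n :=
  space0_eq.ge.trans' (le_sup_right.trans le_sup_left)

theorem familyZero_X_mul_X_le_space0 :
    familyZero 0 2 n (X 0 * X 1) {v | IsSpecialSpin v} ≤ space0 N k n :=
  space0_eq.ge.trans' le_sup_right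

theorem familyZero_one_le_preimage (hN : 2 ≤ N) (a b ω : ℝ) :
    familyZero 1 0 n 1 Set.univ ≤ preimage 0 a b ω (space0 N k n) := by
  refine stateSpace_le_preimage ?_
  rintro _ ⟨f, hf, rfl⟩ v hv
  have hL := add_mem (formalHamZero_mem_restrictSupport (N := N) hf a ω)
    (Submodule.smul_mem _ (constE 0 N a b ω : ℂ) hf)
  refine ⟨_, familyZero_one_le_space0 (symState_mem_familyZero hL hv 1), fun π => ?_⟩
  rw [map_one, AlgHom.toLinearMap_apply,
    gaugeHam_zero_aeval_mul hN (pderiv_pderiv_eq_zero_of_mem_zero le_rfl hf) (gaugeHam_one hN ..)]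
  refine congrArg toRat ?_
  simp only [Derivation.map_one_eq_zero, map_add, map_mul, algHom_C, algebraMap_eq, smul_eq_C_mul]
  ring

theorem familyZero_X_le_preimage (hN : 2 ≤ N) (a b ω : ℝ) :
    familyZero 1 1 n (X 0) Set.univ ≤ preimage 0 a b ω (space0 N k n) := by
  refine stateSpace_le_preimage ?_
  rintro _ ⟨f, hf, rfl⟩ v hv
  have hX : formalHamZero N a ω f + (2 * ω + constE 0 N a b ω : ℂ) • f - (4 : ℂ) • pderiv 1 f ∈
      restrictSupport ℂ (admissible ![1, 2, 3] {d | d 2 ≤ 1} 1 n) :=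
    sub_mem (add_mem (formalHamZero_mem_restrictSupport hf a ω) (Submodule.smul_mem _ _ hf)) <|
      Submodule.smul_mem _ _ <| pderiv_mem_restrictSupport_admissible hf (by simp) (by simp)
  have hOne : (2 : ℂ) • pderiv 0 f ∈
      restrictSupport ℂ (admissible ![1, 2, 3] {d | d 2 ≤ 1} 0 n) :=
    Submodule.smul_mem _ _ <| pderiv_mem_restrictSupport_admissible hf (by simp) (by simp)
  have hSq : (6 : ℂ) • pderiv 2 f ∈
      restrictSupport ℂ (admissible ![1, 2, 3] {d | d 2 ≤ 0} 2 n) :=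
    Submodule.smul_mem _ _ <| pderiv_mem_restrictSupport_admissible hf (by simp) (by simp)
  have hmem := sub_mem (sub_mem
    (familyZero_X_le_space0 (symState_mem_familyZero hX hv (X 0)))
    (familyZero_one_le_space0 (symState_mem_familyZero hOne hv 1)))
    (familyZero_X_sq_le_space0 (symState_mem_familyZero hSq hv (X 0 ^ 2)))
  rw [← map_sub, ← map_sub] at hmem
  refine ⟨_, hmem, fun π => ?_⟩
  rw [rename_X, AlgHom.toLinearMap_apply,
    gaugeHam_zero_aeval_mul hN (pderiv_pderiv_eq_zero_of_mem_zero le_rfl hf)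
      (gaugeHam_zero_X hN ..)]
  refine congrArg toRat ?_
  simp only [Pi.sub_apply, map_sub, map_add, map_smul, map_one, map_pow, rename_X]
  simp only [Fin.coe_ofNat_eq_mod, Nat.cast_one, C_1, Nat.cast_ofNat, C_add, map_ofNat C,
    carreDuChamp_X, pderiv_sigma, smul_eq_C_mul]
  ring

theorem familyZero_X_sq_le_preimage (hN : 2 ≤ N) (a b ω : ℝ) :
    familyZero 0 2 n (X 0 ^ 2) Set.univ ≤ preimage 0 a b ω (space0 N k n) := by
  refine stateSpace_le_preimage ?_
  rintro _ ⟨f, hf, rfl⟩ v hv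
  have hSq : formalHamZero N a ω f + (4 * ω + constE 0 N a b ω : ℂ) • f - (8 : ℂ) • pderiv 1 f ∈
      restrictSupport ℂ (admissible ![1, 2, 3] {d | d 2 ≤ 0} 2 n) :=
    sub_mem (add_mem (formalHamZero_mem_restrictSupport hf a ω) (Submodule.smul_mem _ _ hf)) <|
      Submodule.smul_mem _ _ <| pderiv_mem_restrictSupport_admissible hf (by simp) (by simp)
  have hX : (4 : ℂ) • pderiv 0 f ∈ restrictSupport ℂ (admissible ![1, 2, 3] {d | d 2 ≤ 1} 1 n) :=
    Submodule.smul_mem _ _ <| pderiv_mem_restrictSupport_admissible hf (by simp +contextual)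
        (by simp)
  have hOne : (2 * (1 + 2 * a) : ℂ) • f ∈
      restrictSupport ℂ (admissible ![1, 2, 3] {d | d 2 ≤ 1} 0 n) :=
    Submodule.smul_mem _ _ <| restrictSupport_mono ℂ admissible_zero_subset hf
  have hmem := sub_mem (sub_mem
    (familyZero_X_sq_le_space0 (symState_mem_familyZero hSq hv (X 0 ^ 2)))
    (familyZero_X_le_space0 (symState_mem_familyZero hX hv (X 0))))
    (familyZero_one_le_space0 (symState_mem_familyZero hOne hv 1))
  rw [← map_sub, ← map_sub] at hmem
  refine ⟨_, hmem, fun π => ?_⟩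
  have hd : pderiv 2 f = 0 :=
    pderiv_eq_zero_iff_mem_restrictSupport.2 <|
      restrictSupport_mono ℂ (fun _ hd => Nat.le_zero.1 hd.1) hf
  rw [map_pow, rename_X, AlgHom.toLinearMap_apply,
    gaugeHam_zero_aeval_mul hN (by rw [hd, map_zero]) (gaugeHam_zero_X_sq hN ..), hd]
  refine congrArg toRat ?_
  simp only [Pi.sub_apply, map_sub, map_add, map_smul, map_one, map_pow, map_zero, rename_X]
  simp only [C_neg, C_add, C_1, Derivation.leibniz_pow, Fin.coe_ofNat_eq_mod, Nat.cast_one,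
    Nat.cast_ofNat, map_ofNat C, carreDuChamp_X, pderiv_sigma, smul_eq_C_mul]
  ring

theorem familyZero_X_mul_X_le_preimage (hN : 2 ≤ N) (a b ω : ℝ) :
    familyZero 0 2 n (X 0 * X 1) {v | IsSpecialSpin v} ≤ preimage 0 a b ω (space0 N k n) := by
  refine stateSpace_le_preimage ?_
  rintro _ ⟨f, hf, rfl⟩ v hv
  have hXX : formalHamZero N a ω f + (4 * ω + constE 0 N a b ω : ℂ) • f - (8 : ℂ) • pderiv 1 f ∈
      restrictSupport ℂ (admissible ![1, 2, 3] {d | d 2 ≤ 0} 2 n) :=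
    sub_mem (add_mem (formalHamZero_mem_restrictSupport hf a ω) (Submodule.smul_mem _ _ hf)) <|
      Submodule.smul_mem _ _ <| pderiv_mem_restrictSupport_admissible hf (by simp) (by simp)
  have hX : (2 : ℂ) • pderiv 0 f ∈ restrictSupport ℂ (admissible ![1, 2, 3] {d | d 2 ≤ 1} 1 n) :=
    Submodule.smul_mem _ _ <| pderiv_mem_restrictSupport_admissible hf (by simp +contextual)
        (by simp)
  have hOne : (2 * a : ℂ) • f ∈ restrictSupport ℂ (admissible ![1, 2, 3] {d | d 2 ≤ 1} 0 n) :=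
    Submodule.smul_mem _ _ <| restrictSupport_mono ℂ admissible_zero_subset hf
  have hmem := add_mem (sub_mem (sub_mem
    (familyZero_X_mul_X_le_space0 (symState_mem_familyZero hXX hv (X 0 * X 1)))
    (familyZero_X_le_space0 (symState_mem_familyZero hX (Set.mem_univ v) (X 0))))
    (familyZero_X_le_space0 (symState_X_one_mem_familyZero hX v)))
    (familyZero_one_le_space0 (symState_sum_coeff_mem_familyZero hOne hv))
  rw [← map_sub, ← map_sub, ← map_add] at hmem
  refine ⟨_, hmem, fun π => ?_⟩
  have hπ : π 0 ≠ π 1 := π.injective.ne (by simpa using fin_ne_add_one hN 0)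
  have hd : pderiv 2 f = 0 :=
    pderiv_eq_zero_iff_mem_restrictSupport.2 <|
      restrictSupport_mono ℂ (fun _ hd => Nat.le_zero.1 hd.1) hf
  rw [map_mul, rename_X, rename_X, AlgHom.toLinearMap_apply,
    gaugeHam_zero_aeval_mul hN (by rw [hd, map_zero]) (gaugeHam_zero_X_mul_X hN _ _ _ hπ), hd]
  refine congrArg toRat ?_
  simp only [Pi.sub_apply, Pi.add_apply, map_sub, map_add, map_smul, map_mul, map_zero, rename_X]
  simp only [Derivation.leibniz, Fin.coe_ofNat_eq_mod, Nat.cast_one, C_1, Nat.cast_ofNat, C_add,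
    C_mul, map_ofNat C, carreDuChamp_X, pderiv_sigma, smul_eq_C_mul]
  ring

theorem space0_le_preimage (hN : 2 ≤ N) (a b ω : ℝ) :
    space0 N k n ≤ preimage 0 a b ω (space0 N k n) :=
  space0_eq.trans_le <| sup_le (sup_le (sup_le (familyZero_one_le_preimage hN a b ω)
    (familyZero_X_le_preimage hN a b ω)) (familyZero_X_sq_le_preimage hN a b ω))
    (familyZero_X_mul_X_le_preimage hN a b ω)

end RationalSpaces

/-! ### Invariance for `ε = 1` -/

section ReflectionSpaces

theorem weight_fin_two (w : Fin 2 → ℕ) (d : Fin 2 →₀ ℕ) :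
    Finsupp.weight w d = d 0 * w 0 + d 1 * w 1 := by
  simp [Finsupp.weight_apply, Finsupp.sum_fintype]

variable {N k n : ℕ}

/-- The symmetric functions `σ_1, σ_2` generating the coefficients for `ε = 1`. -/
def genOne (N : ℕ) : Fin 2 → Poly N := ![sigma N 1, sigma N 2]

theorem isHomogeneous_genOne : ∀ i, (genOne N i).IsHomogeneous ((![1, 2] : Fin 2 → ℕ) i) :=
  Fin.forall_fin_two.2 ⟨isHomogeneous_sigma 1, isHomogeneous_sigma 2⟩

theorem isSymmetric_genOne : ∀ i, (genOne N i).IsSymmetric :=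
  Fin.forall_fin_two.2 ⟨isSymmetric_sigma 1, isSymmetric_sigma 2⟩

/-- The operator on functions of `σ_1, σ_2`, of degree at most one in `σ_2`, induced by the gauge
Hamiltonian for `ε = 1` without its constant term. -/
def formalHamOne (N : ℕ) (a b ω : ℝ) (f : MvPolynomial (Fin 2) ℂ) : MvPolynomial (Fin 2) ℂ :=
  (4 * ω : ℂ) • (X 0 * pderiv 0 f) + (8 * ω : ℂ) • (X 1 * pderiv 1 f)
    - (N * (8 * a + 2 * (2 * b + 1)) : ℂ) • pderiv 0 f
    - (4 * (2 + 8 * a + (2 * b + 1)) : ℂ) • (X 0 * pderiv 1 f)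
    - (4 : ℂ) • (X 0 * pderiv 0 (pderiv 0 f)) - (16 : ℂ) • (X 1 * pderiv 0 (pderiv 1 f))

theorem formalHamOne_mem_restrictSupport {m c : ℕ} {f : MvPolynomial (Fin 2) ℂ}
    (hf : f ∈ restrictSupport ℂ (admissible ![1, 2] {d | d 1 ≤ m} c n)) (a b ω : ℝ) :
    formalHamOne N a b ω f ∈ restrictSupport ℂ (admissible ![1, 2] {d | d 1 ≤ m} c n) := by
  refine sub_mem (sub_mem (sub_mem (sub_mem (add_mem
    (Submodule.smul_mem _ _ (X_mul_pderiv_mem_restrictSupport hf ?_))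
    (Submodule.smul_mem _ _ (X_mul_pderiv_mem_restrictSupport hf ?_)))
    (Submodule.smul_mem _ _ (pderiv_mem_restrictSupport hf ?_)))
    (Submodule.smul_mem _ _ (X_mul_pderiv_mem_restrictSupport hf ?_)))
    (Submodule.smul_mem _ _ (X_mul_pderiv_pderiv_mem_restrictSupport hf ?_)))
    (Submodule.smul_mem _ _ (X_mul_pderiv_pderiv_mem_restrictSupport hf ?_))
  all_goals
    rintro d ⟨hd, hw⟩
    simp only [Set.mem_ofPred_eq, Finsupp.coe_add, Pi.add_apply, ne_eq, one_ne_zero,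
      not_false_eq_true, Finsupp.single_eq_of_ne, Finsupp.single_eq_same, Matrix.cons_val_zero,
      Matrix.cons_val_one, weight_fin_two, admissible] at hd hw ⊢
    omega

theorem gaugeHam_one_aeval_mul [NeZero N] (hN : 2 ≤ N) {a b ω : ℝ} {φ g : Poly N}
    {f : MvPolynomial (Fin 2) ℂ} (hf : pderiv 1 (pderiv 1 f) = 0)
    (hg : gaugeHam 1 a b ω φ = toRat g) :
    gaugeHam 1 a b ω (aeval (genOne N) f * φ) = toRat (
      aeval (genOne N) (formalHamOne N a b ω f) * φ + aeval (genOne N) f * g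
      - 8 * (aeval (genOne N) (pderiv 0 f) * carreDuChamp 1 (sigma N 1) φ
        + aeval (genOne N) (pderiv 1 f) * carreDuChamp 1 (sigma N 2) φ)) := by
  rw [gaugeHam_aeval_mul isSymmetric_genOne (L := formalHamOne N a b ω f)
    (G := ![C (-(N * (8 * a + 2 * (2 * b + 1))) : ℂ) + C (4 * ω : ℂ) * sigma N 1,
      C (-(4 * (2 + 8 * a + (2 * b + 1))) : ℂ) * sigma N 1 + C (8 * ω : ℂ) * sigma N 2]) ?_ ?_ hg]
  · refine congrArg toRat ?_
    simp only [Complex.ofReal_neg, Complex.ofReal_ofNat, C_neg, C_mul, Fin.sum_univ_two,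
      Matrix.cons_val_zero, Matrix.cons_val_one, genOne, constC, map_ofNat C]
    ring
  · exact Fin.forall_fin_two.2 ⟨gaugeHam_one_sigma_one hN a b ω, gaugeHam_one_sigma_two hN a b ω⟩
  · have h10 := pderiv_pderiv_comm 1 0 f
    simp only [Fin.sum_univ_two, h10, hf, genOne, Matrix.cons_val,
      carreDuChamp_sigma_sigma, formalHamOne, map_sub, map_add, map_smul, map_mul, aeval_X]
    simp only [C_neg, C_mul, C_1, Complex.ofReal_neg, Complex.ofReal_ofNat, Nat.cast_one,
      Fin.coe_ofNat_eq_mod, Nat.cast_ofNat, map_zero, map_ofNat C, constC, smul_eq_C_mul]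
    ring

/-- The family of states `F Λ(φ |v⟩)` for `ε = 1`, where `F` has degree at most `m` in `σ_2` and
degree at most `n - c` in `z`. -/
def familyOne (k m c n : ℕ) (φ : Poly N) : Submodule ℂ (State N k) :=
  stateSpace (coeffSpace (genOne N) ![1, 2] {d | d 1 ≤ m} c n) φ Set.univ

theorem span_eq_familyOne_one {c : ℕ} (φ : Poly N) :
    Submodule.span ℂ {Φ : State N k | ∃ f v, pderiv 1 (pderiv 1 f) = 0 ∧ pderiv 2 f = 0 ∧
      (substPoly ![sigma N 1, sigma N 2, tau N N] f).totalDegree + c ≤ n ∧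
      Φ = fun s => substPoly ![sigma N 1, sigma N 2, tau N N] f * symmetrize (prodState φ v) s} =
    familyOne k 1 c n φ := by
  have he : Function.Injective (![0, 1] : Fin 2 → Fin 3) := by decide
  have hs : {d : Fin 3 →₀ ℕ | d 1 ≤ 1 ∧ d 2 = 0} =
      {d | (∀ i ∉ Set.range (![0, 1] : Fin 2 → Fin 3), d i = 0) ∧
        d.comapDomain _ he.injOn ∈ {d | d 1 ≤ 1}} := by
    ext d
    simp [Fin.forall_fin_succ, and_comm]
  have hq : ∀ i, genOne N i = ![sigma N 1, sigma N 2, tau N N] (![0, 1] i) :=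
    Fin.forall_fin_two.2 ⟨rfl, rfl⟩
  rw [familyOne, ← span_setOf_eq_stateSpace fun F hF =>
    (mem_coeffSpace_iff_of_ne_zero isHomogeneous_genOne hF).trans
      (and_congr_left' (exists_aeval_eq_iff_of_injective he hq hs F).symm)]
  have hA (f : MvPolynomial (Fin 3) ℂ) : f ∈ restrictSupport ℂ {d | d 1 ≤ 1 ∧ d 2 = 0} ↔
      pderiv 1 (pderiv 1 f) = 0 ∧ pderiv 2 f = 0 :=
    Set.subset_inter_iff.trans <| and_congr
      pderiv_pderiv_eq_zero_iff_mem_restrictSupport.symm pderiv_eq_zero_iff_mem_restrictSupport.symm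
  simp only [hA, and_assoc, Set.mem_univ, true_and]

theorem span_eq_familyOne_zero {c : ℕ} (φ : Poly N) :
    Submodule.span ℂ {Φ : State N k | ∃ g v, pderiv 1 g = 0 ∧
      (substPoly ![sigma N 1, tau N N] g).totalDegree + c ≤ n ∧
      Φ = fun s => substPoly ![sigma N 1, tau N N] g * symmetrize (prodState φ v) s} =
    familyOne k 0 c n φ := by
  have he : Function.Injective (![0] : Fin 1 → Fin 2) := by decide
  have hs : {d : Fin 2 →₀ ℕ | d 1 = 0} = {d | (∀ i ∉ Set.range (![0] : Fin 1 → Fin 2), d i = 0) ∧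
      d.comapDomain _ he.injOn ∈ Set.univ} := by
    ext d
    simp [Fin.forall_fin_succ]
  have hq (p : Poly N) : ∀ i, ![sigma N 1] i = ![sigma N 1, p] (![0] i) :=
    Fin.forall_fin_one.2 rfl
  simp only [familyOne, Nat.le_zero]
  rw [← span_setOf_eq_stateSpace fun F hF =>
    (mem_coeffSpace_iff_of_ne_zero isHomogeneous_genOne hF).trans
      (and_congr_left' ((exists_aeval_eq_iff_of_injective he (hq _) hs F).trans
        (exists_aeval_eq_iff_of_injective he (hq (tau N N)) hs F).symm))]
  simp only [pderiv_eq_zero_iff_mem_restrictSupport, Set.mem_univ, true_and]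

theorem symState_mem_familyOne {m c : ℕ} {f : MvPolynomial (Fin 2) ℂ}
    (hf : f ∈ restrictSupport ℂ (admissible ![1, 2] {d | d 1 ≤ m} c n)) (v : Spin N k)
    (φ : Poly N) :
    symState v (fun π => aeval (genOne N) f * rename π φ) ∈ familyOne k m c n φ :=
  symState_mem_stateSpace (aeval_mem_coeffSpace hf) (Set.mem_univ v) φ

variable [NeZero N]

theorem space1_eq : space1 N k n = familyOne k 1 0 n 1 ⊔ familyOne k 0 1 n (X 0) := by
  simp only [← span_eq_familyOne_one, ← span_eq_familyOne_zero, ← Submodule.span_union, space1,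
    add_zero]

theorem familyOne_one_le_preimage (hN : 2 ≤ N) (a b ω : ℝ) :
    familyOne k 1 0 n 1 ≤ preimage 1 a b ω (space1 N k n) := by
  refine stateSpace_le_preimage ?_
  rintro _ ⟨f, hf, rfl⟩ v -
  have hL := add_mem (formalHamOne_mem_restrictSupport (N := N) hf a b ω)
    (Submodule.smul_mem _ (constE 1 N a b ω : ℂ) hf)
  refine ⟨_, space1_eq.ge (Submodule.mem_sup_left (symState_mem_familyOne hL v 1)), fun π => ?_⟩
  have hd : pderiv 1 (pderiv 1 f) = 0 :=
    pderiv_pderiv_eq_zero_iff_mem_restrictSupport.2 <|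
      restrictSupport_mono ℂ (fun _ hd => hd.1) hf
  rw [map_one, AlgHom.toLinearMap_apply, gaugeHam_one_aeval_mul hN hd (gaugeHam_one hN ..)]
  refine congrArg toRat ?_
  simp only [Derivation.map_one_eq_zero, map_add, map_mul, algHom_C, algebraMap_eq, smul_eq_C_mul]
  ring

theorem familyOne_X_le_preimage (hN : 2 ≤ N) (a b ω : ℝ) :
    familyOne k 0 1 n (X 0) ≤ preimage 1 a b ω (space1 N k n) := by
  refine stateSpace_le_preimage ?_
  rintro _ ⟨f, hf, rfl⟩ v -
  have hX : formalHamOne N a b ω f + (4 * ω + constE 1 N a b ω : ℂ) • f - (8 : ℂ) • pderiv 0 f ∈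
      restrictSupport ℂ (admissible ![1, 2] {d | d 1 ≤ 0} 1 n) :=
    sub_mem (add_mem (formalHamOne_mem_restrictSupport hf a b ω) (Submodule.smul_mem _ _ hf)) <|
      Submodule.smul_mem _ _ <| pderiv_mem_restrictSupport_admissible hf (by simp) (by simp)
  have hsub : admissible ![1, 2] {d : Fin 2 →₀ ℕ | d 1 ≤ 0} 1 n ⊆
      admissible ![1, 2] {d | d 1 ≤ 1} 0 n :=
    fun _ hd => ⟨le_trans (b := 0) hd.1 zero_le_one, le_of_add_le_left hd.2⟩
  have hOne : (8 * a + 2 * (2 * b + 1) : ℂ) • f ∈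
      restrictSupport ℂ (admissible ![1, 2] {d | d 1 ≤ 1} 0 n) :=
    Submodule.smul_mem _ _ <| restrictSupport_mono ℂ hsub hf
  have hmem := space1_eq.ge <| sub_mem
    (Submodule.mem_sup_right (symState_mem_familyOne hX v (X 0)))
    (Submodule.mem_sup_left (symState_mem_familyOne hOne v 1))
  rw [← map_sub] at hmem
  refine ⟨_, hmem, fun π => ?_⟩
  have hd : pderiv 1 f = 0 :=
    pderiv_eq_zero_iff_mem_restrictSupport.2 <|
      restrictSupport_mono ℂ (fun _ hd => Nat.le_zero.1 hd.1) hf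
  rw [rename_X, AlgHom.toLinearMap_apply,
    gaugeHam_one_aeval_mul hN (by rw [hd, map_zero]) (gaugeHam_one_X hN ..), hd]
  refine congrArg toRat ?_
  simp only [Pi.sub_apply, map_sub, map_add, map_smul, map_one, map_zero, rename_X]
  simp only [C_add, C_neg, C_1, Fin.coe_ofNat_eq_mod, Nat.cast_one, map_ofNat C, carreDuChamp_X,
    pderiv_sigma, smul_eq_C_mul]
  ring

theorem space1_le_preimage (hN : 2 ≤ N) (a b ω : ℝ) :
    space1 N k n ≤ preimage 1 a b ω (space1 N k n) :=
  space1_eq.trans_le <|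
    sup_le (familyOne_one_le_preimage hN a b ω) (familyOne_X_le_preimage hN a b ω)

end ReflectionSpaces

/-! ### Invariance for `ε = 2` -/

section TrigonometricSpaces

variable {N k n : ℕ}

theorem carreDuChamp_two_sigma_one_cofactor (j : Fin N) :
    carreDuChamp 2 (sigma N 1) (cofactor j) = sigma N 1 * cofactor j - tau N N := by
  refine mul_left_cancel₀ (X_ne_zero (R := ℂ) j) ?_
  have h := congrArg (carreDuChamp 2 (sigma N 1)) (X_mul_cofactor j)
  rw [Derivation.leibniz, carreDuChamp_X, carreDuChamp_comm _ _ (tau N N),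
    carreDuChamp_two_tau_self, opJzero_of_isHomogeneous (isHomogeneous_sigma 1), pderiv_sigma] at h
  simp only [smul_eq_mul, Fin.val_two, Nat.cast_one, map_one, one_mul, Nat.sub_self, pow_zero,
    mul_one] at h
  linear_combination h - (sigma N 1 + X j) * X_mul_cofactor j

/-- The symmetric functions `σ_1, τ_{N-1}, τ_N` generating the coefficients for `ε = 2`. -/
def genTwo (N : ℕ) : Fin 3 → Poly N := ![sigma N 1, tau N (N - 1), tau N N]

theorem isHomogeneous_genTwo (i : Fin 3) :
    (genTwo N i).IsHomogeneous ((![1, N - 1, N] : Fin 3 → ℕ) i) := by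
  fin_cases i
  exacts [isHomogeneous_sigma 1, isHomogeneous_tau (N - 1), isHomogeneous_tau N]

theorem isSymmetric_genTwo (i : Fin 3) : (genTwo N i).IsSymmetric := by
  fin_cases i
  exacts [isSymmetric_sigma 1, isSymmetric_tau (N - 1), isSymmetric_tau N]

/-- The operator on functions of `σ_1, τ_{N-1}, τ_N`, of degree at most one in `σ_1` and in
`τ_{N-1}`, induced by the gauge Hamiltonian for `ε = 2` without its constant term. -/
def formalHamTwo (N : ℕ) (a : ℝ) (f : MvPolynomial (Fin 3) ℂ) : MvPolynomial (Fin 3) ℂ :=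
  (4 * (1 + 2 * a) : ℂ) • (X 0 * pderiv 0 f)
    + (8 * a * N + 4 * (1 - 2 * a) * (N - 1 : ℕ) : ℂ) • (X 1 * pderiv 1 f)
    + (4 * N : ℂ) • (X 2 * pderiv 2 f)
    + (8 : ℂ) • (X 0 * (X 1 * pderiv 0 (pderiv 1 f)))
    - (8 * N : ℂ) • (X 2 * pderiv 0 (pderiv 1 f))
    + (8 : ℂ) • (X 0 * (X 2 * pderiv 0 (pderiv 2 f)))
    + (8 * (N - 1 : ℕ) : ℂ) • (X 1 * (X 2 * pderiv 1 (pderiv 2 f)))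
    + (4 * N : ℂ) • (X 2 * (X 2 * pderiv 2 (pderiv 2 f)))

theorem formalHamTwo_mem_restrictSupport [NeZero N] {l m c : ℕ} {f : MvPolynomial (Fin 3) ℂ}
    (hf : f ∈ restrictSupport ℂ (admissible ![1, N - 1, N] {d | d 0 ≤ l ∧ d 1 ≤ m} c n)) (a : ℝ) :
    formalHamTwo N a f ∈
      restrictSupport ℂ (admissible ![1, N - 1, N] {d | d 0 ≤ l ∧ d 1 ≤ m} c n) := by
  refine add_mem (add_mem (add_mem (sub_mem (add_mem (add_mem (add_mem
    (Submodule.smul_mem _ _ (X_mul_pderiv_mem_restrictSupport hf ?_))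
    (Submodule.smul_mem _ _ (X_mul_pderiv_mem_restrictSupport hf ?_)))
    (Submodule.smul_mem _ _ (X_mul_pderiv_mem_restrictSupport hf ?_)))
    (Submodule.smul_mem _ _ (X_mul_X_mul_pderiv_pderiv_mem_restrictSupport hf ?_)))
    (Submodule.smul_mem _ _ (X_mul_pderiv_pderiv_mem_restrictSupport hf ?_)))
    (Submodule.smul_mem _ _ (X_mul_X_mul_pderiv_pderiv_mem_restrictSupport hf ?_)))
    (Submodule.smul_mem _ _ (X_mul_X_mul_pderiv_pderiv_mem_restrictSupport hf ?_)))
    (Submodule.smul_mem _ _ (X_mul_X_mul_pderiv_pderiv_mem_restrictSupport hf ?_))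
  all_goals
    obtain ⟨M, rfl⟩ := Nat.exists_eq_add_one_of_ne_zero (NeZero.ne N)
    rintro d ⟨hd, hw⟩
    simp only [Set.mem_ofPred_eq, Finsupp.coe_add, Pi.add_apply, Finsupp.single_eq_same, ne_eq,
      not_false_eq_true, Finsupp.single_eq_of_ne, Fin.reduceEq, Matrix.cons_val, weight_fin_three,
      admissible, add_mul] at hd hw ⊢
    omega

theorem gaugeHam_two_aeval_mul [NeZero N] (hN : 2 ≤ N) {a b ω : ℝ} {φ g : Poly N}
    {f : MvPolynomial (Fin 3) ℂ} (hf₀ : pderiv 0 (pderiv 0 f) = 0)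
    (hf₁ : pderiv 1 (pderiv 1 f) = 0) (hg : gaugeHam 2 a b ω φ = toRat g) :
    gaugeHam 2 a b ω (aeval (genTwo N) f * φ) = toRat (
      aeval (genTwo N) (formalHamTwo N a f) * φ + aeval (genTwo N) f * g
      + 8 * (aeval (genTwo N) (pderiv 0 f) * carreDuChamp 2 (sigma N 1) φ
        + aeval (genTwo N) (pderiv 1 f) * (tau N (N - 1) * opJzero φ - tau N N * opJminus φ)
        + aeval (genTwo N) (pderiv 2 f) * (tau N N * opJzero φ))) := by
  rw [gaugeHam_aeval_mul isSymmetric_genTwo (L := formalHamTwo N a f)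
    (G := ![C (4 * (1 + 2 * a) : ℂ) * sigma N 1,
      C (8 * a * N + 4 * (1 - 2 * a) * (N - 1 : ℕ) : ℂ) * tau N (N - 1),
      C (4 * N : ℂ) * tau N N]) ?_ ?_ hg]
  · refine congrArg toRat ?_
    have h8 : C (2 * constC 2 : ℂ) = (8 : Poly N) := by
      rw [← map_ofNat C]
      norm_num [constC]
    simp only [h8, Fin.sum_univ_three, genTwo, Matrix.cons_val, carreDuChamp_two_tau_self,
      carreDuChamp_two_tau_pred]
  · intro i
    fin_cases i
    exacts [gaugeHam_two_sigma_one hN a b ω, gaugeHam_two_tau_pred hN a b ω,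
      gaugeHam_two_tau_self hN a b ω]
  · have h10 := pderiv_pderiv_comm 1 0 f
    have h20 := pderiv_pderiv_comm 2 0 f
    have h21 := pderiv_pderiv_comm 2 1 f
    have hσ (p) := carreDuChamp_comm 2 (sigma N 1) (tau N p)
    have hτ := carreDuChamp_comm 2 (tau N (N - 1)) (tau N N)
    simp only [Fin.sum_univ_three, h10, h20, h21, hf₀, hf₁, genTwo, Matrix.cons_val, hσ, hτ,
      carreDuChamp_two_tau_self, carreDuChamp_two_tau_pred,
      opJzero_of_isHomogeneous (isHomogeneous_sigma _),
      opJzero_of_isHomogeneous (isHomogeneous_tau _), opJminus_sigma,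
      formalHamTwo, map_sub, map_add, map_smul, map_mul, aeval_X]
    simp only [map_natCast, Complex.ofReal_ofNat, map_zero, tsub_self, C_mul, C_add, C_sub,
      map_ofNat C, constC, sigma_zero, smul_eq_C_mul]
    ring

/-- The family of states `F Λ(φ |v⟩)` for `ε = 2`, where `F` has degree at most `l` in `σ_1`, at
most `m` in `τ_{N-1}`, and degree at most `n - c` in `z`. -/
def familyTwo (k l m c n : ℕ) (φ : Poly N) : Submodule ℂ (State N k) :=
  stateSpace (coeffSpace (genTwo N) ![1, N - 1, N] {d | d 0 ≤ l ∧ d 1 ≤ m} c n) φ Set.univ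

theorem span_eq_familyTwo_one_one {c : ℕ} (φ : Poly N) :
    Submodule.span ℂ {Φ : State N k | ∃ f v, pderiv 0 (pderiv 0 f) = 0 ∧
      pderiv 1 (pderiv 1 f) = 0 ∧
      (substPoly ![sigma N 1, tau N (N - 1), tau N N] f).totalDegree + c ≤ n ∧
      Φ = fun s =>
        substPoly ![sigma N 1, tau N (N - 1), tau N N] f * symmetrize (prodState φ v) s} =
    familyTwo k 1 1 c n φ := by
  have hA (f : MvPolynomial (Fin 3) ℂ) : f ∈ restrictSupport ℂ {d | d 0 ≤ 1 ∧ d 1 ≤ 1} ↔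
      pderiv 0 (pderiv 0 f) = 0 ∧ pderiv 1 (pderiv 1 f) = 0 :=
    Set.subset_inter_iff.trans <| and_congr
      pderiv_pderiv_eq_zero_iff_mem_restrictSupport.symm
      pderiv_pderiv_eq_zero_iff_mem_restrictSupport.symm
  rw [familyTwo, ← span_setOf_eq_stateSpace fun F hF =>
    mem_coeffSpace_iff_of_ne_zero isHomogeneous_genTwo hF]
  simp only [hA, and_assoc, Set.mem_univ, true_and, genTwo]

theorem span_eq_familyTwo_zero_one {c : ℕ} (φ : Poly N) :
    Submodule.span ℂ {Φ : State N k | ∃ g v, pderiv 0 (pderiv 0 g) = 0 ∧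
      (substPoly ![tau N (N - 1), tau N N] g).totalDegree + c ≤ n ∧
      Φ = fun s => substPoly ![tau N (N - 1), tau N N] g * symmetrize (prodState φ v) s} =
    familyTwo k 0 1 c n φ := by
  have he : Function.Injective (![1, 2] : Fin 2 → Fin 3) := by decide
  have hs : {d : Fin 3 →₀ ℕ | d 0 ≤ 0 ∧ d 1 ≤ 1} =
      {d | (∀ i ∉ Set.range (![1, 2] : Fin 2 → Fin 3), d i = 0) ∧
        d.comapDomain _ he.injOn ∈ {d | d 0 ≤ 1}} := by
    ext d
    simp [Fin.forall_fin_succ]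
  have hq : ∀ i, ![tau N (N - 1), tau N N] i = genTwo N (![1, 2] i) :=
    Fin.forall_fin_two.2 ⟨rfl, rfl⟩
  rw [familyTwo, ← span_setOf_eq_stateSpace fun F hF =>
    (mem_coeffSpace_iff_of_ne_zero isHomogeneous_genTwo hF).trans
      (and_congr_left' (exists_aeval_eq_iff_of_injective he hq hs F))]
  simp only [pderiv_pderiv_eq_zero_iff_mem_restrictSupport, Set.mem_univ, true_and]

theorem span_eq_familyTwo_one_zero {c : ℕ} (φ : Poly N) :
    Submodule.span ℂ {Φ : State N k | ∃ q v, pderiv 0 (pderiv 0 q) = 0 ∧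
      (substPoly ![sigma N 1, tau N N] q).totalDegree + c ≤ n ∧
      Φ = fun s => substPoly ![sigma N 1, tau N N] q * symmetrize (prodState φ v) s} =
    familyTwo k 1 0 c n φ := by
  have he : Function.Injective (![0, 2] : Fin 2 → Fin 3) := by decide
  have hs : {d : Fin 3 →₀ ℕ | d 0 ≤ 1 ∧ d 1 ≤ 0} =
      {d | (∀ i ∉ Set.range (![0, 2] : Fin 2 → Fin 3), d i = 0) ∧
        d.comapDomain _ he.injOn ∈ {d | d 0 ≤ 1}} := by
    ext d
    simp [Fin.forall_fin_succ, and_comm]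
  have hq : ∀ i, ![sigma N 1, tau N N] i = genTwo N (![0, 2] i) :=
    Fin.forall_fin_two.2 ⟨rfl, rfl⟩
  rw [familyTwo, ← span_setOf_eq_stateSpace fun F hF =>
    (mem_coeffSpace_iff_of_ne_zero isHomogeneous_genTwo hF).trans
      (and_congr_left' (exists_aeval_eq_iff_of_injective he hq hs F))]
  simp only [pderiv_pderiv_eq_zero_iff_mem_restrictSupport, Set.mem_univ, true_and]

theorem symState_mem_familyTwo {l m c : ℕ} {f : MvPolynomial (Fin 3) ℂ}
    (hf : f ∈ restrictSupport ℂ (admissible ![1, N - 1, N] {d | d 0 ≤ l ∧ d 1 ≤ m} c n))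
    (v : Spin N k) (φ : Poly N) :
    symState v (fun π => aeval (genTwo N) f * rename π φ) ∈ familyTwo k l m c n φ :=
  symState_mem_stateSpace (aeval_mem_coeffSpace hf) (Set.mem_univ v) φ

theorem pderiv_pderiv_eq_zero_of_mem_two {l m c : ℕ} (hl : l ≤ 1) (hm : m ≤ 1)
    {f : MvPolynomial (Fin 3) ℂ}
    (hf : f ∈ restrictSupport ℂ (admissible ![1, N - 1, N] {d | d 0 ≤ l ∧ d 1 ≤ m} c n)) :
    pderiv 0 (pderiv 0 f) = 0 ∧ pderiv 1 (pderiv 1 f) = 0 :=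
  ⟨pderiv_pderiv_eq_zero_iff_mem_restrictSupport.2 <|
      restrictSupport_mono ℂ (fun _ hd => le_trans hd.1.1 hl) hf,
    pderiv_pderiv_eq_zero_iff_mem_restrictSupport.2 <|
      restrictSupport_mono ℂ (fun _ hd => le_trans hd.1.2 hm) hf⟩

variable [NeZero N]

theorem space2_eq : space2 N k n =
    familyTwo k 1 1 0 n 1 ⊔ familyTwo k 0 1 1 n (X 0) ⊔ familyTwo k 1 0 N (n + 1) (cofactor 0) := by
  simp only [← span_eq_familyTwo_one_one, ← span_eq_familyTwo_zero_one,
    ← span_eq_familyTwo_one_zero, ← Submodule.span_union, space2, add_zero]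
  rfl

theorem familyTwo_one_le_space2 : familyTwo k 1 1 0 n 1 ≤ space2 N k n :=
  space2_eq.ge.trans' (le_sup_left.trans le_sup_left)

theorem familyTwo_X_le_space2 : familyTwo k 0 1 1 n (X 0) ≤ space2 N k n :=
  space2_eq.ge.trans' (le_sup_right.trans le_sup_left)

theorem familyTwo_cofactor_le_space2 : familyTwo k 1 0 N (n + 1) (cofactor 0) ≤ space2 N k n :=
  space2_eq.ge.trans' le_sup_right

theorem familyTwo_one_le_preimage (hN : 2 ≤ N) (a b ω : ℝ) :
    familyTwo k 1 1 0 n 1 ≤ preimage 2 a b ω (space2 N k n) := by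
  refine stateSpace_le_preimage ?_
  rintro _ ⟨f, hf, rfl⟩ v -
  have hL := add_mem (formalHamTwo_mem_restrictSupport (N := N) hf a)
    (Submodule.smul_mem _ (constE 2 N a b ω : ℂ) hf)
  refine ⟨_, familyTwo_one_le_space2 (symState_mem_familyTwo hL v 1), fun π => ?_⟩
  obtain ⟨hd₀, hd₁⟩ := pderiv_pderiv_eq_zero_of_mem_two le_rfl le_rfl hf
  rw [map_one, AlgHom.toLinearMap_apply, gaugeHam_two_aeval_mul hN hd₀ hd₁ (gaugeHam_one hN ..)]
  refine congrArg toRat ?_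
  simp only [Derivation.map_one_eq_zero, mul_zero, Finset.sum_const_zero, map_add, map_mul,
    algHom_C, algebraMap_eq, opJzero, opJminus, smul_eq_C_mul]
  ring

theorem familyTwo_X_le_preimage (hN : 2 ≤ N) (a b ω : ℝ) :
    familyTwo k 0 1 1 n (X 0) ≤ preimage 2 a b ω (space2 N k n) := by
  refine stateSpace_le_preimage ?_
  rintro _ ⟨f, hf, rfl⟩ v -
  have hX : formalHamTwo N a f + (4 * (1 + 2 * a) + constE 2 N a b ω : ℂ) • f +
      (8 : ℂ) • (X 1 * pderiv 1 f + X 2 * pderiv 2 f) ∈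
      restrictSupport ℂ (admissible ![1, N - 1, N] {d | d 0 ≤ 0 ∧ d 1 ≤ 1} 1 n) :=
    add_mem (add_mem (formalHamTwo_mem_restrictSupport hf a) (Submodule.smul_mem _ _ hf)) <|
      Submodule.smul_mem _ _ <| add_mem (X_mul_pderiv_mem_restrictSupport hf fun _ => id)
        (X_mul_pderiv_mem_restrictSupport hf fun _ => id)
  have hOne : (8 : ℂ) • (X 2 * pderiv 1 f) ∈
      restrictSupport ℂ (admissible ![1, N - 1, N] {d | d 0 ≤ 1 ∧ d 1 ≤ 1} 0 n) :=
    Submodule.smul_mem _ _ <| X_mul_pderiv_mem_restrictSupport_admissible hf (by simp +contextual)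
      (by simp; omega)
  have hmem := sub_mem (familyTwo_X_le_space2 (symState_mem_familyTwo hX v (X 0)))
    (familyTwo_one_le_space2 (symState_mem_familyTwo hOne v 1))
  rw [← map_sub] at hmem
  refine ⟨_, hmem, fun π => ?_⟩
  have hd : pderiv 0 f = 0 :=
    pderiv_eq_zero_iff_mem_restrictSupport.2 <|
      restrictSupport_mono ℂ (fun _ hd => Nat.le_zero.1 hd.1.1) hf
  obtain ⟨hd₀, hd₁⟩ := pderiv_pderiv_eq_zero_of_mem_two zero_le_one le_rfl hf
  rw [rename_X, AlgHom.toLinearMap_apply,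
    gaugeHam_two_aeval_mul hN hd₀ hd₁ (gaugeHam_two_X hN ..), hd,
    opJzero_of_isHomogeneous (isHomogeneous_X ℂ _), opJminus_X]
  refine congrArg toRat ?_
  simp only [Pi.sub_apply, map_add, map_smul, map_mul, map_one, map_zero, rename_X]
  simp only [aeval_eq_bind₁, Nat.cast_one, C_1, C_add, C_mul, bind₁_X_right, Matrix.cons_val,
    genTwo, map_ofNat C, smul_eq_C_mul]
  ring

theorem familyTwo_cofactor_le_preimage (hN : 2 ≤ N) (a b ω : ℝ) :
    familyTwo k 1 0 N (n + 1) (cofactor 0) ≤ preimage 2 a b ω (space2 N k n) := by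
  refine stateSpace_le_preimage ?_
  rintro _ ⟨f, hf, rfl⟩ v -
  have hC : formalHamTwo N a f +
      (8 * a * N + 4 * (1 - 2 * a) * (N - 1 : ℕ) + constE 2 N a b ω : ℂ) • f +
      ((8 : ℂ) • (X 0 * pderiv 0 f) + (8 * (N - 1 : ℕ) : ℂ) • (X 2 * pderiv 2 f)) ∈
      restrictSupport ℂ (admissible ![1, N - 1, N] {d | d 0 ≤ 1 ∧ d 1 ≤ 0} N (n + 1)) :=
    add_mem (add_mem (formalHamTwo_mem_restrictSupport hf a) (Submodule.smul_mem _ _ hf)) <|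
      add_mem (Submodule.smul_mem _ _ <| X_mul_pderiv_mem_restrictSupport hf fun _ => id)
        (Submodule.smul_mem _ _ <| X_mul_pderiv_mem_restrictSupport hf fun _ => id)
  have hOne : (8 : ℂ) • (X 2 * pderiv 0 f) ∈
      restrictSupport ℂ (admissible ![1, N - 1, N] {d | d 0 ≤ 1 ∧ d 1 ≤ 1} 0 n) :=
    Submodule.smul_mem _ _ <| X_mul_pderiv_mem_restrictSupport_admissible hf (by simp +contextual)
      (by simp; omega)
  have hmem := sub_mem (familyTwo_cofactor_le_space2 (symState_mem_familyTwo hC v (cofactor 0)))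
    (familyTwo_one_le_space2 (symState_mem_familyTwo hOne v 1))
  rw [← map_sub] at hmem
  refine ⟨_, hmem, fun π => ?_⟩
  have hd : pderiv 1 f = 0 :=
    pderiv_eq_zero_iff_mem_restrictSupport.2 <|
      restrictSupport_mono ℂ (fun _ hd => Nat.le_zero.1 hd.1.2) hf
  obtain ⟨hd₀, hd₁⟩ := pderiv_pderiv_eq_zero_of_mem_two le_rfl zero_le_one hf
  rw [rename_cofactor, AlgHom.toLinearMap_apply,
    gaugeHam_two_aeval_mul hN hd₀ hd₁ (gaugeHam_two_cofactor hN ..), hd,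
    opJzero_of_isHomogeneous (isHomogeneous_cofactor _), carreDuChamp_two_sigma_one_cofactor]
  refine congrArg toRat ?_
  simp only [Pi.sub_apply, map_add, map_smul, map_mul, map_one, map_zero, rename_cofactor]
  simp only [aeval_eq_bind₁, C_mul, C_add, bind₁_X_right, Matrix.cons_val, genTwo, map_ofNat C,
    smul_eq_C_mul]
  ring

theorem space2_le_preimage (hN : 2 ≤ N) (a b ω : ℝ) :
    space2 N k n ≤ preimage 2 a b ω (space2 N k n) :=
  space2_eq.trans_le <| sup_le (sup_le (familyTwo_one_le_preimage hN a b ω)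
    (familyTwo_X_le_preimage hN a b ω)) (familyTwo_cofactor_le_preimage hN a b ω)

theorem invSpace_le_preimage (hN : 2 ≤ N) (ε : Fin 3) (a b ω : ℝ) :
    invSpace N k n ε ≤ preimage ε a b ω (invSpace N k n ε) := by
  fin_cases ε
  exacts [space0_le_preimage hN a b ω, space1_le_preimage hN a b ω, space2_le_preimage hN a b ω]

end TrigonometricSpaces

/-! ### Evaluation of the gauge Hamiltonian -/

section Symmetry

variable {N k n : ℕ}

/-- The totally symmetric states. -/
def symmetricStates (N k : ℕ) : Submodule ℂ (State N k) where
  carrier := {Φ | ∀ π, totalPerm π Φ = Φ}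
  zero_mem' π := funext fun _ => map_zero (rename π)
  add_mem' h h' π := funext fun s =>
    (map_add (rename π) _ _).trans (congrArg₂ _ (congrFun (h π) s) (congrFun (h' π) s))
  smul_mem' c _ h π := funext fun s =>
    (map_smul (rename π) c _).trans (congrArg _ (congrFun (h π) s))

theorem rename_swap_of_mem_symmetricStates {Φ : State N k} (hΦ : Φ ∈ symmetricStates N k)
    (i j : Fin N) (s : Config N k) :
    rename (Equiv.swap i j) (Φ s) = Φ (fun l => s (Equiv.swap i j l)) := by
  have h := congrFun (hΦ (Equiv.swap i j)) (fun l => s (Equiv.swap i j l))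
  simpa only [totalPerm, Equiv.swap_apply_self] using h

theorem stateSpace_le_symmetricStates {B : Submodule ℂ (Poly N)} (hB : ∀ F ∈ B, F.IsSymmetric)
    (φ : Poly N) (V : Set (Spin N k)) : stateSpace B φ V ≤ symmetricStates N k := by
  refine Submodule.span_le.2 ?_
  rintro _ ⟨F, hF, v, -, rfl⟩ π
  funext s
  have h := congrFun (totalPerm_symmetrize π (prodState φ v)) s
  simp only [totalPerm] at h ⊢
  rw [map_mul, h, hB F hF π]

theorem isSymmetric_of_mem_coeffSpace {κ : Type*} {p : κ → Poly N} {w : κ → ℕ}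
    {s : Set (κ →₀ ℕ)} {c : ℕ} (hp : ∀ i, (p i).IsSymmetric) :
    ∀ F ∈ coeffSpace p w s c n, F.IsSymmetric := by
  rintro _ ⟨f, -, rfl⟩
  exact isSymmetric_aeval hp f

theorem invSpace_le_symmetricStates [NeZero N] (ε : Fin 3) :
    invSpace N k n ε ≤ symmetricStates N k := by
  have h0 {m c n V} (φ : Poly N) : familyZero (k := k) m c n φ V ≤ symmetricStates N k :=
    stateSpace_le_symmetricStates (isSymmetric_of_mem_coeffSpace isSymmetric_genZero) φ V
  have h1 {m c n} (φ : Poly N) : familyOne k m c n φ ≤ symmetricStates N k :=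
    stateSpace_le_symmetricStates (isSymmetric_of_mem_coeffSpace isSymmetric_genOne) φ _
  have h2 {l m c n} (φ : Poly N) : familyTwo k l m c n φ ≤ symmetricStates N k :=
    stateSpace_le_symmetricStates (isSymmetric_of_mem_coeffSpace isSymmetric_genTwo) φ _
  fin_cases ε
  exacts [space0_eq.trans_le (sup_le (sup_le (sup_le (h0 _) (h0 _)) (h0 _)) (h0 _)),
    space1_eq.trans_le (sup_le (h1 _) (h1 _)),
    space2_eq.trans_le (sup_le (sup_le (h2 _) (h2 _)) (h2 _))]

end Symmetry

section Evaluation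

variable {N : ℕ}

/-- The rational function `r` is regular at `z`, with value `c`. -/
def HasValueAt (z : Fin N → ℂ) (r : RatFun N) (c : ℂ) : Prop :=
  ∃ p q : Poly N, eval z q ≠ 0 ∧ r = toRat p / toRat q ∧ c = eval z p / eval z q

/-- The function `ϑ_ε` of complex arguments. -/
def thetaVal (ε : Fin 3) (x y : ℂ) : ℂ :=
  match ε with
  | 0 => 1
  | 1 => (x + y) / 2
  | 2 => x * y

theorem toRat_ne_zero_of_eval_ne_zero {z : Fin N → ℂ} {q : Poly N} (hq : eval z q ≠ 0) :
    toRat q ≠ 0 := fun h => hq <| by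
  rw [toRat_injective (h.trans (map_zero (algebraMap (Poly N) (RatFun N))).symm), map_zero]

theorem hasValueAt_toRat (z : Fin N → ℂ) (p : Poly N) : HasValueAt z (toRat p) (eval z p) :=
  ⟨p, 1, by simp, by simp [toRat], by simp⟩

namespace HasValueAt

variable {z : Fin N → ℂ} {r r' : RatFun N} {c c' : ℂ}

theorem eq_eval {g : Poly N} (h : HasValueAt z (toRat g) c) : c = eval z g := by
  obtain ⟨p, q, hq, hr, rfl⟩ := h
  rw [eq_div_iff (toRat_ne_zero_of_eval_ne_zero hq)] at hr
  have hgp : g * q = p := toRat_injective ((map_mul _ g q).trans hr)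
  rw [← hgp, map_mul, mul_div_cancel_right₀ _ hq]

theorem add (h : HasValueAt z r c) (h' : HasValueAt z r' c') : HasValueAt z (r + r') (c + c') := by
  obtain ⟨p, q, hq, rfl, rfl⟩ := h
  obtain ⟨p', q', hq', rfl, rfl⟩ := h'
  refine ⟨p * q' + q * p', q * q', by simp [hq, hq'], ?_, ?_⟩
  · rw [div_add_div _ _ (toRat_ne_zero_of_eval_ne_zero hq) (toRat_ne_zero_of_eval_ne_zero hq')]
    simp only [toRat, map_add, map_mul]
  · rw [div_add_div _ _ hq hq']
    simp only [map_add, map_mul]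

theorem mul (h : HasValueAt z r c) (h' : HasValueAt z r' c') : HasValueAt z (r * r') (c * c') := by
  obtain ⟨p, q, hq, rfl, rfl⟩ := h
  obtain ⟨p', q', hq', rfl, rfl⟩ := h'
  refine ⟨p * p', q * q', by simp [hq, hq'], ?_, ?_⟩ <;>
    simp only [div_mul_div_comm, toRat, map_mul]

theorem inv (h : HasValueAt z r c) (hc : c ≠ 0) : HasValueAt z r⁻¹ c⁻¹ := by
  obtain ⟨p, q, -, rfl, rfl⟩ := h
  exact ⟨q, p, (div_ne_zero_iff.1 hc).1, inv_div _ _, inv_div _ _⟩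

theorem div (h : HasValueAt z r c) (h' : HasValueAt z r' c') (hc' : c' ≠ 0) :
    HasValueAt z (r / r') (c / c') := by
  simpa only [div_eq_mul_inv] using h.mul (h'.inv hc')

theorem sub (h : HasValueAt z r c) (h' : HasValueAt z r' c') : HasValueAt z (r - r') (c - c') := by
  simpa [sub_eq_add_neg, toRat] using h.add ((hasValueAt_toRat z (-1)).mul h')

theorem pow_two (h : HasValueAt z r c) : HasValueAt z (r ^ 2) (c ^ 2) := by
  simpa only [_root_.pow_two] using h.mul h

theorem sum {ι : Type*} (s : Finset ι) {r : ι → RatFun N} {c : ι → ℂ}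
    (h : ∀ i, HasValueAt z (r i) (c i)) : HasValueAt z (∑ i ∈ s, r i) (∑ i ∈ s, c i) := by
  classical
  induction s using Finset.induction_on with
  | empty => simpa [toRat] using hasValueAt_toRat z 0
  | insert i s hi ih =>
    rw [Finset.sum_insert hi, Finset.sum_insert hi]
    exact (h i).add ih

theorem two : HasValueAt z 2 2 := by
  simpa [toRat, one_add_one_eq_two] using (hasValueAt_toRat z 1).add (hasValueAt_toRat z 1)

theorem theta (ε : Fin 3) (h : HasValueAt z r c) (h' : HasValueAt z r' c') :
    HasValueAt z (QES.theta ε r r') (thetaVal ε c c') := by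
  fin_cases ε
  exacts [by simpa [QES.theta, thetaVal, toRat] using hasValueAt_toRat z 1,
    (h.add h').div two two_ne_zero, h.mul h']

end HasValueAt

variable [NeZero N]

theorem hasValueAt_gaugeHam (ε : Fin 3) (a b ω : ℝ) (f : Poly N) {z : Fin N → ℂ}
    (hz : ∀ i, z i ≠ z (i + 1)) :
    HasValueAt z (gaugeHam ε a b ω f)
      (constC ε * (∑ i, z i ^ (ε : ℕ) * eval z (pderiv i (pderiv i f))
        + 2 * a * ∑ i, (z i ^ (ε : ℕ) * eval z (pderiv i f)
            - z (i + 1) ^ (ε : ℕ) * eval z (pderiv (i + 1) f)) / (z i - z (i + 1))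
        - 2 * a * ∑ i, thetaVal ε (z i) (z (i + 1)) / (z i - z (i + 1)) ^ 2
            * (eval z f - eval z (rename (Equiv.swap i (i + 1)) f)))
      + constMinus ε b * ∑ i, eval z (pderiv i f)
      + constZero ε a ω * ∑ i, z i * eval z (pderiv i f)
      + constE ε N a b ω * eval z f) := by
  have hz' (i) : z i - z (i + 1) ≠ 0 := sub_ne_zero.2 (hz i)
  have hX (i) : HasValueAt z (toRat (X i)) (z i) := by
    simpa only [eval_X] using hasValueAt_toRat z (X i)
  have hpair := HasValueAt.sum Finset.univ fun i =>
    (hasValueAt_toRat z (X i ^ (ε : ℕ) * pderiv i f - X (i + 1) ^ (ε : ℕ) * pderiv (i + 1) f)).div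
      ((hX i).sub (hX (i + 1))) (hz' i)
  have hexch := HasValueAt.sum Finset.univ fun i =>
    (((hX i).theta ε (hX (i + 1))).div ((hX i).sub (hX (i + 1))).pow_two
      (pow_ne_zero 2 (hz' i))).mul (hasValueAt_toRat z (f - rename (Equiv.swap i (i + 1)) f))
  have hC (c : ℂ) : HasValueAt z (toRat (C c)) c := by
    simpa only [eval_C] using hasValueAt_toRat z (C c)
  have hT := ((hasValueAt_toRat z (∑ i, X i ^ (ε : ℕ) * pderiv i (pderiv i f))).add
    ((hC (2 * a)).mul hpair)).sub ((hC (2 * a)).mul hexch)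
  have hH := ((((hC (constC ε)).mul hT).add
    (hasValueAt_toRat z (C (constMinus ε b : ℂ) * opJminus f))).add
    (hasValueAt_toRat z (C (constZero ε a ω : ℂ) * opJzero f))).add
    (hasValueAt_toRat z (C (constE ε N a b ω : ℂ) * f))
  simpa only [gaugeHam, opT, opJminus, opJzero, map_sum, map_mul, map_sub, map_pow, eval_X,
    eval_C] using hH

end Evaluation

section CoordinateLine

variable {N : ℕ}

theorem iteratedDeriv_two_mul_ofReal {m l : ℝ → ℝ} {q q₁ : ℝ → ℂ} {x l' : ℝ} {q₂ : ℂ}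
    (hm : ∀ᶠ t in 𝓝 x, HasDerivAt m (m t * l t) t) (hl : HasDerivAt l l' x)
    (hq : ∀ᶠ t in 𝓝 x, HasDerivAt q (q₁ t) t) (hq₁ : HasDerivAt q₁ q₂ x) :
    iteratedDeriv 2 (fun t => (m t : ℂ) * q t) x =
      m x * (((l x ^ 2 + l' : ℝ) : ℂ) * q x + 2 * (l x : ℂ) * q₁ x + q₂) := by
  have hderiv : deriv (fun t => (m t : ℂ) * q t) =ᶠ[𝓝 x]
      fun t => ((m t : ℂ) * (l t : ℂ)) * q t + (m t : ℂ) * q₁ t := by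
    filter_upwards [hm, hq] with t ht ht'
    simpa only [Complex.ofReal_mul] using (ht.ofReal_comp.fun_mul ht').deriv
  have hmx := hm.self_of_nhds.ofReal_comp
  rw [iteratedDeriv_succ, iteratedDeriv_one, hderiv.deriv_eq,
    (((hmx.fun_mul hl.ofReal_comp).fun_mul hq.self_of_nhds).fun_add (hmx.fun_mul hq₁)).deriv]
  push_cast
  ring

theorem hasDerivAt_eval_update (P : Poly N) (z : Fin N → ℂ) (i : Fin N) (w : ℂ) :
    HasDerivAt (fun w => eval (Function.update z i w) P)
      (eval (Function.update z i w) (pderiv i P)) w := by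
  induction P using MvPolynomial.induction_on with
  | C c => simpa using hasDerivAt_const w c
  | add p q hp hq => simpa only [map_add] using hp.fun_add hq
  | mul_X p j hp =>
    have hX : HasDerivAt (fun w => Function.update z i w j)
        (eval (Function.update z i w) (pderiv i (X j : Poly N))) w := by
      rcases eq_or_ne j i with rfl | h
      · simpa using hasDerivAt_id' w
      · simpa [pderiv_X_of_ne h, Function.update_of_ne h] using hasDerivAt_const w (z j)
    simp only [map_mul, eval_X, Derivation.leibniz, smul_eq_mul, map_add]
    refine (hp.fun_mul hX).congr_deriv ?_
    ring

end CoordinateLine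

/-! ### Cyclic gauge factors -/

section CyclicProducts

variable {N : ℕ} {a : ℝ}

theorem hasDerivAt_prod_of_logDeriv {ι : Type*} (s : Finset ι) {f : ι → ℝ → ℝ} {l : ι → ℝ} {x : ℝ}
    (h : ∀ i, HasDerivAt (f i) (f i x * l i) x) :
    HasDerivAt (fun t => ∏ i ∈ s, f i t) ((∏ i ∈ s, f i x) * ∑ i ∈ s, l i) x := by
  classical
  induction s using Finset.induction_on with
  | empty => simpa using hasDerivAt_const x (1 : ℝ)
  | insert i s hi ih =>
    simp only [Finset.prod_insert hi, Finset.sum_insert hi]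
    refine ((h i).fun_mul ih).congr_deriv ?_
    ring

theorem sum_neighbors [NeZero N] {M : Type*} [AddCommMonoid M] (g : Fin N → Fin N → M) :
    ∑ i, (g i (i + 1) + g i (i - 1)) = ∑ i, (g i (i + 1) + g (i + 1) i) := by
  have h := sum_add_one fun i => g i (i - 1)
  simp only [add_sub_cancel_right] at h
  rw [Finset.sum_add_distrib, Finset.sum_add_distrib, h]

theorem sub_one_ne [NeZero N] (hN : 2 ≤ N) (i : Fin N) : i - 1 ≠ i := by
  simpa only [sub_add_cancel] using fin_ne_add_one hN (i - 1)

/-- The one- and two-particle factors `α`, `β` of a gauge factor `∏ α(x_i) β(x_i, x_{i+1})`, with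
logarithmic derivatives `A` and `a B` in the first argument. The relation `dom` describes the
allowed positions of two neighbouring particles. -/
structure GaugeFactors (a : ℝ) where
  dom : ℝ → ℝ → Prop
  α : ℝ → ℝ
  A : ℝ → ℝ
  A' : ℝ → ℝ
  β : ℝ → ℝ → ℝ
  B : ℝ → ℝ → ℝ
  B' : ℝ → ℝ → ℝ
  dom_symm : ∀ {u v}, dom u v → dom v u
  dom_open : ∀ {u v}, dom u v → ∀ᶠ t in 𝓝 u, dom t v
  hasDerivAt_α : ∀ {u v}, dom u v → HasDerivAt α (α u * A u) u
  hasDerivAt_A : ∀ {u v}, dom u v → HasDerivAt A (A' u) u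
  β_symm : ∀ u v, β u v = β v u
  hasDerivAt_β : ∀ {u v}, dom u v → HasDerivAt (fun t => β t v) (β u v * (a * B u v)) u
  hasDerivAt_B : ∀ {u v}, dom u v → HasDerivAt (fun t => B t v) (B' u v) u
  α_ne_zero : ∀ {u v}, dom u v → α u ≠ 0
  β_ne_zero : ∀ {u v}, dom u v → β u v ≠ 0
  contDiffAt_α : ∀ {u v}, dom u v → ContDiffAt ℝ (⊤ : ℕ∞) α u
  contDiffAt_β : ∀ {u v}, dom u v → ContDiffAt ℝ (⊤ : ℕ∞) (fun y : ℝ × ℝ => β y.1 y.2) (u, v)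

namespace GaugeFactors

variable [NeZero N] {G : GaugeFactors a} {x : Fin N → ℝ}

/-- The configurations all of whose pairs of cyclic neighbours are in allowed positions. -/
def Admissible (G : GaugeFactors a) (x : Fin N → ℝ) : Prop :=
  ∀ i, G.dom (x i) (x (i + 1))

/-- The gauge factor with the given one- and two-particle factors. -/
def prod (G : GaugeFactors a) (x : Fin N → ℝ) : ℝ :=
  ∏ i, G.α (x i) * G.β (x i) (x (i + 1))

/-- The logarithmic derivative of the gauge factor in the coordinate `i`. -/
def logDeriv (G : GaugeFactors a) (x : Fin N → ℝ) (i : Fin N) : ℝ :=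
  G.A (x i) + a * (G.B (x i) (x (i + 1)) + G.B (x i) (x (i - 1)))

/-- The derivative of `logDeriv` in the coordinate `i`. -/
def logDeriv' (G : GaugeFactors a) (x : Fin N → ℝ) (i : Fin N) : ℝ :=
  G.A' (x i) + a * (G.B' (x i) (x (i + 1)) + G.B' (x i) (x (i - 1)))

theorem Admissible.dom_sub_one (hx : G.Admissible x) (i : Fin N) : G.dom (x i) (x (i - 1)) := by
  simpa only [sub_add_cancel] using G.dom_symm (hx (i - 1))

theorem Admissible.eventually_update (hN : 2 ≤ N) (hx : G.Admissible x) (i : Fin N) :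
    ∀ᶠ t in 𝓝 (x i), G.Admissible (Function.update x i t) := by
  refine Filter.eventually_all.2 fun j => ?_
  rcases eq_or_ne j i with rfl | hj
  · simpa [Function.update_of_ne (fin_ne_add_one hN j).symm] using G.dom_open (hx j)
  rcases eq_or_ne (j + 1) i with rfl | hj'
  · simp only [Function.update_self, Function.update_of_ne hj]
    filter_upwards [G.dom_open (G.dom_symm (hx j))] with t ht using G.dom_symm ht
  · simpa [Function.update_of_ne hj, Function.update_of_ne hj'] using hx j

theorem Admissible.hasDerivAt_prod (hN : 2 ≤ N) (hx : G.Admissible x) (i : Fin N) :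
    HasDerivAt (fun t => G.prod (Function.update x i t)) (G.prod x * G.logDeriv x i) (x i) := by
  have hfactor (j : Fin N) : HasDerivAt
      (fun t => G.α (Function.update x i t j) *
        G.β (Function.update x i t j) (Function.update x i t (j + 1)))
      (G.α (Function.update x i (x i) j) *
        G.β (Function.update x i (x i) j) (Function.update x i (x i) (j + 1)) *
        ((if j = i then G.A (x i) + a * G.B (x i) (x (i + 1)) else 0)
          + if j = i - 1 then a * G.B (x i) (x (i - 1)) else 0)) (x i) := by
    simp only [Function.update_eq_self]
    rcases eq_or_ne j i with rfl | hj
    · simp only [Function.update_self, Function.update_of_ne (fin_ne_add_one hN j).symm, if_true,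
        if_neg (sub_one_ne hN j).symm]
      refine ((G.hasDerivAt_α (hx j)).fun_mul (G.hasDerivAt_β (hx j))).congr_deriv ?_
      ring
    rcases eq_or_ne (j + 1) i with rfl | hj'
    · simp only [Function.update_self, Function.update_of_ne hj, if_neg hj, add_sub_cancel_right,
        if_true, G.β_symm (x j)]
      refine ((G.hasDerivAt_β (G.dom_symm (hx j))).const_mul (G.α (x j))).congr_deriv ?_
      ring
    · simp only [Function.update_of_ne hj, Function.update_of_ne hj', if_neg hj,
        if_neg fun h => hj' (eq_sub_iff_add_eq.1 h), add_zero, mul_zero]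
      exact hasDerivAt_const _ _
  refine (hasDerivAt_prod_of_logDeriv Finset.univ hfactor).congr_deriv ?_
  simp only [Function.update_eq_self, Finset.sum_add_distrib, Finset.sum_ite_eq', Finset.mem_univ,
    if_true, prod, logDeriv]
  ring

theorem Admissible.eventually_hasDerivAt_prod (hN : 2 ≤ N) (hx : G.Admissible x) (i : Fin N) :
    ∀ᶠ t in 𝓝 (x i), HasDerivAt (fun t => G.prod (Function.update x i t))
      (G.prod (Function.update x i t) * G.logDeriv (Function.update x i t) i) t := by
  filter_upwards [hx.eventually_update hN i] with t ht
  simpa only [Function.update_idem, Function.update_self] using ht.hasDerivAt_prod hN i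

theorem Admissible.hasDerivAt_logDeriv (hN : 2 ≤ N) (hx : G.Admissible x) (i : Fin N) :
    HasDerivAt (fun t => G.logDeriv (Function.update x i t) i) (G.logDeriv' x i) (x i) := by
  simp only [logDeriv, Function.update_self, Function.update_of_ne (fin_ne_add_one hN i).symm,
    Function.update_of_ne (sub_one_ne hN i)]
  exact (G.hasDerivAt_A (hx i)).fun_add (((G.hasDerivAt_B (hx i)).fun_add
    (G.hasDerivAt_B (hx.dom_sub_one i))).const_mul a)

theorem Admissible.contDiffAt_prod (hx : G.Admissible x) : ContDiffAt ℝ (⊤ : ℕ∞) G.prod x := by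
  have hc (i : Fin N) : ContDiffAt ℝ (⊤ : ℕ∞) (fun y : Fin N → ℝ => y i) x :=
    (contDiff_apply ℝ ℝ i).contDiffAt
  exact _root_.contDiffAt_prod fun i _ => ((G.contDiffAt_α (hx i)).comp x (hc i)).mul
    (ContDiffAt.comp (g := fun y : ℝ × ℝ => G.β y.1 y.2)
      x (G.contDiffAt_β (hx i)) ((hc i).prodMk (hc (i + 1))))

theorem Admissible.prod_ne_zero (hx : G.Admissible x) : G.prod x ≠ 0 :=
  Finset.prod_ne_zero_iff.2 fun i _ => mul_ne_zero (G.α_ne_zero (hx i)) (G.β_ne_zero (hx i))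

end GaugeFactors
end CyclicProducts

/-! ### The gauge transformation -/

section LocalModel

variable {N k : ℕ} {ε : Fin 3} {η : ℤˣ} {a b ω : ℝ}

/-- Gauge factors for `H_ε`, with the identities that relate them to the potential and to the
coefficients of the gauge Hamiltonian: `V₁` is the one-particle potential, `κ` the coefficient of
the exchange operators, `ζ₁` and `ζ₂` are the derivatives of the change of variable, `c₁` and `c₂`
are the contributions of a particle and of a pair to `-E_0`, and `e` is the contribution of a
pair to `c_0`. -/
structure LocalModel (ε : Fin 3) (η : ℤˣ) (a b ω : ℝ) extends GaugeFactors a where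
  V₁ : ℝ → ℝ
  κ : ℝ → ℝ → ℝ
  ζ₁ : ℝ → ℂ
  ζ₂ : ℝ → ℂ
  c₁ : ℝ
  c₂ : ℝ
  e : ℝ
  hasDerivAt_ζ : ∀ t, HasDerivAt (changeVar ε η) (ζ₁ t) t
  hasDerivAt_ζ₁ : ∀ t, HasDerivAt ζ₁ (ζ₂ t) t
  contDiff_ζ : ContDiff ℝ (⊤ : ℕ∞) (changeVar ε η)
  changeVar_ne : ∀ {u v}, dom u v → changeVar ε η u ≠ changeVar ε η v
  one_body : ∀ {u v}, dom u v → A u ^ 2 + A' u = V₁ u + c₁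
  two_body : ∀ {u v}, dom u v → 2 * a * (A u * B u v + A v * B v u)
    + a ^ 2 * (B u v ^ 2 + B v u ^ 2) + a * (B' u v + B' v u) = (a - 1) * κ u v + c₂
  constE_eq : ∀ N : ℕ, constE ε N a b ω = -(N * (c₁ + c₂))
  one_body_deriv : ∀ {u v}, dom u v → ∀ p q : ℂ,
    -(2 * (A u : ℂ) * (ζ₁ u * p) + (ζ₂ u * p + ζ₁ u ^ 2 * q)) =
      constC ε * (changeVar ε η u ^ (ε : ℕ) * q) + constMinus ε b * p
        + (constZero ε a ω - 2 * e) * (changeVar ε η u * p)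
  two_body_deriv : ∀ {u v}, dom u v → ∀ p q : ℂ,
    -(2 * a * ((B u v : ℂ) * (ζ₁ u * p) + (B v u : ℂ) * (ζ₁ v * q))) =
      constC ε * (2 * a) * ((changeVar ε η u ^ (ε : ℕ) * p - changeVar ε η v ^ (ε : ℕ) * q)
        / (changeVar ε η u - changeVar ε η v)) + e * (changeVar ε η u * p + changeVar ε η v * q)
  exchange : ∀ {u v}, dom u v → constC ε * (2 * a) *
    (thetaVal ε (changeVar ε η u) (changeVar ε η v)
      / (changeVar ε η u - changeVar ε η v) ^ 2) = -(κ u v : ℂ)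
  gaugeFactor_eq : ∀ {N : ℕ} [NeZero N] (x : Fin N → ℝ),
    gaugeFactor ε a b ω x = toGaugeFactors.prod x
  potential_eq : ∀ {N k : ℕ} [NeZero N] (x : Fin N → ℝ) (v : Spin N k) (s : Config N k),
    potential ε a b ω x v s =
      ((∑ i, V₁ (x i) + 2 * a ^ 2 * ∑ i, B (x i) (x (i + 1)) * B (x i) (x (i - 1)) : ℝ) : ℂ)
        * v s + ∑ i, (κ (x i) (x (i + 1)) : ℂ) * (a * v s - spinExchange i (i + 1) v s)
  admissible : ∀ {N : ℕ} [NeZero N], 2 ≤ N → ∀ {x : Fin N → ℝ}, x ∈ configSpace N ε →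
    toGaugeFactors.Admissible x
  dom_of_mem_Ioo : ∀ {u v}, u ∈ Set.Ioo 0 1 → v ∈ Set.Ioo 0 1 → u ≠ v → dom u v

/-- The point `(ζ(x_1), …, ζ(x_N))`. -/
abbrev changeVars (ε : Fin 3) (η : ℤˣ) (x : Fin N → ℝ) : Fin N → ℂ :=
  fun i => changeVar ε η (x i)

namespace LocalModel

variable [NeZero N]

theorem secondPartial_physical (m : LocalModel ε η a b ω) (hN : 2 ≤ N) {x : Fin N → ℝ}
    (hx : m.Admissible x) (Φ : State N k) (i : Fin N) (s : Config N k) :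
    secondPartial i (physical ε η a b ω Φ) x s = gaugeFactor ε a b ω x *
      (((m.logDeriv x i ^ 2 + m.logDeriv' x i : ℝ) : ℂ) * eval (changeVars ε η x) (Φ s)
        + (2 * (m.logDeriv x i : ℂ) * (m.ζ₁ (x i) * eval (changeVars ε η x) (pderiv i (Φ s)))
        + (m.ζ₂ (x i) * eval (changeVars ε η x) (pderiv i (Φ s))
          + m.ζ₁ (x i) ^ 2 * eval (changeVars ε η x) (pderiv i (pderiv i (Φ s)))))) := by
  set z := changeVars ε η x
  have hupdate (t : ℝ) : changeVars ε η (Function.update x i t) =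
      Function.update z i (changeVar ε η t) := Function.comp_update (changeVar ε η) x i t
  have hself : Function.update z i (changeVar ε η (x i)) = z := Function.update_eq_self i z
  have hchain (P : Poly N) (t : ℝ) : HasDerivAt
      (fun t => eval (Function.update z i (changeVar ε η t)) P)
      (m.ζ₁ t * eval (Function.update z i (changeVar ε η t)) (pderiv i P)) t :=
    (hasDerivAt_eval_update P z i (changeVar ε η t)).scomp t (m.hasDerivAt_ζ t)
  have hfun : (fun t => physical ε η a b ω Φ (Function.update x i t) s) = fun t =>
      (m.prod (Function.update x i t) : ℂ) * eval (Function.update z i (changeVar ε η t)) (Φ s) :=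
    funext fun t => by rw [← hupdate, ← m.gaugeFactor_eq, physical]
  rw [secondPartial, hfun, iteratedDeriv_two_mul_ofReal (hx.eventually_hasDerivAt_prod hN i)
    (hx.hasDerivAt_logDeriv hN i) (Filter.Eventually.of_forall (hchain (Φ s)))
    ((m.hasDerivAt_ζ₁ (x i)).fun_mul (hchain (pderiv i (Φ s)) (x i))), hself,
    Function.update_eq_self, m.gaugeFactor_eq]
  ring

theorem sum_logDeriv_sq_add (m : LocalModel ε η a b ω) {x : Fin N → ℝ} (hx : m.Admissible x) :
    ∑ i, (m.logDeriv x i ^ 2 + m.logDeriv' x i) = ∑ i, m.V₁ (x i)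
      + 2 * a ^ 2 * ∑ i, m.B (x i) (x (i + 1)) * m.B (x i) (x (i - 1))
      + (a - 1) * ∑ i, m.κ (x i) (x (i + 1)) - constE ε N a b ω := by
  set g : Fin N → Fin N → ℝ := fun i j => 2 * a * (m.A (x i) * m.B (x i) (x j))
    + a ^ 2 * m.B (x i) (x j) ^ 2 + a * m.B' (x i) (x j)
  have hsplit (i : Fin N) : m.logDeriv x i ^ 2 + m.logDeriv' x i =
      (m.V₁ (x i) + m.c₁) + 2 * a ^ 2 * (m.B (x i) (x (i + 1)) * m.B (x i) (x (i - 1)))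
      + (g i (i + 1) + g i (i - 1)) := by
    rw [← m.one_body (hx i), GaugeFactors.logDeriv, GaugeFactors.logDeriv']
    ring
  have hpair (i : Fin N) : g i (i + 1) + g (i + 1) i = (a - 1) * m.κ (x i) (x (i + 1)) + m.c₂ := by
    rw [← m.two_body (hx i)]
    ring
  calc ∑ i, (m.logDeriv x i ^ 2 + m.logDeriv' x i)
      = ∑ i, (m.V₁ (x i) + m.c₁)
        + ∑ i, 2 * a ^ 2 * (m.B (x i) (x (i + 1)) * m.B (x i) (x (i - 1)))
        + ∑ i, ((a - 1) * m.κ (x i) (x (i + 1)) + m.c₂) := by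
        simp only [hsplit, Finset.sum_add_distrib (g := fun i => g i (i + 1) + g i (i - 1)),
          sum_neighbors g, hpair]
        rw [Finset.sum_add_distrib]
    _ = _ := by
        simp only [Finset.sum_add_distrib, ← Finset.mul_sum, Finset.sum_const, Finset.card_univ,
          Fintype.card_fin, nsmul_eq_mul, m.constE_eq]
        ring

theorem neg_sum_logDeriv_mul (m : LocalModel ε η a b ω) {x : Fin N → ℝ} (hx : m.Admissible x)
    (p q : Fin N → ℂ) :
    -∑ i, (2 * (m.logDeriv x i : ℂ) * (m.ζ₁ (x i) * p i)
        + (m.ζ₂ (x i) * p i + m.ζ₁ (x i) ^ 2 * q i)) =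
      constC ε * (∑ i, changeVar ε η (x i) ^ (ε : ℕ) * q i
        + 2 * a * ∑ i, (changeVar ε η (x i) ^ (ε : ℕ) * p i
          - changeVar ε η (x (i + 1)) ^ (ε : ℕ) * p (i + 1))
            / (changeVar ε η (x i) - changeVar ε η (x (i + 1))))
      + constMinus ε b * ∑ i, p i + constZero ε a ω * ∑ i, changeVar ε η (x i) * p i := by
  set g : Fin N → Fin N → ℂ := fun i j => -(2 * a * ((m.B (x i) (x j) : ℂ) * (m.ζ₁ (x i) * p i)))
  have hsplit (i : Fin N) : -(2 * (m.logDeriv x i : ℂ) * (m.ζ₁ (x i) * p i)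
        + (m.ζ₂ (x i) * p i + m.ζ₁ (x i) ^ 2 * q i)) =
      (constC ε * (changeVar ε η (x i) ^ (ε : ℕ) * q i) + constMinus ε b * p i
        + (constZero ε a ω - 2 * m.e) * (changeVar ε η (x i) * p i))
      + (g i (i + 1) + g i (i - 1)) := by
    rw [← m.one_body_deriv (hx i), GaugeFactors.logDeriv]
    push_cast
    ring
  have hpair (i : Fin N) : g i (i + 1) + g (i + 1) i =
      constC ε * (2 * a) * ((changeVar ε η (x i) ^ (ε : ℕ) * p i
          - changeVar ε η (x (i + 1)) ^ (ε : ℕ) * p (i + 1))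
            / (changeVar ε η (x i) - changeVar ε η (x (i + 1))))
        + m.e * (changeVar ε η (x i) * p i + changeVar ε η (x (i + 1)) * p (i + 1)) := by
    rw [← m.two_body_deriv (hx i)]
    ring
  rw [← Finset.sum_neg_distrib, Finset.sum_congr rfl fun i _ => hsplit i, Finset.sum_add_distrib,
    sum_neighbors g, Finset.sum_congr rfl fun i _ => hpair i]
  simp only [Finset.sum_add_distrib, ← Finset.mul_sum]
  rw [sum_add_one fun i => changeVar ε η (x i) * p i]
  ring

theorem potential_physical (m : LocalModel ε η a b ω) {Φ : State N k}
    (hΦ : Φ ∈ symmetricStates N k) (x : Fin N → ℝ) (s : Config N k) :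
    potential ε a b ω x (physical ε η a b ω Φ x) s = gaugeFactor ε a b ω x *
      (((∑ i, m.V₁ (x i) + 2 * a ^ 2 * ∑ i, m.B (x i) (x (i + 1)) * m.B (x i) (x (i - 1))
          + (a - 1) * ∑ i, m.κ (x i) (x (i + 1)) : ℝ) : ℂ) * eval (changeVars ε η x) (Φ s)
        + ∑ i, (m.κ (x i) (x (i + 1)) : ℂ) * (eval (changeVars ε η x) (Φ s)
          - eval (changeVars ε η x) (rename (Equiv.swap i (i + 1)) (Φ s)))) := by
  have hterm (i : Fin N) : (m.κ (x i) (x (i + 1)) : ℂ) * (a * physical ε η a b ω Φ x s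
        - spinExchange i (i + 1) (physical ε η a b ω Φ x) s) = gaugeFactor ε a b ω x *
      ((a - 1) * m.κ (x i) (x (i + 1)) * eval (changeVars ε η x) (Φ s)
        + m.κ (x i) (x (i + 1)) * (eval (changeVars ε η x) (Φ s)
          - eval (changeVars ε η x) (rename (Equiv.swap i (i + 1)) (Φ s)))) := by
    rw [rename_swap_of_mem_symmetricStates hΦ]
    simp only [physical, spinExchange, spinPerm]
    ring
  rw [m.potential_eq, Finset.sum_congr rfl fun i _ => hterm i, ← Finset.mul_sum,
    Finset.sum_add_distrib, ← Finset.sum_mul, ← Finset.mul_sum]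
  simp only [physical, Complex.ofReal_add, Complex.ofReal_mul, Complex.ofReal_sub,
    Complex.ofReal_one, Complex.ofReal_sum]
  ring

theorem sum_exchange (m : LocalModel ε η a b ω) {x : Fin N → ℝ} (hx : m.Admissible x)
    (d : Fin N → ℂ) :
    constC ε * (2 * a) * ∑ i, thetaVal ε (changeVar ε η (x i)) (changeVar ε η (x (i + 1)))
        / (changeVar ε η (x i) - changeVar ε η (x (i + 1))) ^ 2 * d i =
      -∑ i, (m.κ (x i) (x (i + 1)) : ℂ) * d i := by
  rw [Finset.mul_sum, ← Finset.sum_neg_distrib]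
  exact Finset.sum_congr rfl fun i _ => by rw [← mul_assoc, m.exchange (hx i), neg_mul]

theorem ham_physical (m : LocalModel ε η a b ω) (hN : 2 ≤ N) {Φ Ψ : State N k}
    (hΦ : Φ ∈ symmetricStates N k) (h : GaugeMaps ε a b ω Φ Ψ) {x : Fin N → ℝ}
    (hx : x ∈ configSpace N ε) :
    ham ε a b ω (physical ε η a b ω Φ) x = physical ε η a b ω Ψ x := by
  have hadm := m.admissible hN hx
  funext s
  set z := changeVars ε η x
  have hgauge := hasValueAt_gaugeHam ε a b ω (Φ s) (z := z) fun i => m.changeVar_ne (hadm i)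
  rw [h s] at hgauge
  have hdrift := m.neg_sum_logDeriv_mul hadm (fun i => eval z (pderiv i (Φ s)))
    fun i => eval z (pderiv i (pderiv i (Φ s)))
  have hexchange := m.sum_exchange hadm fun i =>
    eval z (Φ s) - eval z (rename (Equiv.swap i (i + 1)) (Φ s))
  rw [ham, Pi.add_apply, Pi.neg_apply, Finset.sum_apply, m.potential_physical hΦ,
    Finset.sum_congr rfl fun i _ => m.secondPartial_physical hN hadm Φ i s, ← Finset.mul_sum,
    Finset.sum_add_distrib, ← Finset.sum_mul, ← Complex.ofReal_sum, m.sum_logDeriv_sq_add hadm,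
    physical, ← hgauge.eq_eval]
  push_cast
  linear_combination (gaugeFactor ε a b ω x : ℂ) * (hdrift + hexchange)

end LocalModel
end LocalModel

/-! ### The three models -/

section LocalModels

variable {N : ℕ}

theorem hasDerivAt_abs_rpow {f : ℝ → ℝ} {f' t : ℝ} (a : ℝ) (hf : HasDerivAt f f' t)
    (h : f t ≠ 0) : HasDerivAt (fun t => |f t| ^ a) (|f t| ^ a * (a * (f' / f t))) t := by
  have hexp {y : ℝ} (hy : y ≠ 0) : |y| ^ a = Real.exp (a * Real.log y) := by
    rw [Real.rpow_def_of_pos (abs_pos.2 hy), Real.log_abs, mul_comm]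
  have hev : (fun t => |f t| ^ a) =ᶠ[𝓝 t] fun t => Real.exp (a * Real.log (f t)) := by
    filter_upwards [hf.continuousAt.eventually_ne h] with t ht using hexp ht
  rw [hexp h]
  exact ((hf.log h).const_mul a).exp.congr_of_eventuallyEq hev

theorem contDiffAt_abs_rpow {E : Type*} [NormedAddCommGroup E] [NormedSpace ℝ E] {f : E → ℝ}
    {x : E} {n : ℕ∞} (a : ℝ) (hf : ContDiffAt ℝ n f x) (h : f x ≠ 0) :
    ContDiffAt ℝ n (fun y => |f y| ^ a) x :=
  ((contDiffAt_abs h).comp x hf).rpow_const_of_ne (abs_ne_zero.2 h)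

theorem hasDerivAt_sq (t : ℝ) : HasDerivAt (fun t : ℝ => t ^ 2) (2 * t) t := by
  simpa using hasDerivAt_pow 2 t

theorem hasDerivAt_gaussian (ω t : ℝ) :
    HasDerivAt (fun t : ℝ => Real.exp (-(ω / 2) * t ^ 2))
      (Real.exp (-(ω / 2) * t ^ 2) * (-ω * t)) t := by
  refine ((hasDerivAt_sq t).const_mul (-(ω / 2))).exp.congr_deriv ?_
  ring

theorem hasDerivAt_one_div_sub {u v : ℝ} (h : u ≠ v) :
    HasDerivAt (fun t => 1 / (t - v)) (-1 / (u - v) ^ 2) u := by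
  simpa only [one_div] using ((hasDerivAt_id' u).sub_const v).fun_inv (sub_ne_zero.2 h)

theorem ne_add_one_of_strictMono [NeZero N] (hN : 2 ≤ N) {x : Fin N → ℝ} (hx : StrictMono x)
    (i : Fin N) : x i ≠ x (i + 1) := hx.injective.ne (fin_ne_add_one hN i)

/-- The local model for `ε = 0`. -/
def rationalModel (η : ℤˣ) (a b ω : ℝ) : LocalModel 0 η a b ω where
  dom u v := u ≠ v
  α u := Real.exp (-(ω / 2) * u ^ 2)
  A u := -ω * u
  A' _ := -ω
  V₁ u := ω ^ 2 * u ^ 2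
  β u v := |u - v| ^ a
  B u v := 1 / (u - v)
  B' u v := -1 / (u - v) ^ 2
  κ u v := 2 * a / (u - v) ^ 2
  ζ₁ _ := 1
  ζ₂ _ := 0
  c₁ := -ω
  c₂ := -2 * a * ω
  e := 0
  dom_symm := Ne.symm
  dom_open h := eventually_ne_nhds h
  hasDerivAt_α _ := hasDerivAt_gaussian ω _
  hasDerivAt_A {u _} _ := by simpa using (hasDerivAt_id' u).const_mul (-ω)
  β_symm u v := by rw [abs_sub_comm]
  hasDerivAt_β {u v} h := hasDerivAt_abs_rpow a ((hasDerivAt_id' u).sub_const v) (sub_ne_zero.2 h)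
  hasDerivAt_B h := hasDerivAt_one_div_sub h
  α_ne_zero _ := (Real.exp_pos _).ne'
  β_ne_zero h := (Real.rpow_pos_of_pos (abs_pos.2 (sub_ne_zero.2 h)) a).ne'
  contDiffAt_α _ := by fun_prop
  contDiffAt_β h := contDiffAt_abs_rpow a (contDiffAt_fst.sub contDiffAt_snd) (sub_ne_zero.2 h)
  hasDerivAt_ζ _ := Complex.ofRealCLM.hasDerivAt
  hasDerivAt_ζ₁ t := hasDerivAt_const t 1
  contDiff_ζ := Complex.ofRealCLM.contDiff
  changeVar_ne h := by simpa [changeVar] using h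
  one_body _ := by ring
  two_body {u v} h := by
    have huv : u - v ≠ 0 := sub_ne_zero.2 h
    rw [← neg_sub u v]
    field_simp
    ring
  constE_eq N := by simp only [constE]; ring
  one_body_deriv _ p q := by
    simp only [constC, constMinus, constZero, changeVar, Fin.coe_ofNat_eq_mod]
    push_cast
    ring
  two_body_deriv {u v} h p q := by
    have huv : (u : ℂ) - v ≠ 0 := sub_ne_zero.2 (Complex.ofReal_injective.ne h)
    simp only [constC, changeVar, Fin.val_zero, pow_zero, one_mul]
    push_cast
    rw [← neg_sub (u : ℂ) v]
    field_simp
    ring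
  exchange _ := by
    simp only [constC, changeVar, thetaVal]
    push_cast
    ring
  gaugeFactor_eq x := by
    rw [gaugeFactor, GaugeFactors.prod, Finset.prod_mul_distrib, ← Real.exp_sum, Finset.mul_sum]
  potential_eq x v s := by
    simp only [potential, Pi.add_apply, Pi.smul_apply, Finset.sum_apply, Pi.sub_apply, smul_eq_mul,
      Finset.mul_sum]
    congr! 5 with i
    rw [one_div_mul_one_div, mul_one_div, mul_comm (x i - x (i - 1))]
  admissible hN _ hx i := ne_add_one_of_strictMono hN hx i
  dom_of_mem_Ioo _ _ h := h

theorem sq_sub_sq_ne_zero_of_pos {u v : ℝ} (hu : 0 < u) (hv : 0 < v) (h : u ≠ v) :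
    u ^ 2 - v ^ 2 ≠ 0 := by
  rw [sq_sub_sq]
  exact mul_ne_zero (add_pos hu hv).ne' (sub_ne_zero.2 h)

/-- The local model for `ε = 1`. -/
def reflectionModel (η : ℤˣ) (a b ω : ℝ) : LocalModel 1 η a b ω where
  dom u v := 0 < u ∧ 0 < v ∧ u ^ 2 - v ^ 2 ≠ 0
  α u := Real.exp (-(ω / 2) * u ^ 2) * u ^ b
  A u := -ω * u + b / u
  A' u := -ω - b / u ^ 2
  V₁ u := ω ^ 2 * u ^ 2 + b * (b - 1) / u ^ 2
  β u v := |u ^ 2 - v ^ 2| ^ a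
  B u v := 2 * u / (u ^ 2 - v ^ 2)
  B' u v := 2 / (u ^ 2 - v ^ 2) - 4 * u ^ 2 / (u ^ 2 - v ^ 2) ^ 2
  κ u v := 4 * a * ((u ^ 2 + v ^ 2) / (u ^ 2 - v ^ 2) ^ 2)
  ζ₁ u := 2 * u
  ζ₂ _ := 2
  c₁ := -2 * ω * b - ω
  c₂ := -4 * a * ω
  e := 0
  dom_symm h := ⟨h.2.1, h.1, by rw [← neg_sub]; exact neg_ne_zero.2 h.2.2⟩
  dom_open {u v} h := by
    have hcont : ContinuousAt (fun t : ℝ => t ^ 2 - v ^ 2) u := by fun_prop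
    filter_upwards [lt_mem_nhds h.1, hcont.eventually_ne h.2.2] with t ht hne
      using ⟨ht, h.2.1, hne⟩
  hasDerivAt_α {u _} h := by
    refine ((hasDerivAt_gaussian ω u).fun_mul
      (Real.hasDerivAt_rpow_const (Or.inl h.1.ne'))).congr_deriv ?_
    rw [Real.rpow_sub_one h.1.ne']
    ring
  hasDerivAt_A {u _} h := by
    refine (((hasDerivAt_id' u).const_mul (-ω)).fun_add
      ((hasDerivAt_const u b).fun_div (hasDerivAt_id' u) h.1.ne')).congr_deriv ?_
    ring
  β_symm u v := by rw [abs_sub_comm]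
  hasDerivAt_β {u v} h := hasDerivAt_abs_rpow a ((hasDerivAt_sq u).sub_const (v ^ 2)) h.2.2
  hasDerivAt_B {u v} h := by
    have hne := h.2.2
    refine (((hasDerivAt_id' u).const_mul 2).fun_div
      ((hasDerivAt_sq u).sub_const (v ^ 2)) hne).congr_deriv ?_
    field_simp
    ring
  α_ne_zero h := mul_ne_zero (Real.exp_pos _).ne' (Real.rpow_pos_of_pos h.1 b).ne'
  β_ne_zero h := (Real.rpow_pos_of_pos (abs_pos.2 h.2.2) a).ne'
  contDiffAt_α h := ContDiffAt.mul (by fun_prop) (contDiffAt_id.rpow_const_of_ne h.1.ne')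
  contDiffAt_β h := contDiffAt_abs_rpow a ((contDiffAt_fst.pow 2).sub (contDiffAt_snd.pow 2)) h.2.2
  hasDerivAt_ζ _ := (Complex.ofRealCLM.hasDerivAt.fun_pow 2).congr_deriv (by simp)
  hasDerivAt_ζ₁ t := by simpa using (Complex.ofRealCLM.hasDerivAt (x := t)).const_mul 2
  contDiff_ζ := Complex.ofRealCLM.contDiff.pow 2
  changeVar_ne {u v} h := by
    have hne : (u : ℂ) ^ 2 - (v : ℂ) ^ 2 ≠ 0 := mod_cast h.2.2
    exact sub_ne_zero.1 hne
  one_body h := by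
    have hu := h.1.ne'
    field_simp
    ring
  two_body {u v} h := by
    have hne := h.2.2
    have hu := h.1.ne'
    have hv := h.2.1.ne'
    rw [← neg_sub (u ^ 2) (v ^ 2)]
    field_simp
    ring
  constE_eq N := by simp only [constE]; ring
  one_body_deriv {u _} h p q := by
    have hu : (u : ℂ) ≠ 0 := Complex.ofReal_ne_zero.2 h.1.ne'
    simp only [constC, constMinus, constZero, changeVar, Fin.val_one]
    push_cast
    field_simp
    ring
  two_body_deriv {u v} h p q := by
    have hne : (u : ℂ) ^ 2 - (v : ℂ) ^ 2 ≠ 0 := mod_cast h.2.2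
    simp only [constC, changeVar, Fin.val_one]
    push_cast
    rw [← neg_sub ((u : ℂ) ^ 2) ((v : ℂ) ^ 2)]
    field_simp
    ring
  exchange _ := by
    simp only [constC, changeVar, thetaVal]
    push_cast
    ring
  gaugeFactor_eq x := by
    rw [gaugeFactor, GaugeFactors.prod, Finset.mul_sum, Real.exp_sum, ← Finset.prod_mul_distrib]
    exact Finset.prod_congr rfl fun i _ => by ring
  potential_eq x v s := by
    simp only [potential, Pi.add_apply, Pi.smul_apply, Finset.sum_apply, Pi.sub_apply, smul_eq_mul,
      Finset.mul_sum, Finset.sum_add_distrib]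
    congr! 5 with i
    rw [div_mul_div_comm, ← mul_div_assoc, mul_comm (x i ^ 2 - x (i - 1) ^ 2)]
    ring
  admissible hN x hx i := by
    have hpos (i) : 0 < x i := hx.2.trans_le (hx.1.monotone (Fin.zero_le i))
    exact ⟨hpos _, hpos _,
      sq_sub_sq_ne_zero_of_pos (hpos _) (hpos _) (ne_add_one_of_strictMono hN hx.1 i)⟩
  dom_of_mem_Ioo hu hv h := ⟨hu.1, hv.1, sq_sub_sq_ne_zero_of_pos hu.1 hv.1 h⟩

end LocalModels

section TrigonometricModel

theorem sin_ne_zero_of_sin_abs_pos {d : ℝ} (h : 0 < Real.sin |d|) : Real.sin d ≠ 0 := by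
  rcases abs_choice d with hd | hd <;> rw [hd] at h
  · exact h.ne'
  · exact (neg_pos.1 (Real.sin_neg d ▸ h)).ne

theorem sin_abs_eq_abs_sin {d : ℝ} (h : 0 < Real.sin |d|) : Real.sin |d| = |Real.sin d| := by
  rcases abs_choice d with hd | hd <;> rw [hd] at h ⊢
  · exact (abs_of_pos h).symm
  · rw [← abs_neg, ← Real.sin_neg, abs_of_pos h]

theorem eventually_sin_abs_pos {u v : ℝ} (h : 0 < Real.sin |u - v|) :
    ∀ᶠ t in 𝓝 u, 0 < Real.sin |t - v| :=
  continuousAt_const.eventually_lt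
    (by fun_prop : ContinuousAt (fun t => Real.sin |t - v|) u) h

theorem hasDerivAt_cot {d : ℝ} (h : Real.sin d ≠ 0) :
    HasDerivAt Real.cot (-1 / Real.sin d ^ 2) d := by
  rw [_root_.funext Real.cot_eq_cos_div_sin]
  refine ((Real.hasDerivAt_cos d).fun_div (Real.hasDerivAt_sin d) h).congr_deriv ?_
  congr 1
  linear_combination -Real.sin_sq_add_cos_sq d

theorem cot_sub_comm (u v : ℝ) : Real.cot (v - u) = -Real.cot (u - v) := by
  rw [← neg_sub u v, Real.cot_eq_cos_div_sin, Real.cot_eq_cos_div_sin, Real.cos_neg, Real.sin_neg,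
    div_neg]

theorem hasDerivAt_sin_abs_rpow {u v : ℝ} (a : ℝ) (h : 0 < Real.sin |u - v|) :
    HasDerivAt (fun t => Real.sin |t - v| ^ a)
      (Real.sin |u - v| ^ a * (a * Real.cot (u - v))) u := by
  have hev : (fun t => Real.sin |t - v| ^ a) =ᶠ[𝓝 u] fun t => |Real.sin (t - v)| ^ a := by
    filter_upwards [eventually_sin_abs_pos h] with t ht
    rw [sin_abs_eq_abs_sin ht]
  have hsin := hasDerivAt_abs_rpow a ((hasDerivAt_id' u).sub_const v).sin
    (sin_ne_zero_of_sin_abs_pos h)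
  refine (hsin.congr_of_eventuallyEq hev).congr_deriv ?_
  rw [sin_abs_eq_abs_sin h, Real.cot_eq_cos_div_sin, mul_one]

theorem contDiffAt_sin_abs_rpow {u v : ℝ} (a : ℝ) (h : 0 < Real.sin |u - v|) :
    ContDiffAt ℝ (⊤ : ℕ∞) (fun y : ℝ × ℝ => Real.sin |y.1 - y.2| ^ a) (u, v) := by
  have hne : u - v ≠ 0 := fun h0 => by simp [h0] at h
  have habs : ContDiffAt ℝ (⊤ : ℕ∞) (fun y : ℝ × ℝ => |y.1 - y.2|) (u, v) :=
    ContDiffAt.comp (g := fun t : ℝ => |t|) (u, v) (contDiffAt_abs hne)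
      (contDiffAt_fst.sub contDiffAt_snd)
  exact habs.sin.rpow_const_of_ne h.ne'

theorem I_mul_units_sq (η : ℤˣ) : (Complex.I * ((η : ℤ) : ℂ)) ^ 2 = -1 := by
  rcases Int.units_eq_one_or η with rfl | rfl <;> simp

theorem I_mul_units_ne_zero (η : ℤˣ) : Complex.I * ((η : ℤ) : ℂ) ≠ 0 := by
  simp

theorem exp_I_mul_units_mul (η : ℤˣ) (z : ℂ) : Complex.exp (Complex.I * ((η : ℤ) : ℂ) * z) =
    Complex.cos z + Complex.I * ((η : ℤ) : ℂ) * Complex.sin z := by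
  rcases Int.units_eq_one_or η with rfl | rfl
  · rw [Units.val_one, Int.cast_one, mul_one, mul_comm, Complex.exp_mul_I]
    ring
  · rw [show Complex.I * (((-1 : ℤˣ) : ℤ) : ℂ) * z = -z * Complex.I by push_cast; ring,
      Complex.exp_mul_I, Complex.cos_neg, Complex.sin_neg]
    push_cast
    ring

/-- The factor `exp (± i (u + v))` common to the sum and the difference of `exp (± 2 i u)` and
`exp (± 2 i v)`. -/
def meanPhase (η : ℤˣ) (u v : ℝ) : ℂ :=
  Complex.exp (Complex.I * ((η : ℤ) : ℂ) * (u + v))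

theorem changeVar_two_mul (η : ℤˣ) (u v : ℝ) :
    changeVar 2 η u * changeVar 2 η v = meanPhase η u v ^ 2 := by
  simp only [changeVar, meanPhase]
  rw [← Complex.exp_nat_mul, ← Complex.exp_add]
  congr 1
  push_cast
  ring

theorem changeVar_two_left (η : ℤˣ) (u v : ℝ) : changeVar 2 η u = meanPhase η u v *
    (Real.cos (u - v) + Complex.I * ((η : ℤ) : ℂ) * Real.sin (u - v)) := by
  rw [Complex.ofReal_cos, Complex.ofReal_sin, ← exp_I_mul_units_mul, meanPhase, ← Complex.exp_add]
  simp only [changeVar]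
  congr 1
  push_cast
  ring

theorem changeVar_two_right (η : ℤˣ) (u v : ℝ) : changeVar 2 η v = meanPhase η u v *
    (Real.cos (u - v) - Complex.I * ((η : ℤ) : ℂ) * Real.sin (u - v)) := by
  rw [changeVar_two_left η v u, ← neg_sub u v, Real.cos_neg, Real.sin_neg, meanPhase, meanPhase,
    add_comm (v : ℂ)]
  push_cast
  ring

theorem changeVar_two_sub (η : ℤˣ) (u v : ℝ) : changeVar 2 η u - changeVar 2 η v =
    2 * (Complex.I * ((η : ℤ) : ℂ)) * Real.sin (u - v) * meanPhase η u v := by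
  rw [changeVar_two_left η u v, changeVar_two_right η u v]
  ring

theorem changeVar_two_sub_ne_zero (η : ℤˣ) {u v : ℝ} (h : Real.sin (u - v) ≠ 0) :
    changeVar 2 η u - changeVar 2 η v ≠ 0 := by
  rw [changeVar_two_sub]
  exact mul_ne_zero (mul_ne_zero (mul_ne_zero two_ne_zero (I_mul_units_ne_zero η))
    (Complex.ofReal_ne_zero.2 h)) (Complex.exp_ne_zero _)

theorem cot_mul_changeVar_two_sub (η : ℤˣ) {u v : ℝ} (h : Real.sin (u - v) ≠ 0) :
    (Real.cot (u - v) : ℂ) * (changeVar 2 η u - changeVar 2 η v) =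
      Complex.I * ((η : ℤ) : ℂ) * (changeVar 2 η u + changeVar 2 η v) := by
  have hs : (Real.sin (u - v) : ℂ) ≠ 0 := Complex.ofReal_ne_zero.2 h
  rw [changeVar_two_sub, changeVar_two_left η u v, changeVar_two_right η u v,
    Real.cot_eq_cos_div_sin, Complex.ofReal_div]
  field_simp
  ring

theorem hasDerivAt_changeVar_two (η : ℤˣ) (t : ℝ) :
    HasDerivAt (changeVar 2 η) (2 * (Complex.I * ((η : ℤ) : ℂ)) * changeVar 2 η t) t := by
  have hlinear := (Complex.ofRealCLM.hasDerivAt (x := t)).const_mul (((η : ℤ) : ℂ) * 2 * Complex.I)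
  refine hlinear.cexp.congr_deriv ?_
  simp only [changeVar, Complex.ofRealCLM_apply, Complex.ofReal_one]
  ring

theorem neg_cot_mul_changeVar_two (η : ℤˣ) (a : ℝ) {u v : ℝ} (h : Real.sin (u - v) ≠ 0) (p q : ℂ) :
    -(2 * a * ((Real.cot (u - v) : ℂ) * (2 * (Complex.I * ((η : ℤ) : ℂ)) * changeVar 2 η u * p)
        + (Real.cot (v - u) : ℂ) * (2 * (Complex.I * ((η : ℤ) : ℂ)) * changeVar 2 η v * q))) =
      4 * (2 * a) * ((changeVar 2 η u ^ 2 * p - changeVar 2 η v ^ 2 * q)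
        / (changeVar 2 η u - changeVar 2 η v))
        - 4 * a * (changeVar 2 η u * p + changeVar 2 η v * q) := by
  have hd := changeVar_two_sub_ne_zero η h
  have hcot := cot_mul_changeVar_two_sub η h
  have hcancel := div_mul_cancel₀ (changeVar 2 η u ^ 2 * p - changeVar 2 η v ^ 2 * q) hd
  rw [cot_sub_comm u v, Complex.ofReal_neg]
  refine mul_right_cancel₀ hd ?_
  linear_combination (-4 * a * (Complex.I * ((η : ℤ) : ℂ))
      * (changeVar 2 η u * p - changeVar 2 η v * q)) * hcot - 8 * a * hcancel
    - 4 * a * (changeVar 2 η u * p - changeVar 2 η v * q)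
      * (changeVar 2 η u + changeVar 2 η v) * I_mul_units_sq η

theorem changeVar_two_mul_div_sub_sq (η : ℤˣ) {u v : ℝ} (h : Real.sin (u - v) ≠ 0) :
    changeVar 2 η u * changeVar 2 η v / (changeVar 2 η u - changeVar 2 η v) ^ 2 =
      -1 / (4 * (Real.sin (u - v) : ℂ) ^ 2) := by
  have hs : (Real.sin (u - v) : ℂ) ≠ 0 := Complex.ofReal_ne_zero.2 h
  have hE : meanPhase η u v ≠ 0 := Complex.exp_ne_zero _
  rw [changeVar_two_mul, changeVar_two_sub, mul_pow, mul_pow, mul_pow, I_mul_units_sq]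
  field_simp
  ring

/-- The local model for `ε = 2`. -/
def trigModel (η : ℤˣ) (a b ω : ℝ) : LocalModel 2 η a b ω where
  dom u v := 0 < Real.sin |u - v|
  α _ := 1
  A _ := 0
  A' _ := 0
  V₁ _ := 0
  β u v := Real.sin |u - v| ^ a
  B u v := Real.cot (u - v)
  B' u v := -1 / Real.sin (u - v) ^ 2
  κ u v := 2 * a / Real.sin (u - v) ^ 2
  ζ₁ u := 2 * (Complex.I * ((η : ℤ) : ℂ)) * changeVar 2 η u
  ζ₂ u := -4 * changeVar 2 η u
  c₁ := 0
  c₂ := -2 * a ^ 2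
  e := -4 * a
  dom_symm h := by rwa [abs_sub_comm]
  dom_open h := eventually_sin_abs_pos h
  hasDerivAt_α {u _} _ := by simpa using hasDerivAt_const u (1 : ℝ)
  hasDerivAt_A {u _} _ := hasDerivAt_const u 0
  β_symm u v := by rw [abs_sub_comm]
  hasDerivAt_β h := hasDerivAt_sin_abs_rpow a h
  hasDerivAt_B {u v} h := (hasDerivAt_cot (sin_ne_zero_of_sin_abs_pos h)).comp_sub_const u v
  α_ne_zero _ := one_ne_zero
  β_ne_zero h := (Real.rpow_pos_of_pos h a).ne'
  contDiffAt_α _ := contDiffAt_const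
  contDiffAt_β h := contDiffAt_sin_abs_rpow a h
  hasDerivAt_ζ t := hasDerivAt_changeVar_two η t
  hasDerivAt_ζ₁ t := by
    refine ((hasDerivAt_changeVar_two η t).const_mul _).congr_deriv ?_
    linear_combination 4 * changeVar 2 η t * I_mul_units_sq η
  contDiff_ζ := (contDiff_const.mul Complex.ofRealCLM.contDiff).cexp
  changeVar_ne h := sub_ne_zero.1 (changeVar_two_sub_ne_zero η (sin_ne_zero_of_sin_abs_pos h))
  one_body _ := by ring
  two_body {u v} h := by
    have hs := sin_ne_zero_of_sin_abs_pos h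
    rw [cot_sub_comm u v, Real.cot_eq_cos_div_sin, ← neg_sub u v, Real.sin_neg]
    field_simp
    linear_combination (2 * a ^ 2) * Real.sin_sq_add_cos_sq (u - v)
  constE_eq N := by simp only [constE]; ring
  one_body_deriv {u _} _ p q := by
    simp only [constC, constMinus, constZero, Fin.val_two]
    push_cast
    linear_combination (-4 * changeVar 2 η u ^ 2 * q) * I_mul_units_sq η
  two_body_deriv h p q := by
    rw [neg_cot_mul_changeVar_two η a (sin_ne_zero_of_sin_abs_pos h)]
    simp only [constC, Fin.val_two]
    push_cast
    ring
  exchange h := by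
    simp only [constC, thetaVal]
    rw [changeVar_two_mul_div_sub_sq η (sin_ne_zero_of_sin_abs_pos h)]
    push_cast
    ring
  gaugeFactor_eq x := by simp only [gaugeFactor, GaugeFactors.prod, one_mul]
  potential_eq x v s := by
    simp only [potential, Pi.add_apply, Pi.smul_apply, Finset.sum_apply, Pi.sub_apply, smul_eq_mul,
      Finset.sum_const_zero, zero_add]
    congr! 5 with i
    exact mul_comm _ _
  admissible _ _ hx := hx.2
  dom_of_mem_Ioo {u v} hu hv h := by
    have hlt : |u - v| < 1 :=
      abs_lt.2 ⟨by linarith [hu.1, hv.2], by linarith [hu.2, hv.1]⟩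
    exact Real.sin_pos_of_pos_of_lt_pi (abs_pos.2 (sub_ne_zero.2 h))
      (by linarith [Real.pi_gt_three])

end TrigonometricModel

section Conclusion

variable {N k n : ℕ} {ε : Fin 3} {η : ℤˣ} {a b ω : ℝ}

/-- The local model for each `ε`. -/
def localModel (ε : Fin 3) (η : ℤˣ) (a b ω : ℝ) : LocalModel ε η a b ω :=
  match ε with
  | 0 => rationalModel η a b ω
  | 1 => reflectionModel η a b ω
  | 2 => trigModel η a b ω

theorem contDiff_eval {ζ : ℝ → ℂ} {r : WithTop ℕ∞} (hζ : ContDiff ℝ r ζ) (P : Poly N) :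
    ContDiff ℝ r fun x : Fin N → ℝ => eval (fun i => ζ (x i)) P := by
  induction P using MvPolynomial.induction_on with
  | C c => simpa using contDiff_const
  | add p q hp hq => simpa using hp.add hq
  | mul_X p j hp => simpa using hp.mul (hζ.comp (contDiff_apply ℝ ℝ j))

theorem div_lt_succ_div (i : Fin N) : (i : ℝ) / N < ((i : ℝ) + 1) / N :=
  div_lt_div_of_pos_right (lt_add_one _) (mod_cast i.pos)

theorem Ioo_div_subset_Ioo (i : Fin N) :
    Set.Ioo ((i : ℝ) / N) (((i : ℝ) + 1) / N) ⊆ Set.Ioo 0 1 :=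
  Set.Ioo_subset_Ioo (by positivity)
    (div_le_one_of_le₀ (mod_cast i.isLt) (Nat.cast_nonneg N))

theorem strictMono_of_mem_Ioo_div {t : Fin N → ℝ}
    (ht : ∀ i : Fin N, t i ∈ Set.Ioo ((i : ℝ) / N) (((i : ℝ) + 1) / N)) : StrictMono t := by
  intro i j hij
  have hstep : ((i : ℝ) + 1) / N ≤ (j : ℝ) / N :=
    div_le_div_of_nonneg_right (mod_cast hij) (Nat.cast_nonneg N)
  exact (ht i).2.trans_le (hstep.trans (ht j).1.le)

variable [NeZero N]

theorem mem_configSpace_of_mem_Ioo (hN : 2 ≤ N) (ε : Fin 3) {t : Fin N → ℝ}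
    (hmono : StrictMono t) (ht : ∀ i, t i ∈ Set.Ioo 0 1) : t ∈ configSpace N ε := by
  fin_cases ε
  · exact hmono
  · exact ⟨hmono, (ht 0).1⟩
  · exact ⟨hmono, fun i => (trigModel 1 0 0 0).dom_of_mem_Ioo (ht _) (ht _)
      (ne_add_one_of_strictMono hN hmono i)⟩

namespace LocalModel

theorem contDiffOn_physical (m : LocalModel ε η a b ω) (hN : 2 ≤ N) (Φ : State N k) :
    ContDiffOn ℝ (⊤ : ℕ∞) (physical ε η a b ω Φ) (configSpace N ε) := by
  refine contDiffOn_pi.2 fun s x hx => ContDiffAt.contDiffWithinAt ?_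
  have hgauge : ContDiffAt ℝ (⊤ : ℕ∞) (gaugeFactor ε a b ω) x := by
    rw [_root_.funext m.gaugeFactor_eq]
    exact (m.admissible hN hx).contDiffAt_prod
  exact (Complex.ofRealCLM.contDiff.contDiffAt.comp x hgauge).mul
    (contDiff_eval m.contDiff_ζ (Φ s)).contDiffAt

theorem injOn_changeVar (m : LocalModel ε η a b ω) :
    Set.InjOn (changeVar ε η) (Set.Ioo 0 1) := fun _ hu _ hv huv =>
  by_contra fun hne => m.changeVar_ne (m.dom_of_mem_Ioo hu hv hne) huv

theorem gaugeFactor_ne_zero (m : LocalModel ε η a b ω) (hN : 2 ≤ N) {x : Fin N → ℝ}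
    (hx : x ∈ configSpace N ε) : gaugeFactor ε a b ω x ≠ 0 := by
  rw [m.gaugeFactor_eq]
  exact (m.admissible hN hx).prod_ne_zero

theorem exists_physical_ne_zero (m : LocalModel ε η a b ω) (hN : 2 ≤ N) {Φ : State N k}
    (hΦ : Φ ≠ 0) : ∃ x ∈ configSpace N ε, physical ε η a b ω Φ x ≠ 0 := by
  by_contra! h
  refine hΦ (funext fun s => MvPolynomial.funext_set
    (fun i : Fin N => changeVar ε η '' Set.Ioo ((i : ℝ) / N) (((i : ℝ) + 1) / N))
    (fun i => (Set.Ioo_infinite (div_lt_succ_div i)).image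
      (m.injOn_changeVar.mono (Ioo_div_subset_Ioo i))) fun z hz => ?_)
  choose t ht hzt using fun i => hz i (Set.mem_univ i)
  obtain rfl : (fun i => changeVar ε η (t i)) = z := funext hzt
  have hmem : t ∈ configSpace N ε := mem_configSpace_of_mem_Ioo hN ε
    (strictMono_of_mem_Ioo_div ht) fun i => Ioo_div_subset_Ioo i (ht i)
  have hzero := congrFun (h t hmem) s
  have hgauge : (gaugeFactor ε a b ω t : ℂ) ≠ 0 :=
    Complex.ofReal_ne_zero.2 (m.gaugeFactor_ne_zero hN hmem)
  simpa only [Pi.zero_apply, map_zero] using (mul_eq_zero.1 hzero).resolve_left hgauge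

end LocalModel
end Conclusion

end

end QES

theorem corollary1 (N : ℕ) [NeZero N] (hN : 2 ≤ N) (k n : ℕ) (ε : Fin 3) (η : ℤˣ) (a b ω : ℝ) :
    -- the gauge Hamiltonian is defined on the space and leaves it invariant
    (∀ Φ ∈ QES.invSpace N k n ε, ∃ Ψ ∈ QES.invSpace N k n ε, QES.GaugeMaps ε a b ω Φ Ψ) ∧
    -- on this space it is carried to the physical Hamiltonian by `Φ ↦ μ · Φ ∘ ζ`
    (∀ Φ ∈ QES.invSpace N k n ε, ∀ Ψ : QES.State N k, QES.GaugeMaps ε a b ω Φ Ψ →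
      ∀ x ∈ QES.configSpace N ε,
        QES.ham ε a b ω (QES.physical ε η a b ω Φ) x = QES.physical ε η a b ω Ψ x) ∧
    -- its eigenvectors in this space yield eigenfunctions of the physical Hamiltonian
    (∀ Φ ∈ QES.invSpace N k n ε, Φ ≠ 0 → ∀ E : ℂ, QES.GaugeMaps ε a b ω Φ (E • Φ) →
      QES.IsEigenfunction ε a b ω E (QES.physical ε η a b ω Φ)) := by
  let m := QES.localModel ε η a b ω
  have hsymm : ∀ Φ ∈ QES.invSpace N k n ε, Φ ∈ QES.symmetricStates N k :=
    fun _ h => QES.invSpace_le_symmetricStates ε h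
  refine ⟨fun Φ hΦ => QES.invSpace_le_preimage hN ε a b ω hΦ,
    fun Φ hΦ Ψ h x hx => m.ham_physical hN (hsymm Φ hΦ) h hx,
    fun Φ hΦ hne E h => ⟨m.contDiffOn_physical hN Φ, m.exists_physical_ne_zero hN hne,
      fun x hx => ?_⟩⟩
  rw [m.ham_physical hN (hsymm Φ hΦ) h hx]
  funext s
  simp only [QES.physical, Pi.smul_apply, smul_eq_mul, MvPolynomial.smul_eval]
  ring
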